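/- **Notation.** For an open set $G\subset\mathbb C$ let $A^2(G)$ be the Bergman space of holomorphic functions on $G$ that are square integrable with respect to area measure, with $L^2$ inner product $\langle\cdot,\cdot\rangle_G$ and norm $\|\cdot\|_G$. The Bergman kernel $K_G(z,w)$ is determined on $G\times G$ by $K_G(\cdot,w)\in A^2(G)$ and $h(w)=\langle h,K_G(\cdot,w)\rangle_G$ for all $h\in A^2(G)$, $w\in G$. For a kernel $K$ put $K_w(z)=K(z,w)$ and $K_a^m(z)=\frac{\partial^m}{\partial\bar w^m}K(z,w)\big|_{w=a}$. Let $D_r=\{|z|<r\}$, $D=D_1$, and $$E_N(w)=\frac1\pi\,\frac{(N+2)w^{N+1}-(N+1)w^{N+2}}{(1-w)^2}.$$ **(1) The disc.** The Bergman kernel of $D$ exists and is $K(z,w)=\pi^{-1}(1-z\bar w)^{-2}$, and $K_0^m(z)=\pi^{-1}(m+1)!\,z^m$. If $|B|<1$ then, with $K$ and $K_0^n$ given by these formulas also for $|z|\ge1$, $$K_B(z)-\sum_{n=0}^N\frac{\bar B^n}{n!}K_0^n(z)=E_N(z\bar B)\qquad (N\ge 0,\ z\bar B\ne1),$$ and for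 every $r>1$ with $r|B|<1$, $E_N(z\bar B)\to0$ as $N\to\infty$, uniformly for $z\in D_r$. **(2) General domains.** Let $\Omega\subset\mathbb C$ be a bounded domain and let $a\ne b$ be points of $\Omega$. There is a simply connected domain $\widetilde\Omega$, relatively compact in $\Omega$, with smooth real-analytic boundary and with $a,b\in\widetilde\Omega$. For every such $\widetilde\Omega$, the Bergman kernel $\widetilde K$ of $\widetilde\Omega$ exists, and there is a biholomorphic map $f:\widetilde\Omega\to D$ with $f(a)=0$, $f'(a)>0$. For every such $f$, with $F=f^{-1}$ and $B=f(b)$, the following hold. (a) For $z\in\widetilde\Omega$ and $w\in D$, $f'(z)K(f(z),w)=\widetilde K(z,F(w))\overline{F'(w)}$; in particular $\overline{f'(b)}\,f'(z)K_B(f(z))=\widetilde K_b(z)$; and for all $m\ge0$ $$f'(z)K_0^m(f(z))=\frac{\partial^m}{\partial\bar w^m}\Big[\widetilde K(z,F(w))\overline{F'(w)}\Big]_{w=0}=\sum_{n=0}^m\beta_{m,n}\widetilde K_a^n(z),\qquad \beta_{m,n}=\overline{\frac1{n!}\frac{d^m}{dw^m}\Big[(F(w)-a)^nF'(w)\Big]_{w=0}}.$$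 (b) Put $$\tilde c_{N,n}=\overline{f'(b)}\sum_{m=n}^N\frac{\bar B^m}{m!}\,\beta_{m,n}\qquad(0\le n\le N).$$ There is a connected open set $U$ with $\overline{\widetilde\Omega}\subset U\subset\Omega$, independent of $N$, to which $f$, $\widetilde K_b$ and all $\widetilde K_a^n$ extend holomorphically (the extensions are denoted by the same symbols), and there are constants $r>1$ with $r|B|<1$ and $M$ such that $|f|<r$ and $|f'|\le M$ on $U$, and for all $N\ge 0$ and $z\in U$ $$\widetilde K_b(z)-\sum_{n=0}^N\tilde c_{N,n}\widetilde K_a^n(z)=\overline{f'(b)}\,f'(z)\,E_N(f(z)\overline B),$$ $$\Big|\widetilde K_b(z)-\sum_{n=0}^N\tilde c_{N,n}\widetilde K_a^n(z)\Big|\le |f'(b)|\,M\,\frac{(N+2)\rho^{N+1}+(N+1)\rho^{N+2}}{\pi(1-\rho)^2},\qquad\rho=r|B|.$$ In particular, for every $\varepsilon>0$ there is $N_0$ such that for all $N\ge N_0$ the left-hand side of the last display is $<\varepsilon$ for all $z\in U$. (c) For every $N\ge0$ and every $h\in A^2(\widetilde\Omega)$, $$h(b)-\sum_{n=0}^N\overline{\tilde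 c_{N,n}}\,h^{(n)}(a)=\Big\langle h,\ \widetilde K_b-\sum_{n=0}^N\tilde c_{N,n}\widetilde K_a^n\Big\rangle_{\widetilde\Omega},$$ and for every $\varepsilon>0$ there is $N_0$ such that for all $N\ge N_0$ and all $h\in A^2(\widetilde\Omega)$ the modulus of the left-hand side is at most $\varepsilon\|h\|_{\widetilde\Omega}$. -/

import Mathlib

open Set Metric MeasureTheory Topology
open scoped ComplexConjugate

/-- `h` belongs to the Bergman space of `Ω`: it is holomorphic on `Ω` and square integrable
there with respect to area measure. -/
def InBergmanSpace (Ω : Set ℂ) (h : ℂ → ℂ) : Prop :=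
  DifferentiableOn ℂ h Ω ∧ MemLp h 2 (volume.restrict Ω)

/-- The `L²` pairing on `Ω` with respect to area measure, conjugate linear in the second entry. -/
noncomputable def areaInner (Ω : Set ℂ) (h k : ℂ → ℂ) : ℂ :=
  ∫ x in Ω, h x * conj (k x)

/-- The `L²` norm on `Ω` with respect to area measure. -/
noncomputable def areaNorm (Ω : Set ℂ) (h : ℂ → ℂ) : ℝ :=
  Real.sqrt (∫ x in Ω, ‖h x‖ ^ 2)

/-- `K` is the reproducing kernel of the Bergman space of `Ω`: each `K(·, w)`, `w ∈ Ω`, lies in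
the Bergman space, and `h(w) = ⟨h, K(·, w)⟩` for all `h` in the Bergman space. -/
def IsBergmanKernel (Ω : Set ℂ) (K : ℂ → ℂ → ℂ) : Prop :=
  ∀ w ∈ Ω, InBergmanSpace Ω (fun z => K z w) ∧
    ∀ h : ℂ → ℂ, InBergmanSpace Ω h → areaInner Ω h (fun z => K z w) = h w

theorem areaInner_conj (Ω : Set ℂ) (h k : ℂ → ℂ) :
    conj (areaInner Ω h k) = areaInner Ω k h := by
  unfold areaInner
  rw [← integral_conj]
  congr 1
  funext x
  simp [mul_comm]

/-- The Bergman kernel is unique on `Ω × Ω`. -/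
theorem IsBergmanKernel.unique {Ω : Set ℂ} {K L : ℂ → ℂ → ℂ} (hK : IsBergmanKernel Ω K)
    (hL : IsBergmanKernel Ω L) {z w : ℂ} (hz : z ∈ Ω) (hw : w ∈ Ω) : K z w = L z w := by
  have h1 := (hL z hz).2 _ (hK w hw).1
  have h2 := (hK w hw).2 _ (hL z hz).1
  have h3 := (hL z hz).2 _ (hL w hw).1
  have h4 := (hL w hw).2 _ (hL z hz).1
  rw [← h1, ← h3, ← areaInner_conj, h2, ← areaInner_conj, h4]

/-- The Bergman kernel `K(z, w)` of `Ω` (values outside `Ω × Ω` are irrelevant). -/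
noncomputable def bergmanKernel (Ω : Set ℂ) : ℂ → ℂ → ℂ :=
  Classical.epsilon (IsBergmanKernel Ω)

/-- The Wirtinger derivative `∂g/∂w̄ = (∂g/∂x + i ∂g/∂y) / 2`. -/
noncomputable def dbar (g : ℂ → ℂ) (w : ℂ) : ℂ :=
  (fderiv ℝ g w 1 + Complex.I * fderiv ℝ g w Complex.I) / 2

/-- `K_a^m(z) = (∂/∂w̄)^m K(z, w)` at `w = a`. -/
noncomputable def kernelDeriv (K : ℂ → ℂ → ℂ) (a : ℂ) (m : ℕ) (z : ℂ) : ℂ :=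
  (dbar^[m] (fun w => K z w)) a

/-- The explicit function `π⁻¹ (1 - z w̄)⁻²`. -/
noncomputable def diskKernel (z w : ℂ) : ℂ :=
  (Real.pi : ℂ)⁻¹ * ((1 - z * conj w) ^ 2)⁻¹

/-- The explicit Taylor remainder `E_N(w)`. -/
noncomputable def taylorRemainder (N : ℕ) (w : ℂ) : ℂ :=
  (Real.pi : ℂ)⁻¹ * (((N : ℂ) + 2) * w ^ (N + 1) - ((N : ℂ) + 1) * w ^ (N + 2)) / (1 - w) ^ 2

/-- The explicit majorant of `|E_N(w)|` for `|w| ≤ ρ < 1`. -/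
noncomputable def remainderBound (N : ℕ) (ρ : ℝ) : ℝ :=
  Real.pi⁻¹ * (((N : ℝ) + 2) * ρ ^ (N + 1) + ((N : ℝ) + 1) * ρ ^ (N + 2)) / (1 - ρ) ^ 2

/-- The boundary of `G` is a smooth real-analytic curve: near every boundary point, `G` is the
set where a real-analytic function with non-vanishing differential is negative. -/
def HasRealAnalyticBoundary (G : Set ℂ) : Prop :=
  ∀ p ∈ frontier G, ∃ ρ : ℂ → ℝ, AnalyticAt ℝ ρ p ∧ fderiv ℝ ρ p ≠ 0 ∧
    ∀ᶠ z in 𝓝 p, (z ∈ G ↔ ρ z < 0)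

/-- `G` is a simply connected subdomain of the bounded domain `Ω`, relatively compact in `Ω`,
with real-analytic boundary, containing `a` and `b`. -/
structure IsProbeDomain (Ω G : Set ℂ) (a b : ℂ) : Prop where
  isOpen : IsOpen G
  simplyConnected : IsSimplyConnected G
  isCompact_closure : IsCompact (closure G)
  closure_subset : closure G ⊆ Ω
  analyticBoundary : HasRealAnalyticBoundary G
  left_mem : a ∈ G
  right_mem : b ∈ G

/-- `f` is the Riemann map of `G` onto the unit disc with `f(a) = 0` and `f'(a) > 0`. -/
structure IsRiemannMap (G : Set ℂ) (a : ℂ) (f : ℂ → ℂ) : Prop where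
  holomorphic : DifferentiableOn ℂ f G
  bijOn : BijOn f G (ball 0 1)
  map_base : f a = 0
  deriv_re_pos : 0 < (deriv f a).re
  deriv_im : (deriv f a).im = 0

/-- The coefficient of `K̃_a^n` in `(∂/∂w̄)^m [K̃(z, F(w)) conj F'(w)]` at `w = 0`: the conjugate
of `(1/n!) (d/dw)^m [(F(w) - a)^n F'(w)]` at `w = 0`. -/
noncomputable def pullbackCoeff (F : ℂ → ℂ) (a : ℂ) (m n : ℕ) : ℂ :=
  conj (iteratedDeriv m (fun w => (F w - a) ^ n * deriv F w) 0 / (n.factorial : ℂ))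

/-- The coefficients `c̃_n` (for `0 ≤ n ≤ N`) of the approximation of `K̃_b`:
`conj f'(b) ∑_{m=n}^N (conj f(b))^m / m! · (coefficient of K̃_a^n in the pull-back of K_0^m)`. -/
noncomputable def approxCoeff (f F : ℂ → ℂ) (a b : ℂ) (N n : ℕ) : ℂ :=
  conj (deriv f b) *
    ∑ m ∈ Finset.Icc n N, conj (f b) ^ m / (m.factorial : ℂ) * pullbackCoeff F a m n

/-! On the disc everything is explicit. The integral of `h` against `conj z ^ m` over a circle of
radius `r` is a Cauchy integral, because `conj z = r ^ 2 / z` there. Integrating in `r` shows that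
pairing with `K_0^m` returns the `m`-th derivative of `h` at `0`. The kernel minus its Taylor
polynomial in `conj B` is a tail of the differentiated geometric series, which is the closed form
`E_N`. It tends to zero uniformly on every disc of radius `r` with `r * ‖B‖ < 1`, and the case `r =
1` already gives the reproducing property.

A biholomorphic map `f` onto the disc acts on Bergman spaces isometrically by pulling back
one-forms, `h ↦ (h ∘ f) * f'`, since the Jacobian `‖f'‖ ^ 2` is `f' * conj f'`. Hence the kernel of
the domain is `conj f'(w) * f'(z) * K(f z, f w)`. For fixed `z` it is the conjugate of a holomorphic
function of `w`, so iterated `dbar` is conjugated iterated complex differentiation. A Faà di Bruno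
formula for one-forms (`iteratedDeriv_pullback`) then expresses the pulled-back `K_0^m` through the
`K̃_a^n` with `n ≤ m`. Pulling back the Taylor identity of the disc and exchanging a triangular sum
gives the approximation of `K̃_b`, with error `conj f'(b) * f' * E_N(f * conj B)`. Pairing with `h`
gives the quadrature identity.

Uniformity beyond the closure needs `f` to continue across the boundary. A real-analytic boundary
curve is complexified to a chart in which the domain is a half disc (`exists_boundary_chart_of_lt`).
In it `‖f‖` tends to `1` at the diameter because the sublevel sets of `‖f‖` are compact, and Schwarz
reflection applies (`exists_reflection`). The local extensions patch together
(`exists_differentiableOn_extension`). Since `‖f‖ ≤ 1` on the compact closure, the bound `‖f‖ < r`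
survives on a neighbourhood, and the identity theorem carries the error formula there.

Existence of `f` is the Riemann mapping theorem, proved by Koebe's extremal problem with Montel and
Hurwitz. The domain itself is a sublevel set of a Riemann map of a simply connected open set through
`a` and `b`, obtained by dragging a ball along `Ω` with homeomorphisms. -/

/-! ### Wirtinger derivatives of conjugates of holomorphic functions -/

theorem dbar_congr {g h : ℂ → ℂ} {w : ℂ} (hgh : g =ᶠ[𝓝 w] h) : dbar g w = dbar h w := by
  simp only [dbar, hgh.fderiv_eq]

theorem dbar_eventuallyEq {g h : ℂ → ℂ} {w : ℂ} (hgh : g =ᶠ[𝓝 w] h) :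
    dbar g =ᶠ[𝓝 w] dbar h :=
  hgh.eventuallyEq_nhds.mono fun _ hz => dbar_congr hz

/-- Locality is what makes kernel derivatives computable: a kernel is determined only on `Ω × Ω`,
and an explicit formula may be substituted near the base point. -/
theorem dbar_iterate_eventuallyEq {g h : ℂ → ℂ} {w : ℂ} (hgh : g =ᶠ[𝓝 w] h) (m : ℕ) :
    dbar^[m] g =ᶠ[𝓝 w] dbar^[m] h := by
  induction m generalizing g h with
  | zero => exact hgh
  | succ m ih => exact ih (dbar_eventuallyEq hgh)

/-- The real differential is `v ↦ conj (g' * v)`, with values `conj g'` at `1` and `-I * conj g'` at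
`I`. The two terms of `dbar` therefore agree and their mean is `conj g'`. -/
theorem dbar_conj_comp {g : ℂ → ℂ} {w : ℂ} (hg : DifferentiableAt ℂ g w) :
    dbar (fun z => conj (g z)) w = conj (deriv g w) := by
  have h1 : HasFDerivAt g ((ContinuousLinearMap.toSpanSingleton ℂ (deriv g w)).restrictScalars ℝ) w :=
    hg.hasDerivAt.hasFDerivAt.restrictScalars ℝ
  have h2 := Complex.conjCLE.toContinuousLinearMap.hasFDerivAt.comp w h1
  have h3 : fderiv ℝ (fun z => conj (g z)) w = _ := h2.fderiv
  simp only [dbar, h3]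
  simp
  ring_nf
  simp
  ring

theorem dbar_iterate_conj_comp {g : ℂ → ℂ} {w : ℂ} (hg : AnalyticAt ℂ g w) (m : ℕ) :
    (dbar^[m] (fun z => conj (g z))) w = conj (iteratedDeriv m g w) := by
  induction m generalizing g with
  | zero => simp
  | succ m ih =>
    have h : dbar (fun z => conj (g z)) =ᶠ[𝓝 w] fun z => conj (deriv g z) := by
      filter_upwards [hg.eventually_analyticAt] with z hz
      exact dbar_conj_comp hz.differentiableAt
    rw [Function.iterate_succ_apply, (dbar_iterate_eventuallyEq h m).eq_of_nhds,
      ih hg.deriv, iteratedDeriv_succ']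

theorem dbar_iterate_of_eventuallyEq_conj {k g : ℂ → ℂ} {w : ℂ} (hg : AnalyticAt ℂ g w)
    (hk : k =ᶠ[𝓝 w] fun z => conj (g z)) (m : ℕ) :
    (dbar^[m] k) w = conj (iteratedDeriv m g w) := by
  rw [(dbar_iterate_eventuallyEq hk m).eq_of_nhds, dbar_iterate_conj_comp hg]

/-! ### Taylor coefficients of pulled-back one-forms -/

section Pullback

variable {φ g : ℂ → ℂ} {p : ℂ}

/-- Composition and multiplication preserve the order of vanishing. The free factor `k` closes the
induction: differentiating gives `g'(φ) * (φ' * k) + g(φ) * k'`, two products of the same shape. -/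
theorem iteratedDeriv_comp_mul_eq_zero (hφ : AnalyticAt ℂ φ p) (m : ℕ) :
    ∀ {g k : ℂ → ℂ}, AnalyticAt ℂ g (φ p) → AnalyticAt ℂ k p →
      (∀ n ≤ m, iteratedDeriv n g (φ p) = 0) →
      iteratedDeriv m (fun w => g (φ w) * k w) p = 0 := by
  induction m with
  | zero =>
    intro g k _ _ h0
    have := h0 0 le_rfl
    simp only [iteratedDeriv_zero] at this ⊢
    simp [this]
  | succ m ih =>
    intro g k hg hk h0
    have hφe := hφ.eventually_analyticAt
    have hge := hφ.continuousAt.eventually hg.eventually_analyticAt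
    have hd : deriv (fun w => g (φ w) * k w) =ᶠ[𝓝 p]
        (fun w => deriv g (φ w) * (deriv φ w * k w)) + fun w => g (φ w) * deriv k w := by
      filter_upwards [hφe, hge, hk.eventually_analyticAt] with w h1 h2 h3
      have := ((h2.differentiableAt.hasDerivAt.comp w h1.differentiableAt.hasDerivAt).mul
        h3.differentiableAt.hasDerivAt).deriv
      simp only [Pi.add_apply]
      rw [← mul_assoc]
      exact this
    have hgφ : AnalyticAt ℂ (fun w => g (φ w)) p := hg.comp hφ
    have hgφ' : AnalyticAt ℂ (fun w => deriv g (φ w)) p := AnalyticAt.comp (g := deriv g) hg.deriv hφ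
    have ha1 : AnalyticAt ℂ (fun w => deriv g (φ w) * (deriv φ w * k w)) p :=
      hgφ'.mul (hφ.deriv.mul hk)
    have ha2 : AnalyticAt ℂ (fun w => g (φ w) * deriv k w) p := hgφ.mul hk.deriv
    rw [iteratedDeriv_succ', hd.iteratedDeriv_eq m, iteratedDeriv_add ha1.contDiffAt ha2.contDiffAt,
      ih (k := fun w => deriv φ w * k w) hg.deriv (hφ.deriv.mul hk) fun n hn => by
        rw [← iteratedDeriv_succ']; exact h0 _ (by omega),
      ih hg hk.deriv fun n hn => h0 n (by omega), add_zero]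

theorem iteratedDeriv_sub_pow (c : ℂ) (n j : ℕ) :
    iteratedDeriv n (fun w : ℂ => (w - c) ^ j) c = if n = j then (j.factorial : ℂ) else 0 := by
  have h := congrFun (iteratedDeriv_comp_sub_const n (fun w : ℂ => w ^ j) c) c
  rw [h, sub_self, iteratedDeriv_fun_pow_zero]
  split_ifs <;> simp

/-- Faà di Bruno's formula for a pulled back one-form, in terms of powers of `φ - φ p`. -/
theorem iteratedDeriv_pullback (hφ : AnalyticAt ℂ φ p) (hg : AnalyticAt ℂ g (φ p)) (m : ℕ) :
    iteratedDeriv m (fun w => g (φ w) * deriv φ w) p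
      = ∑ n ∈ Finset.range (m + 1),
        iteratedDeriv m (fun w => (φ w - φ p) ^ n * deriv φ w) p / (n.factorial : ℂ)
          * iteratedDeriv n g (φ p) := by
  -- The Taylor polynomial of `g` of degree `m`. As `g - T` vanishes to order `m` at `φ p`, only the
  -- pull-back of `T`, a combination of powers of `φ - φ p`, contributes.
  set T : ℂ → ℂ := fun u => ∑ n ∈ Finset.range (m + 1),
    (iteratedDeriv n g (φ p) / (n.factorial : ℂ)) * (u - φ p) ^ n with hT
  have hterm : ∀ n, AnalyticAt ℂ (fun u : ℂ => (u - φ p) ^ n) (φ p) := fun n => by fun_prop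
  have hTa : AnalyticAt ℂ T (φ p) := by
    rw [hT]; fun_prop
  have h0 : iteratedDeriv m (fun w => (g - T) (φ w) * deriv φ w) p = 0 := by
    refine iteratedDeriv_comp_mul_eq_zero hφ m (hg.sub hTa) hφ.deriv fun n hn => ?_
    rw [iteratedDeriv_sub hg.contDiffAt hTa.contDiffAt, hT, iteratedDeriv_fun_sum
      fun i _ => contDiffAt_const.mul (hterm i).contDiffAt]
    simp only [iteratedDeriv_const_mul_field, iteratedDeriv_sub_pow]
    rw [Finset.sum_eq_single n]
    · simp [Nat.factorial_ne_zero]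
    · intro b _ hb
      simp [hb.symm]
    · intro h; exact absurd (Finset.mem_range.2 (by omega)) h
  have hgφ : AnalyticAt ℂ (fun w => g (φ w)) p := hg.comp hφ
  have hTφ : AnalyticAt ℂ (fun w => T (φ w)) p := AnalyticAt.comp (g := T) hTa hφ
  have h1 : (fun w => (g - T) (φ w) * deriv φ w)
      = (fun w => g (φ w) * deriv φ w) - fun w => T (φ w) * deriv φ w := by
    funext w; simp [sub_mul]
  have ha1 : AnalyticAt ℂ (fun w => g (φ w) * deriv φ w) p := hgφ.mul hφ.deriv
  have ha2 : AnalyticAt ℂ (fun w => T (φ w) * deriv φ w) p := hTφ.mul hφ.deriv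
  rw [h1, iteratedDeriv_sub ha1.contDiffAt ha2.contDiffAt,
    sub_eq_zero] at h0
  rw [h0]
  have h2 : (fun w => T (φ w) * deriv φ w) = fun w => ∑ n ∈ Finset.range (m + 1),
      (iteratedDeriv n g (φ p) / (n.factorial : ℂ)) * ((φ w - φ p) ^ n * deriv φ w) := by
    funext w
    simp only [hT, Finset.sum_mul, mul_assoc]
  have ht2 : ∀ n, AnalyticAt ℂ (fun w => (φ w - φ p) ^ n * deriv φ w) p := fun n =>
    ((hφ.sub analyticAt_const).pow n).mul hφ.deriv
  rw [h2, iteratedDeriv_fun_sum fun i _ => contDiffAt_const.mul (ht2 i).contDiffAt]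
  simp only [iteratedDeriv_const_mul_field]
  exact Finset.sum_congr rfl fun n _ => by ring

end Pullback

/-! ### The explicit disc kernel and its Taylor remainder -/

/-- `w ↦ π⁻¹ (1 - c w)⁻²`. -/
noncomputable def invSq (c w : ℂ) : ℂ := (Real.pi : ℂ)⁻¹ * ((1 - c * w) ^ 2)⁻¹

theorem diskKernel_eq_conj (z w : ℂ) : diskKernel z w = conj (invSq (conj z) w) := by
  simp [diskKernel, invSq]

theorem diskKernel_eq_invSq (z w : ℂ) : diskKernel z w = invSq (conj w) z := by
  simp [diskKernel, invSq, mul_comm]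

theorem analyticAt_invSq {c w : ℂ} (h : c * w ≠ 1) : AnalyticAt ℂ (invSq c) w := by
  unfold invSq
  refine analyticAt_const.mul (AnalyticAt.inv (by fun_prop) ?_)
  exact pow_ne_zero _ (sub_ne_zero.2 h.symm)

theorem iteratedDeriv_invSq (c : ℂ) (m : ℕ) {w : ℂ} (h : c * w ≠ 1) :
    iteratedDeriv m (invSq c) w
      = (Real.pi : ℂ)⁻¹ * ((m + 1).factorial : ℂ) * c ^ m * ((1 - c * w) ^ (m + 2))⁻¹ := by
  induction m generalizing w with
  | zero => simp [invSq]
  | succ m ih =>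
    have ho : ∀ᶠ u in 𝓝 w, c * u ≠ 1 :=
      (continuous_const.mul continuous_id).continuousAt.eventually_ne h
    have he : iteratedDeriv m (invSq c) =ᶠ[𝓝 w] fun u =>
        (Real.pi : ℂ)⁻¹ * ((m + 1).factorial : ℂ) * c ^ m * ((1 - c * u) ^ (m + 2))⁻¹ :=
      ho.mono fun u hu => ih hu
    have hne : 1 - c * w ≠ 0 := sub_ne_zero.2 h.symm
    have hd : HasDerivAt (fun u : ℂ => 1 - c * u) (-c) w := by
      simpa using ((hasDerivAt_id w).const_mul c).const_sub 1
    have hd2 := ((hd.fun_pow (m + 2)).fun_inv (pow_ne_zero _ hne)).const_mul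
      ((Real.pi : ℂ)⁻¹ * ((m + 1).factorial : ℂ) * c ^ m)
    rw [iteratedDeriv_succ, he.deriv_eq, hd2.deriv, Nat.factorial_succ (m + 1)]
    push_cast
    field_simp
    ring

theorem iteratedDeriv_invSq_zero (c : ℂ) (m : ℕ) :
    iteratedDeriv m (invSq c) 0 = (Real.pi : ℂ)⁻¹ * ((m + 1).factorial : ℂ) * c ^ m := by
  rw [iteratedDeriv_invSq c m (by simp)]; simp

theorem kernelDeriv_diskKernel (z : ℂ) (m : ℕ) :
    kernelDeriv diskKernel 0 m z = (Real.pi : ℂ)⁻¹ * ((m + 1).factorial : ℂ) * z ^ m := by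
  unfold kernelDeriv
  rw [dbar_iterate_of_eventuallyEq_conj (analyticAt_invSq (c := conj z) (by simp))
    (Filter.Eventually.of_forall fun w => diskKernel_eq_conj z w), iteratedDeriv_invSq_zero]
  simp

/-- Up to the factor `π⁻¹` the Taylor polynomial is the sum of `(n + 1) * x ^ n` with `x = z * conj
B`. Clearing `(1 - x) ^ 2` turns the claim into a polynomial identity, so no bound on `‖x‖` is
needed. -/
theorem diskKernel_sub_taylor (B : ℂ) (N : ℕ) (z : ℂ) (h : z * conj B ≠ 1) :
    diskKernel z B - ∑ n ∈ Finset.range (N + 1),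
        conj B ^ n / (n.factorial : ℂ) * kernelDeriv diskKernel 0 n z
      = taylorRemainder N (z * conj B) := by
  simp only [kernelDeriv_diskKernel, diskKernel, taylorRemainder]
  have hterm : ∀ n : ℕ, conj B ^ n / (n.factorial : ℂ)
      * ((Real.pi : ℂ)⁻¹ * ((n + 1).factorial : ℂ) * z ^ n)
      = (Real.pi : ℂ)⁻¹ * ((n + 1 : ℂ) * (z * conj B) ^ n) := fun n => by
    have : (n.factorial : ℂ) ≠ 0 := by exact_mod_cast Nat.factorial_ne_zero n
    rw [Nat.factorial_succ, mul_pow]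
    push_cast
    field_simp
  simp only [hterm, ← Finset.mul_sum]
  set x := z * conj B
  have hx : 1 - x ≠ 0 := sub_ne_zero.2 h.symm
  have hsum : (∑ n ∈ Finset.range (N + 1), ((n + 1 : ℂ) * x ^ n)) * (1 - x) ^ 2
      = 1 - (N + 2) * x ^ (N + 1) + (N + 1) * x ^ (N + 2) := by
    induction N with
    | zero => simp; ring
    | succ N ih => rw [Finset.sum_range_succ, add_mul, ih]; push_cast; ring
  have hpi : (Real.pi : ℂ) ≠ 0 := by exact_mod_cast Real.pi_ne_zero
  field_simp
  linear_combination -hsum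

theorem norm_taylorRemainder_le (N : ℕ) {ρ : ℝ} (hρ : ρ < 1) {w : ℂ} (hw : ‖w‖ ≤ ρ) :
    ‖taylorRemainder N w‖ ≤ remainderBound N ρ := by
  unfold taylorRemainder remainderBound
  have h0 : 0 ≤ ρ := (norm_nonneg w).trans hw
  have hpi := Real.pi_pos
  have h1 : 1 - ρ ≤ ‖1 - w‖ := by
    have := norm_sub_norm_le (1 : ℂ) w
    rw [norm_one] at this
    linarith
  have hN2 : ‖(N : ℂ) + 2‖ = (N : ℝ) + 2 := by
    rw [show (N : ℂ) + 2 = ((N + 2 : ℕ) : ℂ) by push_cast; rfl, Complex.norm_natCast]; push_cast; rfl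
  have hN1 : ‖(N : ℂ) + 1‖ = (N : ℝ) + 1 := by
    rw [show (N : ℂ) + 1 = ((N + 1 : ℕ) : ℂ) by push_cast; rfl, Complex.norm_natCast]; push_cast; rfl
  rw [norm_div, norm_mul, norm_inv, Complex.norm_real, Real.norm_of_nonneg hpi.le, norm_pow]
  have h2 : 0 < 1 - ρ := by linarith
  gcongr
  refine (norm_sub_le _ _).trans ?_
  rw [norm_mul, norm_mul, norm_pow, norm_pow, hN1, hN2]
  gcongr

theorem tendsto_remainderBound {ρ : ℝ} (h0 : 0 ≤ ρ) (hρ : ρ < 1) :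
    Filter.Tendsto (fun N => remainderBound N ρ) Filter.atTop (𝓝 0) := by
  unfold remainderBound
  have h1 : Filter.Tendsto (fun n : ℕ => (n : ℝ) * ρ ^ n) Filter.atTop (𝓝 0) :=
    tendsto_self_mul_const_pow_of_lt_one h0 hρ
  have h2 : Filter.Tendsto (fun n : ℕ => ρ ^ n) Filter.atTop (𝓝 0) :=
    tendsto_pow_atTop_nhds_zero_of_lt_one h0 hρ
  have h3 := ((((h1.mul_const ρ).add (h2.mul_const (2 * ρ))).add
    ((h1.mul_const (ρ ^ 2)).add (h2.mul_const (ρ ^ 2)))).const_mul (Real.pi⁻¹)).div_const ((1 - ρ) ^ 2)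
  simp only [zero_mul, add_zero, mul_zero, zero_div] at h3
  refine h3.congr fun N => ?_
  ring

theorem exists_forall_remainderBound_lt {ρ : ℝ} (h0 : 0 ≤ ρ) (hρ : ρ < 1) (C : ℝ) {ε : ℝ}
    (hε : 0 < ε) : ∃ N₀ : ℕ, ∀ N ≥ N₀, C * remainderBound N ρ < ε := by
  have h := (tendsto_remainderBound h0 hρ).const_mul C
  rw [mul_zero] at h
  exact Filter.eventually_atTop.1 (h.eventually_lt_const hε)

theorem mul_conj_ne_one {z B : ℂ} {r : ℝ} (hz : ‖z‖ < r) (hr : r * ‖B‖ < 1) :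
    z * conj B ≠ 1 := by
  intro h
  have h1 : ‖z * conj B‖ = 1 := by rw [h, norm_one]
  rw [norm_mul, Complex.norm_conj] at h1
  nlinarith [norm_nonneg B]

theorem norm_taylorRemainder_mul_conj_le (N : ℕ) {z B : ℂ} {r : ℝ} (hz : ‖z‖ < r)
    (hr : r * ‖B‖ < 1) : ‖taylorRemainder N (z * conj B)‖ ≤ remainderBound N (r * ‖B‖) := by
  refine norm_taylorRemainder_le N hr ?_
  rw [norm_mul, Complex.norm_conj]
  exact mul_le_mul_of_nonneg_right hz.le (norm_nonneg _)

theorem exists_forall_norm_taylorRemainder_lt (B : ℂ) {r : ℝ} (h0 : 0 ≤ r) (hr : r * ‖B‖ < 1)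
    {ε : ℝ} (hε : 0 < ε) : ∃ N₀ : ℕ, ∀ N ≥ N₀, ∀ z ∈ ball (0 : ℂ) r,
      ‖taylorRemainder N (z * conj B)‖ < ε := by
  obtain ⟨N₀, h⟩ := exists_forall_remainderBound_lt (mul_nonneg h0 (norm_nonneg B)) hr 1 hε
  refine ⟨N₀, fun N hN z hz => ?_⟩
  have := h N hN
  rw [one_mul] at this
  exact (norm_taylorRemainder_mul_conj_le N (by simpa using hz) hr).trans_lt this

/-! ### The reproducing property on the disc, in polar coordinates -/

theorem polarCoord_symm_eq_circleMap (r θ : ℝ) :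
    Complex.polarCoord.symm (r, θ) = circleMap 0 r θ := by
  rw [Complex.polarCoord_symm_apply, circleMap, zero_add, Complex.exp_mul_I]
  simp

theorem continuous_complexPolarCoord_symm : Continuous (Complex.polarCoord.symm : ℝ × ℝ → ℂ) := by
  have : (Complex.polarCoord.symm : ℝ × ℝ → ℂ)
      = fun p => (p.1 : ℂ) * (Real.cos p.2 + Real.sin p.2 * Complex.I) := by
    funext p; exact Complex.polarCoord_symm_apply p
  rw [this]
  fun_prop

theorem polarCoord_target_inter_preimage :
    Complex.polarCoord.target ∩ Complex.polarCoord.symm ⁻¹' (ball 0 1)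
      = Ioo (0 : ℝ) 1 ×ˢ Ioo (-Real.pi) Real.pi := by
  ext ⟨r, θ⟩
  simp only [Complex.polarCoord_target, mem_inter_iff, mem_prod, mem_Ioi, mem_Ioo, mem_preimage,
    mem_ball_zero_iff, Complex.norm_polarCoord_symm]
  constructor
  · rintro ⟨⟨h1, h2⟩, h3⟩
    exact ⟨⟨h1, by rwa [abs_of_pos h1] at h3⟩, h2⟩
  · rintro ⟨⟨h1, h3⟩, h2⟩
    exact ⟨⟨h1, h2⟩, by rwa [abs_of_pos h1]⟩

theorem integrableOn_comp_polarCoord_symm {g : ℂ → ℂ} (hg : ContinuousOn g (ball 0 1))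
    (hi : IntegrableOn g (ball 0 1)) :
    IntegrableOn (fun p : ℝ × ℝ => p.1 • g (Complex.polarCoord.symm p))
      (Ioo (0 : ℝ) 1 ×ˢ Ioo (-Real.pi) Real.pi) := by
  have hm : MeasurableSet (Ioo (0 : ℝ) 1 ×ˢ Ioo (-Real.pi) Real.pi) :=
    measurableSet_Ioo.prod measurableSet_Ioo
  have hms : MeasurableSet (Complex.polarCoord.symm ⁻¹' (ball 0 1) : Set (ℝ × ℝ)) :=
    continuous_complexPolarCoord_symm.measurable measurableSet_ball
  refine ⟨ContinuousOn.aestronglyMeasurable ?_ hm, ?_⟩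
  · refine continuous_fst.continuousOn.smul (hg.comp continuous_complexPolarCoord_symm.continuousOn ?_)
    rw [← polarCoord_target_inter_preimage]
    exact fun p hp => hp.2
  · have h := Complex.lintegral_comp_polarCoord_symm
      ((ball (0 : ℂ) 1).indicator fun z => ‖g z‖ₑ)
    rw [lintegral_indicator measurableSet_ball] at h
    unfold HasFiniteIntegral
    refine lt_of_le_of_lt (le_of_eq ?_) (h.trans_lt hi.2)
    rw [← polarCoord_target_inter_preimage, inter_comm, ← Measure.restrict_restrict hms,
      ← lintegral_indicator hms]
    refine setLIntegral_congr_fun Complex.polarCoord.open_target.measurableSet fun p hp => ?_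
    have hp1 : 0 < p.1 := hp.1
    by_cases hpb : Complex.polarCoord.symm p ∈ ball (0 : ℂ) 1
    · rw [indicator_of_mem (by exact hpb), indicator_of_mem hpb, enorm_smul,
        Real.enorm_of_nonneg hp1.le, smul_eq_mul]
    · rw [indicator_of_notMem (by exact hpb), indicator_of_notMem hpb, smul_zero]

theorem integral_ball_eq_polar {g : ℂ → ℂ} (hg : ContinuousOn g (ball 0 1))
    (hi : IntegrableOn g (ball 0 1)) :
    ∫ x in ball (0 : ℂ) 1, g x
      = ∫ r in Ioo (0 : ℝ) 1, ∫ θ in Ioo (-Real.pi) Real.pi, (r : ℂ) * g (circleMap 0 r θ) := by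
  have hms : MeasurableSet (Complex.polarCoord.symm ⁻¹' (ball 0 1) : Set (ℝ × ℝ)) :=
    continuous_complexPolarCoord_symm.measurable measurableSet_ball
  have h := Complex.integral_comp_polarCoord_symm ((ball (0 : ℂ) 1).indicator g)
  rw [integral_indicator measurableSet_ball] at h
  rw [← h]
  have h2 := setIntegral_prod _ (integrableOn_comp_polarCoord_symm hg hi)
  simp only [polarCoord_symm_eq_circleMap, Complex.real_smul] at h2
  rw [← h2, ← polarCoord_target_inter_preimage, inter_comm, Measure.volume_eq_prod,
    ← Measure.restrict_restrict hms, ← integral_indicator hms]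
  refine setIntegral_congr_fun Complex.polarCoord.open_target.measurableSet fun p hp => ?_
  by_cases hpb : Complex.polarCoord.symm p ∈ ball (0 : ℂ) 1
  · rw [indicator_of_mem (by exact hpb), indicator_of_mem (by exact hpb), Complex.real_smul]
  · rw [indicator_of_notMem (by exact hpb), indicator_of_notMem (by exact hpb), smul_zero]

/-- On the circle `conj z = r ^ 2 / z`, so the integrand becomes that of Cauchy's formula for the
`m`-th derivative at `0`. Periodicity moves the range of `θ` from `(-π, π)` to `[0, 2π]`. -/
theorem integral_circleMap_mul_conj_pow {h : ℂ → ℂ} (hh : DifferentiableOn ℂ h (ball 0 1))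
    {r : ℝ} (h0 : 0 < r) (h1 : r < 1) (m : ℕ) :
    ∫ θ in Ioo (-Real.pi) Real.pi, (r : ℂ) * (h (circleMap 0 r θ) * conj (circleMap 0 r θ ^ m))
      = ((r ^ (2 * m + 1) : ℝ) : ℂ) * (2 * Real.pi / m.factorial * iteratedDeriv m h 0) := by
  have hc := (hh.mono (closedBall_subset_ball h1)).circleIntegral_one_div_sub_center_pow_smul h0 m
  rw [circleIntegral] at hc
  have hper : Function.Periodic
      (fun θ : ℝ => (r : ℂ) * (h (circleMap 0 r θ) * conj (circleMap 0 r θ ^ m))) (2 * Real.pi) := by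
    intro θ
    simp only [periodic_circleMap 0 r θ]
  rw [← integral_Ioc_eq_integral_Ioo, ← intervalIntegral.integral_of_le (by linarith [Real.pi_pos])]
  have h3 := hper.intervalIntegral_add_eq (-Real.pi) 0
  rw [show -Real.pi + 2 * Real.pi = Real.pi by ring, zero_add] at h3
  rw [h3]
  have hint : ∀ θ : ℝ, (r : ℂ) * (h (circleMap 0 r θ) * conj (circleMap 0 r θ ^ m))
      = ((r ^ (2 * m + 1) : ℝ) : ℂ) * (-Complex.I) * (deriv (circleMap 0 r) θ •
        (1 / (circleMap 0 r θ - 0) ^ (m + 1)) • h (circleMap 0 r θ)) := by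
    intro θ
    have hz : circleMap 0 r θ ≠ 0 := circleMap_ne_center h0.ne'
    have hzz : circleMap 0 r θ * conj (circleMap 0 r θ) = (r : ℂ) ^ 2 := by
      rw [Complex.mul_conj, Complex.normSq_eq_norm_sq]; simp
    rw [deriv_circleMap, sub_zero, smul_eq_mul, smul_eq_mul, map_pow]
    set z := circleMap 0 r θ
    have h5 : conj z = (r : ℂ) ^ 2 / z := by rw [eq_div_iff hz, mul_comm]; exact hzz
    rw [h5, div_pow]
    push_cast
    field_simp
    rw [Complex.I_sq]
    ring
  simp only [hint]
  rw [intervalIntegral.integral_const_mul, hc, smul_eq_mul]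
  have : (m.factorial : ℂ) ≠ 0 := by exact_mod_cast m.factorial_ne_zero
  linear_combination (-((r ^ (2 * m + 1) : ℝ) : ℂ) * (2 * Real.pi / m.factorial * iteratedDeriv m h 0))
    * Complex.I_sq

theorem InBergmanSpace.integrableOn {Ω : Set ℂ} {h : ℂ → ℂ} (hh : InBergmanSpace Ω h)
    (hΩ : volume Ω ≠ ⊤) : IntegrableOn h Ω := by
  have : IsFiniteMeasure (volume.restrict Ω) :=
    ⟨by rw [Measure.restrict_apply_univ]; exact hΩ.lt_top⟩
  exact hh.2.integrable one_le_two

/-- An integrable function times a bounded function that is continuous on `Ω`. -/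
theorem integrableOn_mul_of_bdd {Ω : Set ℂ} (hm : MeasurableSet Ω) {h k : ℂ → ℂ}
    (hh : IntegrableOn h Ω)
    (hk : ContinuousOn k Ω) {C : ℝ} (hC : ∀ z ∈ Ω, ‖k z‖ ≤ C) :
    IntegrableOn (fun z => h z * k z) Ω :=
  hh.mul_bdd (c := C) (hk.aestronglyMeasurable hm)
    ((ae_restrict_iff' hm).2 (Filter.Eventually.of_forall hC))

/-- What remains after the angular integral is the integral of `r ^ (2 * m + 1)` over `(0, 1)`,
equal to `1 / (2 * m + 2)`; this is where `m!` becomes `(m + 1)!`. -/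
theorem integral_unitBall_mul_conj_pow {h : ℂ → ℂ} (hh : InBergmanSpace (ball 0 1) h) (m : ℕ) :
    ∫ x in ball (0 : ℂ) 1, h x * conj (x ^ m)
      = Real.pi / ((m + 1).factorial : ℂ) * iteratedDeriv m h 0 := by
  have hi : IntegrableOn (fun x => h x * conj (x ^ m)) (ball (0 : ℂ) 1) := by
    refine integrableOn_mul_of_bdd measurableSet_ball (hh.integrableOn measure_ball_lt_top.ne)
      (Continuous.continuousOn (Complex.continuous_conj.comp (continuous_pow m))) (C := 1) fun z hz => ?_
    rw [Complex.norm_conj, norm_pow]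
    exact pow_le_one₀ (norm_nonneg _) (by simpa using (mem_ball_zero_iff.1 hz).le)
  have hc : ContinuousOn (fun x => h x * conj (x ^ m)) (ball (0 : ℂ) 1) := hh.1.continuousOn.mul
    (Continuous.continuousOn (Complex.continuous_conj.comp (continuous_pow m)))
  rw [integral_ball_eq_polar hc hi]
  rw [setIntegral_congr_fun measurableSet_Ioo fun r (hr : r ∈ Ioo (0 : ℝ) 1) =>
    integral_circleMap_mul_conj_pow hh.1 hr.1 hr.2 m]
  rw [← integral_Ioc_eq_integral_Ioo, ← intervalIntegral.integral_of_le zero_le_one,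
    intervalIntegral.integral_mul_const, intervalIntegral.integral_ofReal, integral_pow]
  have h1 : (m.factorial : ℂ) ≠ 0 := by exact_mod_cast m.factorial_ne_zero
  have h2 : (m : ℂ) + 1 ≠ 0 := by exact_mod_cast m.succ_ne_zero
  rw [Nat.factorial_succ]
  push_cast
  field_simp
  simp only [one_pow, zero_pow (Nat.succ_ne_zero _)]
  have h3 : 2 * (m : ℂ) + 1 + 1 ≠ 0 := by
    rw [show 2 * (m : ℂ) + 1 + 1 = 2 * (m + 1) by ring]; exact mul_ne_zero two_ne_zero h2
  field_simp
  ring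

theorem areaInner_congr_right {Ω : Set ℂ} (hm : MeasurableSet Ω) (h : ℂ → ℂ) {k l : ℂ → ℂ}
    (hkl : EqOn k l Ω) : areaInner Ω h k = areaInner Ω h l :=
  setIntegral_congr_fun hm fun x hx => by simp only [hkl hx]

theorem areaInner_kernelDeriv_diskKernel {h : ℂ → ℂ} (hh : InBergmanSpace (ball 0 1) h) (m : ℕ) :
    areaInner (ball 0 1) h (kernelDeriv diskKernel 0 m) = iteratedDeriv m h 0 := by
  unfold areaInner
  have : ∀ x, h x * conj (kernelDeriv diskKernel 0 m x)
      = ((Real.pi : ℂ)⁻¹ * ((m + 1).factorial : ℂ)) * (h x * conj (x ^ m)) := fun x => by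
    rw [kernelDeriv_diskKernel]; simp; ring
  simp only [this]
  rw [integral_const_mul, integral_unitBall_mul_conj_pow hh]
  have h1 : ((m + 1).factorial : ℂ) ≠ 0 := by exact_mod_cast (m + 1).factorial_ne_zero
  have hpi : (Real.pi : ℂ) ≠ 0 := by exact_mod_cast Real.pi_ne_zero
  field_simp

theorem norm_areaInner_le {Ω : Set ℂ} (hm : MeasurableSet Ω) {h k : ℂ → ℂ}
    (hi : IntegrableOn h Ω) {C : ℝ} (hC : ∀ z ∈ Ω, ‖k z‖ ≤ C) :
    ‖areaInner Ω h k‖ ≤ C * ∫ x in Ω, ‖h x‖ := by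
  unfold areaInner
  rw [← integral_const_mul]
  refine norm_integral_le_of_norm_le (hi.norm.const_mul C)
    ((ae_restrict_iff' hm).2 (Filter.Eventually.of_forall fun z hz => ?_))
  rw [norm_mul, Complex.norm_conj, mul_comm]
  exact mul_le_mul_of_nonneg_right (hC z hz) (norm_nonneg _)

theorem memLp_two_of_bdd {Ω : Set ℂ} (hm : MeasurableSet Ω) (hΩ : volume Ω ≠ ⊤) {k : ℂ → ℂ}
    (hk : ContinuousOn k Ω) {C : ℝ} (hC : ∀ z ∈ Ω, ‖k z‖ ≤ C) : MemLp k 2 (volume.restrict Ω) := by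
  have : IsFiniteMeasure (volume.restrict Ω) :=
    ⟨by rw [Measure.restrict_apply_univ]; exact hΩ.lt_top⟩
  exact MemLp.of_bound (hk.aestronglyMeasurable hm) C
    ((ae_restrict_iff' hm).2 (Filter.Eventually.of_forall hC))

theorem differentiableOn_diskKernel {w : ℂ} {r : ℝ} (hr : r * ‖w‖ < 1) :
    DifferentiableOn ℂ (fun z => diskKernel z w) (ball 0 r) := by
  intro z hz
  have : (fun z => diskKernel z w) = invSq (conj w) := by funext z; exact diskKernel_eq_invSq z w
  rw [this]
  refine (analyticAt_invSq ?_).differentiableAt.differentiableWithinAt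
  rw [mul_comm]
  exact mul_conj_ne_one (mem_ball_zero_iff.1 hz) hr

theorem exists_norm_diskKernel_le {w : ℂ} (hw : ‖w‖ < 1) :
    ∃ C, ∀ z ∈ ball (0 : ℂ) 1, ‖diskKernel z w‖ ≤ C := by
  obtain ⟨r, hr1, hrw⟩ : ∃ r : ℝ, 1 < r ∧ r * ‖w‖ < 1 := by
    -- As `‖w‖ < 1`, this number exceeds `1`, and its product with `‖w‖` is below `1`. The kernel is
    -- thus continuous on the closed unit disc.
    refine ⟨2 / (1 + ‖w‖), ?_, ?_⟩
    · rw [lt_div_iff₀ (by positivity)]; linarith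
    · rw [div_mul_eq_mul_div, div_lt_one (by positivity)]; linarith
  obtain ⟨C, hC⟩ := (isCompact_closedBall (0 : ℂ) 1).exists_bound_of_continuousOn
    ((differentiableOn_diskKernel hrw).continuousOn.mono (closedBall_subset_ball hr1))
  exact ⟨C, fun z hz => hC z (ball_subset_closedBall hz)⟩

theorem inBergmanSpace_diskKernel {w : ℂ} (hw : ‖w‖ < 1) :
    InBergmanSpace (ball 0 1) (fun z => diskKernel z w) := by
  have hd := differentiableOn_diskKernel (w := w) (r := 1) (by simpa using hw)
  obtain ⟨C, hC⟩ := exists_norm_diskKernel_le hw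
  exact ⟨hd, memLp_two_of_bdd measurableSet_ball measure_ball_lt_top.ne hd.continuousOn hC⟩

theorem continuous_kernelDeriv_diskKernel (m : ℕ) : Continuous (kernelDeriv diskKernel 0 m) := by
  have : kernelDeriv diskKernel 0 m
    = fun z => (Real.pi : ℂ)⁻¹ * ((m + 1).factorial : ℂ) * z ^ m := by
    funext z; exact kernelDeriv_diskKernel z m
  rw [this]; fun_prop

theorem integrableOn_mul_conj_kernelDeriv_diskKernel {h : ℂ → ℂ}
    (hh : InBergmanSpace (ball 0 1) h) (m : ℕ) :
    IntegrableOn (fun x => h x * conj (kernelDeriv diskKernel 0 m x)) (ball 0 1) := by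
  have hc : Continuous fun x => conj (kernelDeriv diskKernel 0 m x) :=
    Complex.continuous_conj.comp (continuous_kernelDeriv_diskKernel m)
  obtain ⟨C, hC⟩ := (isCompact_closedBall (0 : ℂ) 1).exists_bound_of_continuousOn hc.continuousOn
  exact integrableOn_mul_of_bdd measurableSet_ball (hh.integrableOn measure_ball_lt_top.ne)
    hc.continuousOn fun z hz => hC z (ball_subset_closedBall hz)

theorem areaInner_diskKernel_sub {h : ℂ → ℂ} (hh : InBergmanSpace (ball 0 1) h) {w : ℂ}
    (hw : ‖w‖ < 1) (N : ℕ) :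
    areaInner (ball 0 1) h (fun z => diskKernel z w - ∑ n ∈ Finset.range (N + 1),
        conj w ^ n / (n.factorial : ℂ) * kernelDeriv diskKernel 0 n z)
      = areaInner (ball 0 1) h (fun z => diskKernel z w)
        - ∑ n ∈ Finset.range (N + 1), w ^ n / (n.factorial : ℂ) * iteratedDeriv n h 0 := by
  have hi1 : IntegrableOn (fun x => h x * conj (diskKernel x w)) (ball 0 1) := by
    obtain ⟨C, hC⟩ := exists_norm_diskKernel_le hw
    refine integrableOn_mul_of_bdd measurableSet_ball (hh.integrableOn measure_ball_lt_top.ne)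
      (Complex.continuous_conj.comp_continuousOn (inBergmanSpace_diskKernel hw).1.continuousOn)
      (C := C) fun z hz => by rw [Complex.norm_conj]; exact hC z hz
  have hi2 := fun m => integrableOn_mul_conj_kernelDeriv_diskKernel hh m
  have hpt : ∀ x, h x * conj (diskKernel x w - ∑ n ∈ Finset.range (N + 1),
        conj w ^ n / (n.factorial : ℂ) * kernelDeriv diskKernel 0 n x)
      = h x * conj (diskKernel x w) - ∑ n ∈ Finset.range (N + 1),
        w ^ n / (n.factorial : ℂ) * (h x * conj (kernelDeriv diskKernel 0 n x)) := fun x => by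
    simp only [map_sub, map_sum, map_mul, map_div₀, map_pow, Complex.conj_conj, mul_sub,
      Finset.mul_sum, map_natCast]
    congr 1
    exact Finset.sum_congr rfl fun n _ => by ring
  simp only [areaInner, hpt]
  rw [integral_sub hi1 (integrable_finsetSum _ fun n _ => (hi2 n).const_mul _),
    integral_finsetSum _ fun n _ => (hi2 n).const_mul _]
  congr 1
  refine Finset.sum_congr rfl fun n _ => ?_
  rw [integral_const_mul]
  congr 1
  exact areaInner_kernelDeriv_diskKernel hh n

/-- The reproducing property of the kernel of the unit disc. -/
theorem areaInner_diskKernel {h : ℂ → ℂ} (hh : InBergmanSpace (ball 0 1) h) {w : ℂ}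
    (hw : w ∈ ball (0 : ℂ) 1) : areaInner (ball 0 1) h (fun z => diskKernel z w) = h w := by
  have hw' : ‖w‖ < 1 := mem_ball_zero_iff.1 hw
  have hw1 : (1 : ℝ) * ‖w‖ < 1 := by simpa using hw'
  have ht := (Complex.hasSum_taylorSeries_on_ball hh.1 hw).tendsto_sum_nat.comp
    (Filter.tendsto_add_atTop_nat 1)
  have hb := (tendsto_remainderBound (by positivity) hw1).mul_const (∫ x in ball (0 : ℂ) 1, ‖h x‖)
  rw [zero_mul] at hb
  -- The difference is the pairing of `h` with the Taylor remainder, bounded by the supremum of the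
  -- remainder on the unit disc times the `L¹` norm of `h`.
  have ht2 : Filter.Tendsto (fun N : ℕ => areaInner (ball 0 1) h (fun z => diskKernel z w)
      - ∑ n ∈ Finset.range (N + 1), w ^ n / (n.factorial : ℂ) * iteratedDeriv n h 0)
      Filter.atTop (𝓝 0) := by
    refine squeeze_zero_norm (fun N => ?_) hb
    rw [← areaInner_diskKernel_sub hh hw']
    refine norm_areaInner_le measurableSet_ball (hh.integrableOn measure_ball_lt_top.ne)
      fun z hz => ?_
    rw [diskKernel_sub_taylor w N z (mul_conj_ne_one (mem_ball_zero_iff.1 hz) hw1)]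
    exact norm_taylorRemainder_mul_conj_le N (mem_ball_zero_iff.1 hz) hw1
  have ht3 : Filter.Tendsto (fun N : ℕ =>
      ∑ n ∈ Finset.range (N + 1), w ^ n / (n.factorial : ℂ) * iteratedDeriv n h 0)
      Filter.atTop (𝓝 (h w)) := by
    refine ht.congr fun N => ?_
    simp only [Function.comp, sub_zero, smul_eq_mul]
    exact Finset.sum_congr rfl fun n _ => by ring
  have := tendsto_nhds_unique (tendsto_const_nhds.sub ht3) ht2
  exact sub_eq_zero.1 this

theorem isBergmanKernel_diskKernel : IsBergmanKernel (ball 0 1) diskKernel := fun _ hw =>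
  ⟨inBergmanSpace_diskKernel (mem_ball_zero_iff.1 hw), fun _ hh => areaInner_diskKernel hh hw⟩

theorem IsBergmanKernel.bergmanKernel {Ω : Set ℂ} {K : ℂ → ℂ → ℂ} (hK : IsBergmanKernel Ω K) :
    IsBergmanKernel Ω (bergmanKernel Ω) :=
  Classical.epsilon_spec (p := IsBergmanKernel Ω) ⟨K, hK⟩

theorem IsBergmanKernel.bergmanKernel_eq {Ω : Set ℂ} {K : ℂ → ℂ → ℂ} (hK : IsBergmanKernel Ω K)
    {z w : ℂ} (hz : z ∈ Ω) (hw : w ∈ Ω) : _root_.bergmanKernel Ω z w = K z w :=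
  hK.bergmanKernel.unique hK hz hw

/-- Uniqueness fixes the kernel only for `w ∈ Ω`; openness makes that a neighbourhood of `a`, which
is all that derivatives see. -/
theorem IsBergmanKernel.kernelDeriv_eq {Ω : Set ℂ} (hΩ : IsOpen Ω) {K : ℂ → ℂ → ℂ}
    (hK : IsBergmanKernel Ω K) {z a : ℂ} (hz : z ∈ Ω) (ha : a ∈ Ω) (m : ℕ) :
    kernelDeriv (_root_.bergmanKernel Ω) a m z = kernelDeriv K a m z :=
  (dbar_iterate_eventuallyEq ((hΩ.eventually_mem ha).mono fun _ hw =>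
    hK.bergmanKernel_eq hz hw) m).eq_of_nhds

/-! ### Injective holomorphic maps and their inverses -/

section Injective

variable {G : Set ℂ} {f F : ℂ → ℂ}

theorem not_eventually_const_of_injOn (hG : IsOpen G) (hi : InjOn f G) {z₀ : ℂ} (hz : z₀ ∈ G) :
    ¬ ∀ᶠ z in 𝓝 z₀, f z = f z₀ := by
  intro h
  have h2 : ∀ᶠ z in 𝓝 z₀, z = z₀ := by
    filter_upwards [h, hG.mem_nhds hz] with z h1 h2
    exact hi h2 hz h1
  have h3 : ({z₀} : Set ℂ) ∈ 𝓝 z₀ := h2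
  exact (not_isOpen_singleton z₀) (isOpen_singleton_iff_nhds_eq_pure z₀ |>.2
    (le_antisymm (by simpa using h3) (pure_le_nhds z₀)))

theorem nhds_le_map_of_injOn (hG : IsOpen G) (hf : DifferentiableOn ℂ f G) (hi : InjOn f G)
    {z₀ : ℂ} (hz : z₀ ∈ G) : 𝓝 (f z₀) ≤ Filter.map f (𝓝 z₀) :=
  ((hf.analyticAt (hG.mem_nhds hz)).eventually_constant_or_nhds_le_map_nhds).resolve_left
    (not_eventually_const_of_injOn hG hi hz)

theorem isOpen_image_of_injOn (hG : IsOpen G) (hf : DifferentiableOn ℂ f G) (hi : InjOn f G) :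
    IsOpen (f '' G) := by
  rw [isOpen_iff_mem_nhds]
  rintro _ ⟨z, hz, rfl⟩
  exact nhds_le_map_of_injOn hG hf hi hz (Filter.image_mem_map (hG.mem_nhds hz))

theorem tendsto_inverse_of_injOn (hG : IsOpen G) (hf : DifferentiableOn ℂ f G) (hi : InjOn f G)
    (hF : ∀ z ∈ G, F (f z) = z) {z₀ : ℂ} (hz : z₀ ∈ G) :
    Filter.Tendsto F (𝓝 (f z₀)) (𝓝 z₀) := by
  refine Filter.Tendsto.mono_left ?_ (nhds_le_map_of_injOn hG hf hi hz)
  rw [Filter.tendsto_map'_iff]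
  refine Filter.Tendsto.congr' ?_ Filter.tendsto_id
  filter_upwards [hG.mem_nhds hz] with z h
  exact (hF z h).symm

theorem eventually_inverse_of_injOn (hG : IsOpen G) (hf : DifferentiableOn ℂ f G) (hi : InjOn f G)
    (hF : ∀ z ∈ G, F (f z) = z) {z₀ : ℂ} (hz : z₀ ∈ G) :
    ∀ᶠ w in 𝓝 (f z₀), F w ∈ G ∧ f (F w) = w := by
  have h := (isOpen_image_of_injOn hG hf hi).mem_nhds (mem_image_of_mem f hz)
  filter_upwards [h]
  rintro _ ⟨z, hz, rfl⟩
  rw [hF z hz]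
  exact ⟨hz, rfl⟩

theorem hasDerivAt_inverse_of_deriv_ne_zero (hG : IsOpen G) (hf : DifferentiableOn ℂ f G)
    (hi : InjOn f G) (hF : ∀ z ∈ G, F (f z) = z) {z₀ : ℂ} (hz : z₀ ∈ G) (hd : deriv f z₀ ≠ 0) :
    HasDerivAt F (deriv f z₀)⁻¹ (f z₀) := by
  refine HasDerivAt.of_local_left_inverse (f := f) ?_ ?_ hd ?_
  · rw [ContinuousAt, hF z₀ hz]; exact tendsto_inverse_of_injOn hG hf hi hF hz
  · rw [hF z₀ hz]; exact (hf.differentiableAt (hG.mem_nhds hz)).hasDerivAt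
  · exact (eventually_inverse_of_injOn hG hf hi hF hz).mono fun w hw => hw.2

/-- Zeros of `f'` are isolated, since otherwise `f` would be locally constant. The inverse is
therefore holomorphic on a punctured neighbourhood of `f z₀` and continuous at `f z₀`, so the
singularity is removable, and the chain rule for `F ∘ f = id` excludes `f' = 0`. -/
theorem deriv_ne_zero_of_injOn (hG : IsOpen G) (hf : DifferentiableOn ℂ f G) (hi : InjOn f G)
    {z₀ : ℂ} (hz : z₀ ∈ G) : deriv f z₀ ≠ 0 := by
  obtain ⟨F, hF⟩ : ∃ F : ℂ → ℂ, ∀ z ∈ G, F (f z) = z :=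
    ⟨Function.invFunOn f G, fun z hz => hi.leftInvOn_invFunOn hz⟩
  have hfa := hf.analyticAt (hG.mem_nhds hz)
  have hne : ∀ᶠ z in 𝓝[≠] z₀, deriv f z ≠ 0 := by
    refine hfa.deriv.eventually_eq_zero_or_eventually_ne_zero.resolve_left fun h => ?_
    obtain ⟨r, hr, hb⟩ := Metric.eventually_nhds_iff_ball.1 (h.and (hG.mem_nhds hz))
    refine not_eventually_const_of_injOn hG hi hz ?_
    filter_upwards [ball_mem_nhds z₀ hr] with z hzr
    exact isOpen_ball.is_const_of_deriv_eq_zero (convex_ball z₀ r).isPreconnected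
      (hf.mono fun z hz => (hb z hz).2) (fun z hz => (hb z hz).1) hzr (mem_ball_self hr)
  have ht := tendsto_inverse_of_injOn hG hf hi hF hz
  have hev := eventually_inverse_of_injOn hG hf hi hF hz
  have hFa : AnalyticAt ℂ F (f z₀) := by
    refine Complex.analyticAt_of_differentiable_on_punctured_nhds_of_continuousAt ?_ ?_
    · have ht' : Filter.Tendsto F (𝓝[≠] (f z₀)) (𝓝[≠] z₀) := by
        refine tendsto_nhdsWithin_iff.2 ⟨ht.mono_left nhdsWithin_le_nhds, ?_⟩
        filter_upwards [hev.filter_mono nhdsWithin_le_nhds, self_mem_nhdsWithin] with w hw hw2 h3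
        rw [mem_singleton_iff] at h3
        exact hw2 (by rw [mem_singleton_iff, ← hw.2, h3])
      filter_upwards [hev.filter_mono nhdsWithin_le_nhds, ht'.eventually hne] with w hw hd
      have := hasDerivAt_inverse_of_deriv_ne_zero hG hf hi hF hw.1 hd
      rw [hw.2] at this
      exact this.differentiableAt
    · rw [ContinuousAt, hF z₀ hz]; exact ht
  have hcomp := hFa.differentiableAt.hasDerivAt.comp z₀ hfa.differentiableAt.hasDerivAt
  have hid : HasDerivAt (F ∘ f) 1 z₀ := by
    refine (hasDerivAt_id z₀).congr_of_eventuallyEq ?_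
    filter_upwards [hG.mem_nhds hz] with z h
    exact hF z h
  have h1 := hcomp.unique hid
  intro h0
  rw [h0, mul_zero] at h1
  exact zero_ne_one h1

theorem hasDerivAt_inverse_of_injOn (hG : IsOpen G) (hf : DifferentiableOn ℂ f G)
    (hi : InjOn f G) (hF : ∀ z ∈ G, F (f z) = z) {z₀ : ℂ} (hz : z₀ ∈ G) :
    HasDerivAt F (deriv f z₀)⁻¹ (f z₀) :=
  hasDerivAt_inverse_of_deriv_ne_zero hG hf hi hF hz (deriv_ne_zero_of_injOn hG hf hi hz)

end Injective

/-! ### Holomorphic change of variables in area integrals -/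

section ChangeOfVariables

variable {G : Set ℂ} {f : ℂ → ℂ}

/-- The real determinant of multiplication by `c` is the algebra norm of `c` for `ℂ` over `ℝ`. -/
theorem abs_det_toSpanSingleton (c : ℂ) :
    |((ContinuousLinearMap.toSpanSingleton ℂ c).restrictScalars ℝ).det| = ‖c‖ ^ 2 := by
  have : ((ContinuousLinearMap.toSpanSingleton ℂ c).restrictScalars ℝ).det = ‖c‖ ^ 2 := by
    have h := Algebra.norm_complex_apply c
    rw [Complex.normSq_eq_norm_sq] at h
    rw [← h, Algebra.norm_apply, ContinuousLinearMap.det]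
    congr 1
    ext; simp [mul_comm]
  rw [this, abs_of_nonneg (by positivity)]

theorem hasFDerivWithinAt_restrictScalars (hG : IsOpen G) (hf : DifferentiableOn ℂ f G) :
    ∀ x ∈ G, HasFDerivWithinAt f
      ((ContinuousLinearMap.toSpanSingleton ℂ (deriv f x)).restrictScalars ℝ) G x := fun _ hx =>
  ((hf.differentiableAt (hG.mem_nhds hx)).hasDerivAt.hasFDerivAt.restrictScalars ℝ).hasFDerivWithinAt

theorem integral_image_holomorphic (hG : IsOpen G) (hf : DifferentiableOn ℂ f G) (hi : InjOn f G)
    (g : ℂ → ℂ) :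
    ∫ w in f '' G, g w = ∫ z in G, ((‖deriv f z‖ ^ 2 : ℝ) : ℂ) * g (f z) := by
  rw [integral_image_eq_integral_abs_det_fderiv_smul volume hG.measurableSet
    (hasFDerivWithinAt_restrictScalars hG hf) hi]
  simp only [abs_det_toSpanSingleton, Complex.real_smul]

theorem integrableOn_image_holomorphic (hG : IsOpen G) (hf : DifferentiableOn ℂ f G)
    (hi : InjOn f G) (g : ℂ → ℝ) :
    IntegrableOn g (f '' G) ↔ IntegrableOn (fun z => ‖deriv f z‖ ^ 2 * g (f z)) G := by
  rw [integrableOn_image_iff_integrableOn_abs_det_fderiv_smul volume hG.measurableSet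
    (hasFDerivWithinAt_restrictScalars hG hf) hi]
  simp only [abs_det_toSpanSingleton, smul_eq_mul]

/-- The pull-back of `h` as a one-form. -/
noncomputable def formPullback (f h : ℂ → ℂ) (z : ℂ) : ℂ := h (f z) * deriv f z

theorem InBergmanSpace.formPullback (hG : IsOpen G) (hf : DifferentiableOn ℂ f G) (hi : InjOn f G)
    {h : ℂ → ℂ} (hh : InBergmanSpace (f '' G) h) : InBergmanSpace G (formPullback f h) := by
  have hd : DifferentiableOn ℂ (_root_.formPullback f h) G :=
    (hh.1.comp hf (mapsTo_image f G)).mul (hf.deriv hG)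
  refine ⟨hd, ?_⟩
  rw [memLp_two_iff_integrable_sq_norm (hd.continuousOn.aestronglyMeasurable hG.measurableSet)]
  have h2 := (memLp_two_iff_integrable_sq_norm hh.2.1).1 hh.2
  have h3 := (integrableOn_image_holomorphic hG hf hi _).1 h2
  refine h3.congr (Filter.Eventually.of_forall fun z => ?_)
  simp only [_root_.formPullback, norm_mul]
  ring

/-- The Jacobian splits as `f' * conj f'`, one factor for each entry of the pairing. This is why
functions are transported as one-forms. -/
theorem areaInner_formPullback (hG : IsOpen G) (hf : DifferentiableOn ℂ f G) (hi : InjOn f G)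
    (h k : ℂ → ℂ) :
    areaInner (f '' G) h k = areaInner G (formPullback f h) (formPullback f k) := by
  unfold areaInner
  rw [integral_image_holomorphic hG hf hi]
  congr 1
  funext z
  have : ((‖deriv f z‖ ^ 2 : ℝ) : ℂ) = deriv f z * conj (deriv f z) := by
    rw [Complex.mul_conj, Complex.normSq_eq_norm_sq]
  rw [this]
  simp only [formPullback, map_mul]
  ring

end ChangeOfVariables

/-! ### Transport of the Bergman kernel from the disc -/

section Transport

variable {G : Set ℂ} {f F : ℂ → ℂ}

theorem left_inverse_of_bijOn (hb : BijOn f G (ball 0 1))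
    (hF : ∀ w ∈ ball (0 : ℂ) 1, F w ∈ G ∧ f (F w) = w) : ∀ z ∈ G, F (f z) = z := fun _ hz =>
  hb.injOn (hF _ (hb.mapsTo hz)).1 hz (hF _ (hb.mapsTo hz)).2

theorem deriv_inverse_mul_deriv (hG : IsOpen G) (hf : DifferentiableOn ℂ f G)
    (hb : BijOn f G (ball 0 1)) (hF : ∀ w ∈ ball (0 : ℂ) 1, F w ∈ G ∧ f (F w) = w)
    {z : ℂ} (hz : z ∈ G) : deriv F (f z) * deriv f z = 1 := by
  rw [(hasDerivAt_inverse_of_injOn hG hf hb.injOn (left_inverse_of_bijOn hb hF) hz).deriv,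
    inv_mul_cancel₀ (deriv_ne_zero_of_injOn hG hf hb.injOn hz)]

theorem differentiableOn_inverse_of_bijOn (hG : IsOpen G) (hf : DifferentiableOn ℂ f G)
    (hb : BijOn f G (ball 0 1)) (hF : ∀ w ∈ ball (0 : ℂ) 1, F w ∈ G ∧ f (F w) = w) :
    DifferentiableOn ℂ F (ball 0 1) := by
  intro w hw
  have := hasDerivAt_inverse_of_injOn hG hf hb.injOn (left_inverse_of_bijOn hb hF) (hF w hw).1
  rw [(hF w hw).2] at this
  exact this.differentiableAt.differentiableWithinAt

theorem image_inverse (hb : BijOn f G (ball 0 1))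
    (hF : ∀ w ∈ ball (0 : ℂ) 1, F w ∈ G ∧ f (F w) = w) : F '' ball 0 1 = G := by
  ext z
  constructor
  · rintro ⟨w, hw, rfl⟩; exact (hF w hw).1
  · intro hz
    exact ⟨f z, hb.mapsTo hz, left_inverse_of_bijOn hb hF z hz⟩

theorem injOn_inverse (hF : ∀ w ∈ ball (0 : ℂ) 1, F w ∈ G ∧ f (F w) = w) :
    InjOn F (ball 0 1) := fun w hw w' hw' h => by
  rw [← (hF w hw).2, h, (hF w' hw').2]

theorem formPullback_formPullback (hG : IsOpen G) (hf : DifferentiableOn ℂ f G)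
    (hb : BijOn f G (ball 0 1)) (hF : ∀ w ∈ ball (0 : ℂ) 1, F w ∈ G ∧ f (F w) = w)
    (h : ℂ → ℂ) {z : ℂ} (hz : z ∈ G) : formPullback f (formPullback F h) z = h z := by
  simp only [formPullback]
  rw [left_inverse_of_bijOn hb hF z hz, mul_assoc, deriv_inverse_mul_deriv hG hf hb hF hz, mul_one]

theorem inBergmanSpace_formPullback_inverse (hG : IsOpen G) (hf : DifferentiableOn ℂ f G)
    (hb : BijOn f G (ball 0 1)) (hF : ∀ w ∈ ball (0 : ℂ) 1, F w ∈ G ∧ f (F w) = w)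
    {h : ℂ → ℂ} (hh : InBergmanSpace G h) : InBergmanSpace (ball 0 1) (formPullback F h) :=
  InBergmanSpace.formPullback isOpen_ball (differentiableOn_inverse_of_bijOn hG hf hb hF)
    (injOn_inverse hF) (by rwa [image_inverse hb hF])

theorem areaInner_formPullback_right (hG : IsOpen G) (hf : DifferentiableOn ℂ f G)
    (hb : BijOn f G (ball 0 1)) (hF : ∀ w ∈ ball (0 : ℂ) 1, F w ∈ G ∧ f (F w) = w)
    (h k : ℂ → ℂ) :
    areaInner G h (formPullback f k) = areaInner (ball 0 1) (formPullback F h) k := by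
  rw [← hb.image_eq, areaInner_formPullback hG hf hb.injOn]
  exact setIntegral_congr_fun hG.measurableSet fun _ hz => by
    simp only [formPullback_formPullback hG hf hb hF h hz]

theorem areaInner_const_mul_right (Ω : Set ℂ) (h k : ℂ → ℂ) (c : ℂ) :
    areaInner Ω h (fun z => c * k z) = conj c * areaInner Ω h k := by
  unfold areaInner
  rw [← integral_const_mul]
  congr 1
  funext z
  rw [map_mul]; ring

/-- The kernel of `G` expressed through a conformal map onto the unit disc. -/
noncomputable def transportedKernel (f : ℂ → ℂ) (z w : ℂ) : ℂ :=
  conj (deriv f w) * formPullback f (fun u => diskKernel u (f w)) z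

/-- Pulling back by `f` and by its inverse are mutually inverse isometries. Pairing `h` with the
transported kernel is thus evaluating the pull-back of `h` at `f w`, and the factor `conj (deriv f
w)` undoes the derivative of the inverse picked up there. -/
theorem isBergmanKernel_transportedKernel (hG : IsOpen G) (hf : DifferentiableOn ℂ f G)
    (hb : BijOn f G (ball 0 1)) (hF : ∀ w ∈ ball (0 : ℂ) 1, F w ∈ G ∧ f (F w) = w) :
    IsBergmanKernel G (transportedKernel f) := by
  intro w hw
  have hfw := hb.mapsTo hw
  constructor
  · have h := InBergmanSpace.formPullback hG hf hb.injOn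
      (h := fun u => diskKernel u (f w)) (by
        rw [hb.image_eq]; exact inBergmanSpace_diskKernel (mem_ball_zero_iff.1 hfw))
    exact ⟨h.1.const_mul _, h.2.const_mul _⟩
  · intro h hh
    have := areaInner_const_mul_right G h (formPullback f (fun u => diskKernel u (f w)))
      (conj (deriv f w))
    unfold transportedKernel
    rw [this, areaInner_formPullback_right hG hf hb hF,
      areaInner_diskKernel (inBergmanSpace_formPullback_inverse hG hf hb hF hh) hfw,
      Complex.conj_conj, mul_comm]
    exact formPullback_formPullback hG hf hb hF h hw

end Transport

/-! ### The Riemann mapping theorem -/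

section Montel

variable {G : Set ℂ}

/-- **Montel's theorem** along an ultrafilter. -/
theorem exists_tendstoLocallyUniformlyOn_of_bounded {ι : Type*} (l : Ultrafilter ι) (hG : IsOpen G)
    {u : ι → ℂ → ℂ} (hu : ∀ n, DifferentiableOn ℂ (u n) G)
    (hu1 : ∀ n, ∀ z ∈ G, ‖u n z‖ ≤ 1) :
    ∃ f : ℂ → ℂ, TendstoLocallyUniformlyOn u f l G := by
  have hlim : ∀ z, ∃ y, z ∈ G → Filter.Tendsto (fun n => u n z) l (𝓝 y) := by
    intro z
    by_cases hz : z ∈ G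
    · obtain ⟨y, _, hy⟩ := (isCompact_closedBall (0 : ℂ) 1).ultrafilter_le_nhds
        -- Along an ultrafilter every family with values in the compact disc converges, so pointwise
        -- limits exist at once and no diagonal subsequence is extracted.
        (l.map fun n => u n z) (by
          rw [Filter.le_principal_iff, Ultrafilter.coe_map, Filter.mem_map]
          exact Filter.univ_mem' fun n => by simpa using hu1 n z hz)
      exact ⟨y, fun _ => hy⟩
    · exact ⟨0, fun h => absurd h hz⟩
  choose f hf using hlim
  refine ⟨f, Metric.tendstoLocallyUniformlyOn_iff.2 fun ε hε z₀ hz₀ => ?_⟩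
  obtain ⟨R, hR, hRG⟩ := Metric.isOpen_iff.1 hG z₀ hz₀
  -- Equicontinuity from the Schwarz lemma: each `u n` maps the ball into the closed disc of radius
  -- `2` about `u n z₀`.
  have hlip : ∀ n, ∀ z ∈ ball z₀ R, dist (u n z) (u n z₀) ≤ 2 / R * dist z z₀ := fun n z hz =>
    Complex.dist_le_div_mul_dist_of_mapsTo_ball ((hu n).mono hRG) (fun y hy => by
      rw [mem_closedBall, dist_eq_norm]
      have h1 := hu1 n y (hRG hy)
      have h2 := hu1 n z₀ hz₀
      linarith [norm_sub_le (u n y) (u n z₀)]) hz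
  set δ := min R (ε * R / 8) with hδ
  have hδ0 : 0 < δ := lt_min hR (by positivity)
  have hlip2 : ∀ n, ∀ z ∈ ball z₀ δ, dist (u n z) (u n z₀) ≤ ε / 4 := fun n z hz => by
    refine (hlip n z (ball_subset_ball (min_le_left _ _) hz)).trans ?_
    have : dist z z₀ ≤ ε * R / 8 := (mem_ball.1 hz).le.trans (min_le_right _ _)
    calc 2 / R * dist z z₀ ≤ 2 / R * (ε * R / 8) := by gcongr
      _ = ε / 4 := by field_simp; ring
  refine ⟨ball z₀ δ, mem_nhdsWithin_of_mem_nhds (ball_mem_nhds z₀ hδ0), ?_⟩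
  have hev : ∀ᶠ n in (l : Filter ι), dist (u n z₀) (f z₀) < ε / 4 :=
    Metric.tendsto_nhds.1 (hf z₀ hz₀) _ (by positivity)
  filter_upwards [hev] with n hn y hy
  have hyG : y ∈ G := hRG (ball_subset_ball (min_le_left _ _) hy)
  have h3 : dist (f y) (f z₀) ≤ ε / 4 := by
    refine le_of_tendsto ((hf y hyG).dist (hf z₀ hz₀)) (Filter.Eventually.of_forall fun m => ?_)
    exact hlip2 m y hy
  have h4 := hlip2 n y hy
  have t1 := dist_triangle4 (f y) (f z₀) (u n z₀) (u n y)
  rw [dist_comm (f z₀), dist_comm (u n z₀) (u n y)] at t1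
  linarith

end Montel

section Hurwitz

variable {G : Set ℂ} {ι : Type*} {l : Filter ι} [l.NeBot] {u : ι → ℂ → ℂ} {f : ℂ → ℂ}

/-- A quantitative open mapping theorem plays the role of Rouché. Let `m` be the minimum of `‖f - f
z₀‖` on a small circle. Once `u n` is within `m / 4` of `f`, it stays `m / 2` away from `u n z₀` on
the circle, so its image contains the ball of radius `m / 4` about `u n z₀`, and with it `f z₀`. -/
theorem eventually_exists_eq_of_tendstoLocallyUniformlyOn (hG : IsOpen G)
    (hu : ∀ n, DifferentiableOn ℂ (u n) G) (hi : ∀ n, InjOn (u n) G)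
    (h : TendstoLocallyUniformlyOn u f l G) {z₀ : ℂ} (hz : z₀ ∈ G)
    (hne : ¬ ∀ᶠ z in 𝓝 z₀, f z = f z₀) {V : Set ℂ} (hV : V ∈ 𝓝 z₀) :
    ∀ᶠ n in l, ∃ z ∈ V, u n z = f z₀ := by
  have hfd : DifferentiableOn ℂ f G := h.differentiableOn (Filter.Eventually.of_forall hu) hG
  have hfa := hfd.analyticAt (hG.mem_nhds hz)
  have hpunct := (hfa.eventually_eq_or_eventually_ne (analyticAt_const (v := f z₀))).resolve_left hne
  rw [eventually_nhdsWithin_iff] at hpunct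
  obtain ⟨R, hR, hb⟩ := Metric.eventually_nhds_iff_ball.1
    ((hpunct.and (hG.mem_nhds hz)).and hV)
  set r := R / 2 with hr
  have hr0 : 0 < r := by positivity
  have hrR : closedBall z₀ r ⊆ ball z₀ R := closedBall_subset_ball (by linarith)
  have hrG : closedBall z₀ r ⊆ G := fun z hz => (hb z (hrR hz)).1.2
  have hcont : ContinuousOn (fun z => ‖f z - f z₀‖) (sphere z₀ r) :=
    ((hfd.continuousOn.mono (sphere_subset_closedBall.trans hrG)).sub continuousOn_const).norm
  obtain ⟨x, hx, hmin⟩ := (isCompact_sphere z₀ r).exists_isMinOn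
    (NormedSpace.sphere_nonempty.2 hr0.le) hcont
  set m := ‖f x - f z₀‖ with hm
  have hm0 : 0 < m := by
    rw [hm, norm_pos_iff, sub_ne_zero]
    refine (hb x (hrR (sphere_subset_closedBall hx))).1.1 ?_
    intro hxz
    rw [mem_singleton_iff] at hxz
    rw [hxz, mem_sphere, dist_self] at hx
    exact hr0.ne hx
  have hunif := (tendstoLocallyUniformlyOn_iff_forall_isCompact hG).1 h _ hrG
    (isCompact_closedBall z₀ r)
  filter_upwards [Metric.tendstoUniformlyOn_iff.1 hunif (m / 4) (by positivity)] with n hn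
  have hz0 := hn z₀ (mem_closedBall_self hr0.le)
  have hsub := DiffContOnCl.ball_subset_image_closedBall (f := u n) (z₀ := z₀) (ε := m / 2) (r := r)
    (((hu n).mono (closure_ball_subset_closedBall.trans hrG)).diffContOnCl) hr0 (fun z hz => by
      have h1 : m ≤ ‖f z - f z₀‖ := hmin hz
      have h2 := hn z (sphere_subset_closedBall hz)
      rw [dist_eq_norm] at h2 hz0
      have h3 : f z - f z₀ = (f z - u n z) + (u n z - u n z₀) - (f z₀ - u n z₀) := by ring
      have h4 : ‖f z - f z₀‖ ≤ ‖f z - u n z‖ + ‖u n z - u n z₀‖ + ‖f z₀ - u n z₀‖ := by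
        rw [h3]
        exact (norm_sub_le _ _).trans (add_le_add_left (norm_add_le _ _) _)
      linarith)
    (fun h0 => not_eventually_const_of_injOn hG (hi n) hz (h0.mono fun z hz => not_not.1 hz))
  obtain ⟨z, hzr, hze⟩ := hsub (show f z₀ ∈ ball (u n z₀) (m / 2 / 2) by
    rw [mem_ball]; linarith)
  exact ⟨z, (hb z (hrR hzr)).2, hze⟩

/-- **Hurwitz's theorem**: a locally uniform limit of injective holomorphic functions on a
connected open set is injective unless it is constant. -/
theorem injOn_of_tendstoLocallyUniformlyOn (hG : IsOpen G) (hc : IsPreconnected G)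
    (hu : ∀ n, DifferentiableOn ℂ (u n) G) (hi : ∀ n, InjOn (u n) G)
    (h : TendstoLocallyUniformlyOn u f l G) {a : ℂ} (ha : a ∈ G) (hd : deriv f a ≠ 0) :
    InjOn f G := by
  have hfd : DifferentiableOn ℂ f G := h.differentiableOn (Filter.Eventually.of_forall hu) hG
  have hne : ∀ z₀ ∈ G, ¬ ∀ᶠ z in 𝓝 z₀, f z = f z₀ := by
    intro z₀ hz₀ hev
    have heq := (hfd.analyticOnNhd hG).eqOn_of_preconnected_of_eventuallyEq
      (analyticOnNhd_const (v := f z₀)) hc hz₀ hev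
    have : f =ᶠ[𝓝 a] fun _ => f z₀ := heq.eventuallyEq_of_mem (hG.mem_nhds ha)
    exact hd (by rw [this.deriv_eq, deriv_const])
  intro z₁ h₁ z₂ h₂ he
  by_contra hz
  -- One `u n` takes the common value `f z₁ = f z₂` in each of two disjoint neighbourhoods, against
  -- its injectivity.
  obtain ⟨V₁, V₂, hV₁, hV₂, hdisj⟩ := t2_separation_nhds hz
  have e1 := eventually_exists_eq_of_tendstoLocallyUniformlyOn hG hu hi h h₁ (hne z₁ h₁)
    (Filter.inter_mem hV₁ (hG.mem_nhds h₁))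
  have e2 := eventually_exists_eq_of_tendstoLocallyUniformlyOn hG hu hi h h₂ (hne z₂ h₂)
    (Filter.inter_mem hV₂ (hG.mem_nhds h₂))
  obtain ⟨n, ⟨x, hx, hxe⟩, ⟨y, hy, hye⟩⟩ := (e1.and e2).exists
  have hxy : x = y := hi n hx.2 hy.2 (by rw [hxe, hye, he])
  exact hdisj.ne_of_mem hx.1 hy.1 hxy

end Hurwitz

section Moebius

/-- The disc automorphism `z ↦ (z - w) / (1 - w̄ z)`. -/
noncomputable def discMoebius (w z : ℂ) : ℂ := (z - w) / (1 - conj w * z)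

theorem discMoebius_denom_ne_zero {w z : ℂ} (hw : ‖w‖ < 1) (hz : ‖z‖ < 1) :
    1 - conj w * z ≠ 0 := by
  intro h
  have h1 : ‖conj w * z‖ = 1 := by rw [← sub_eq_zero.1 h, norm_one]
  rw [norm_mul, Complex.norm_conj] at h1
  nlinarith [norm_nonneg w, norm_nonneg z]

theorem norm_discMoebius_lt_one {w z : ℂ} (hw : ‖w‖ < 1) (hz : ‖z‖ < 1) :
    ‖discMoebius w z‖ < 1 := by
  have hne := discMoebius_denom_ne_zero hw hz
  rw [discMoebius, norm_div, div_lt_one (norm_pos_iff.2 hne)]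
  rw [← sq_lt_sq₀ (norm_nonneg _) (norm_nonneg _), ← Complex.normSq_eq_norm_sq,
    ← Complex.normSq_eq_norm_sq]
  have h1 : Complex.normSq w < 1 := by rw [Complex.normSq_eq_norm_sq]; nlinarith [norm_nonneg w]
  have h2 : Complex.normSq z < 1 := by rw [Complex.normSq_eq_norm_sq]; nlinarith [norm_nonneg z]
  simp only [Complex.normSq_apply, Complex.sub_re, Complex.sub_im, Complex.mul_re, Complex.mul_im,
    Complex.one_re, Complex.one_im, Complex.conj_re, Complex.conj_im] at *
  nlinarith [mul_pos (sub_pos.2 h1) (sub_pos.2 h2)]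

theorem injOn_discMoebius {w : ℂ} (hw : ‖w‖ < 1) : InjOn (discMoebius w) (ball 0 1) := by
  intro x hx y hy h
  have hx' := discMoebius_denom_ne_zero hw (mem_ball_zero_iff.1 hx)
  have hy' := discMoebius_denom_ne_zero hw (mem_ball_zero_iff.1 hy)
  rw [discMoebius, discMoebius, div_eq_div_iff hx' hy'] at h
  have h3 := discMoebius_denom_ne_zero hw hw
  have : (x - y) * (1 - conj w * w) = 0 := by linear_combination h
  exact sub_eq_zero.1 ((mul_eq_zero.1 this).resolve_right h3)

theorem hasDerivAt_discMoebius {w z : ℂ} (hw : ‖w‖ < 1) (hz : ‖z‖ < 1) :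
    HasDerivAt (discMoebius w) ((1 - conj w * w) / (1 - conj w * z) ^ 2) z := by
  have hne := discMoebius_denom_ne_zero hw hz
  have h1 : HasDerivAt (fun z : ℂ => z - w) 1 z := (hasDerivAt_id z).sub_const w
  have h2 : HasDerivAt (fun z : ℂ => 1 - conj w * z) (-conj w) z := by
    simpa using ((hasDerivAt_id z).const_mul (conj w)).const_sub 1
  have h3 : HasDerivAt (discMoebius w) _ z := h1.div h2 hne
  convert h3 using 2
  ring

theorem discMoebius_eq_zero {w z : ℂ} (hw : ‖w‖ < 1) (hz : ‖z‖ < 1)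
    (h : discMoebius w z = 0) : z = w := by
  rw [discMoebius, div_eq_zero_iff] at h
  exact sub_eq_zero.1 (h.resolve_right (discMoebius_denom_ne_zero hw hz))

end Moebius

/-- The slope of `g` is the slope of `q = g ^ 2` divided by `g z + g z₀`, which tends to `2 * g z₀ ≠
0`. Continuity of the root is enough. -/
theorem hasDerivAt_of_sq_eq {G : Set ℂ} (hG : IsOpen G) {g q : ℂ → ℂ} (hg : ContinuousOn g G)
    (hq : DifferentiableOn ℂ q G) (hgq : ∀ z ∈ G, g z ^ 2 = q z) {z₀ : ℂ} (hz : z₀ ∈ G)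
    (h0 : g z₀ ≠ 0) : HasDerivAt g (deriv q z₀ / (2 * g z₀)) z₀ := by
  have hgc := hg.continuousAt (hG.mem_nhds hz)
  rw [hasDerivAt_iff_tendsto_slope]
  have hqs := hasDerivAt_iff_tendsto_slope.1 (hq.differentiableAt (hG.mem_nhds hz)).hasDerivAt
  have hadd : Filter.Tendsto (fun z => g z + g z₀) (𝓝[≠] z₀) (𝓝 (2 * g z₀)) := by
    rw [two_mul]; exact (hgc.tendsto.mono_left nhdsWithin_le_nhds).add_const _
  have h2 : (2 : ℂ) * g z₀ ≠ 0 := mul_ne_zero two_ne_zero h0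
  refine (hqs.div hadd h2).congr' ?_
  filter_upwards [hadd.eventually_ne h2, self_mem_nhdsWithin,
    mem_nhdsWithin_of_mem_nhds (hG.mem_nhds hz)] with z h3 h4 h5
  have h6 : z - z₀ ≠ 0 := sub_ne_zero.2 h4
  rw [Pi.div_apply, slope_def_field, slope_def_field, ← hgq z h5, ← hgq z₀ hz]
  field_simp
  ring

/-- The competitors in the extremal problem for the Riemann map. -/
structure IsDiscInjection (G : Set ℂ) (a : ℂ) (f : ℂ → ℂ) : Prop where
  holomorphic : DifferentiableOn ℂ f G
  injOn : InjOn f G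
  norm_lt_one : ∀ z ∈ G, ‖f z‖ < 1
  map_base : f a = 0

/-- Koebe's square-root trick. Moving the omitted value `w` to `0` by a disc automorphism gives a
zero-free function, which has a continuous square root on a simply connected set. A second
automorphism brings the value at `a` back to `0`, and the derivative has grown. -/
theorem IsDiscInjection.exists_lt_norm_deriv {G : Set ℂ} {a : ℂ} (hG : IsOpen G)
    (hsc : IsSimplyConnected G) (ha : a ∈ G) {f : ℂ → ℂ} (hf : IsDiscInjection G a f) {w : ℂ}
    (hw : ‖w‖ < 1) (hwf : w ∉ f '' G) :
    ∃ h : ℂ → ℂ, IsDiscInjection G a h ∧ ‖deriv f a‖ < ‖deriv h a‖ := by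
  have hqd : ∀ z ∈ G, HasDerivAt (fun z => discMoebius w (f z))
      ((1 - conj w * w) / (1 - conj w * f z) ^ 2 * deriv f z) z := fun z hz =>
    (hasDerivAt_discMoebius hw (hf.norm_lt_one z hz)).comp z
      (hf.holomorphic.differentiableAt (hG.mem_nhds hz)).hasDerivAt
  set q : ℂ → ℂ := fun z => discMoebius w (f z) with hq
  have hqD : DifferentiableOn ℂ q G := fun z hz =>
    (hqd z hz).differentiableAt.differentiableWithinAt
  have hq0 : ∀ z ∈ G, q z ≠ 0 := fun z hz h =>
    hwf ⟨z, hz, discMoebius_eq_zero hw (hf.norm_lt_one z hz) h⟩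
  obtain ⟨g, hgc, hgq⟩ := Complex.exists_continuousOn_pow_eq hsc hG hqD.continuousOn
    (by rintro ⟨z, hz, h⟩; exact hq0 z hz h) two_ne_zero
  have hg0 : ∀ z ∈ G, g z ≠ 0 := fun z hz h => hq0 z hz (by rw [← hgq z, h]; simp)
  have hgd := fun z (hz : z ∈ G) => hasDerivAt_of_sq_eq hG hgc hqD (fun z _ => hgq z) hz (hg0 z hz)
  have hg1 : ∀ z ∈ G, ‖g z‖ < 1 := fun z hz => by
    have h1 : ‖g z‖ ^ 2 < 1 := by
      rw [← norm_pow, hgq z]; exact norm_discMoebius_lt_one hw (hf.norm_lt_one z hz)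
    nlinarith [norm_nonneg (g z)]
  have hhd : ∀ z ∈ G, HasDerivAt (fun z => discMoebius (g a) (g z))
      ((1 - conj (g a) * g a) / (1 - conj (g a) * g z) ^ 2 * (deriv q z / (2 * g z))) z :=
    fun z hz => (hasDerivAt_discMoebius (hg1 a ha) (hg1 z hz)).comp z (hgd z hz)
  refine ⟨fun z => discMoebius (g a) (g z), ⟨fun z hz =>
    (hhd z hz).differentiableAt.differentiableWithinAt, fun x hx y hy hxy => ?_,
    fun z hz => norm_discMoebius_lt_one (hg1 a ha) (hg1 z hz), by simp [discMoebius]⟩, ?_⟩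
  · have h1 : g x = g y := injOn_discMoebius (hg1 a ha) (mem_ball_zero_iff.2 (hg1 x hx))
      (mem_ball_zero_iff.2 (hg1 y hy)) hxy
    have h2 : q x = q y := by rw [← hgq x, ← hgq y, h1]
    exact hf.injOn hx hy (injOn_discMoebius hw (mem_ball_zero_iff.2 (hf.norm_lt_one x hx))
      (mem_ball_zero_iff.2 (hf.norm_lt_one y hy)) h2)
  · rw [(hhd a ha).deriv, (hqd a ha).deriv, hf.map_base]
    have hda := deriv_ne_zero_of_injOn hG hf.holomorphic hf.injOn ha
    have hdp : 0 < ‖deriv f a‖ := norm_pos_iff.2 hda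
    set t := ‖g a‖ with ht
    have ht0 : 0 < t := norm_pos_iff.2 (hg0 a ha)
    have ht1 : t < 1 := hg1 a ha
    have hwt : ‖w‖ = t ^ 2 := by
      rw [ht, ← norm_pow, hgq a]
      simp [hq, hf.map_base, discMoebius]
    have hn : ∀ v : ℂ, ‖v‖ ≤ 1 → ‖1 - conj v * v‖ = 1 - ‖v‖ ^ 2 := fun v hv => by
      rw [mul_comm, Complex.mul_conj, Complex.normSq_eq_norm_sq, ← Complex.ofReal_one,
        ← Complex.ofReal_sub, Complex.norm_real, Real.norm_of_nonneg]
      nlinarith [norm_nonneg v]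
    have hp : 0 < 1 - t ^ 2 := by nlinarith
    rw [norm_mul, norm_div, norm_pow, norm_div, norm_mul, norm_div, hn _ ht1.le, hn _ hw.le, norm_mul,
      hwt, ← ht, mul_zero, sub_zero]
    simp only [one_pow, norm_one, div_one, Complex.norm_ofNat]
    -- With `t = ‖g a‖` and `‖w‖ = t ^ 2` the derivative is multiplied by `(1 + t ^ 2) / (2 * t)`,
    -- which exceeds `1` because `t < 1`.
    have : (1 - t ^ 2) / (1 - t ^ 2) ^ 2 * ((1 - (t ^ 2) ^ 2) * ‖deriv f a‖ / (2 * t))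
        = (1 + t ^ 2) / (2 * t) * ‖deriv f a‖ := by
      field_simp
      ring
    rw [this]
    have h1 : 1 < (1 + t ^ 2) / (2 * t) := by
      rw [lt_div_iff₀ (by positivity)]
      nlinarith [sq_nonneg (1 - t), mul_pos (sub_pos.2 ht1) (sub_pos.2 ht1)]
    nlinarith

/-- **The Riemann mapping theorem** for bounded domains. -/
theorem exists_isRiemannMap {G : Set ℂ} {a : ℂ} (hG : IsOpen G) (hsc : IsSimplyConnected G)
    (hb : Bornology.IsBounded G) (ha : a ∈ G) : ∃ f : ℂ → ℂ, IsRiemannMap G a f := by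
  set S : Set ℝ := {x | ∃ f, IsDiscInjection G a f ∧ ‖deriv f a‖ = x} with hS
  obtain ⟨r, hr, hrG⟩ := Metric.isOpen_iff.1 hG a ha
  have hSb : BddAbove S := by
    refine ⟨1 / r, ?_⟩
    rintro _ ⟨f, hf, rfl⟩
    exact Complex.norm_deriv_le_div_of_mapsTo_ball (hf.holomorphic.mono hrG) (fun z hz => by
      rw [hf.map_base, mem_closedBall_zero_iff]; exact (hf.norm_lt_one z (hrG hz)).le) hr
  have hne : ∃ f, IsDiscInjection G a f := by
    obtain ⟨R, hR⟩ := hb.subset_ball a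
    have hR0 : 0 < R := pos_of_mem_ball (hR ha)
    have hRc : (R : ℂ) ≠ 0 := by exact_mod_cast hR0.ne'
    refine ⟨fun z => (z - a) / R, by fun_prop, fun x _ y _ h => ?_, fun z hz => ?_, by simp⟩
    · simpa [hRc] using h
    · rw [norm_div, Complex.norm_real, Real.norm_of_nonneg hR0.le, div_lt_one hR0]
      simpa [dist_eq_norm] using hR hz
  have hpos : ∀ f, IsDiscInjection G a f → 0 < ‖deriv f a‖ := fun f hf =>
    norm_pos_iff.2 (deriv_ne_zero_of_injOn hG hf.holomorphic hf.injOn ha)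
  obtain ⟨x, -, hxlim, hxS⟩ := exists_seq_tendsto_sSup
    (by obtain ⟨f, hf⟩ := hne; exact ⟨_, f, hf, rfl⟩ : S.Nonempty) hSb
  choose u hu hux using hxS
  set l : Ultrafilter ℕ := Ultrafilter.of Filter.atTop
  have hl : (l : Filter ℕ) ≤ Filter.atTop := Ultrafilter.of_le _
  obtain ⟨f, hf⟩ := exists_tendstoLocallyUniformlyOn_of_bounded l hG (fun n => (hu n).holomorphic)
    fun n z hz => ((hu n).norm_lt_one z hz).le
  have hev : ∀ᶠ n in (l : Filter ℕ), DifferentiableOn ℂ (u n) G :=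
    Filter.Eventually.of_forall fun n => (hu n).holomorphic
  have hfd : DifferentiableOn ℂ f G := hf.differentiableOn hev hG
  have hderiv : ‖deriv f a‖ = sSup S := by
    refine tendsto_nhds_unique ((hf.deriv hev hG).tendsto_at ha).norm ?_
    refine (hxlim.mono_left hl).congr fun n => (hux n).symm
  have hs0 : 0 < ‖deriv f a‖ := by
    rw [hderiv]
    obtain ⟨f, hf⟩ := hne
    exact (hpos f hf).trans_le (le_csSup hSb ⟨f, hf, rfl⟩)
  have hinj : InjOn f G := injOn_of_tendstoLocallyUniformlyOn hG
    hsc.isPathConnected.isConnected.isPreconnected (fun n => (hu n).holomorphic)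
    (fun n => (hu n).injOn) hf ha (norm_pos_iff.1 hs0)
  have hfa : f a = 0 := by
    refine tendsto_nhds_unique (hf.tendsto_at ha) ?_
    simp only [(hu _).map_base]
    exact tendsto_const_nhds
  have hf1 : ∀ z ∈ G, ‖f z‖ < 1 := by
    -- The limit only gives `‖f‖ ≤ 1`. The image is open, hence inside the interior of the closed
    -- disc.
    have hsub : f '' G ⊆ interior (closedBall 0 1) := by
      refine interior_maximal ?_ (isOpen_image_of_injOn hG hfd hinj)
      rintro _ ⟨z, hz, rfl⟩
      rw [mem_closedBall_zero_iff]
      exact le_of_tendsto (hf.tendsto_at hz).norm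
        (Filter.Eventually.of_forall fun n => ((hu n).norm_lt_one z hz).le)
    rw [interior_closedBall _ one_ne_zero] at hsub
    exact fun z hz => mem_ball_zero_iff.1 (hsub (mem_image_of_mem f hz))
  have hfI : IsDiscInjection G a f := ⟨hfd, hinj, hf1, hfa⟩
  have hsurj : ball 0 1 ⊆ f '' G := by
    intro w hw
    by_contra hwf
    obtain ⟨h, hh, hlt⟩ := hfI.exists_lt_norm_deriv hG hsc ha (mem_ball_zero_iff.1 hw) hwf
    have := le_csSup hSb ⟨h, hh, rfl⟩
    linarith
  -- A rotation making the derivative at `a` equal to its modulus.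
  set c : ℂ := conj (deriv f a) / ‖deriv f a‖ with hc
  have hnc : (‖deriv f a‖ : ℂ) ≠ 0 := by exact_mod_cast hs0.ne'
  have hc1 : ‖c‖ = 1 := by
    rw [hc, norm_div, Complex.norm_conj, Complex.norm_real, norm_norm, div_self hs0.ne']
  have hc0 : c ≠ 0 := by rw [← norm_pos_iff, hc1]; exact one_pos
  have hcd : deriv (fun z => c * f z) a = (‖deriv f a‖ : ℂ) := by
    rw [deriv_const_mul _ (hfd.differentiableAt (hG.mem_nhds ha)), hc, div_mul_eq_mul_div,
      mul_comm, Complex.mul_conj, Complex.normSq_eq_norm_sq]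
    push_cast
    field_simp
  refine ⟨fun z => c * f z, hfd.const_mul c, ⟨fun z hz => ?_, fun x hx y hy h => ?_, fun w hw => ?_⟩,
    by simp [hfa], by rw [hcd]; simpa using hs0, by rw [hcd]; simp⟩
  · rw [mem_ball_zero_iff, norm_mul, hc1, one_mul]; exact hf1 z hz
  · exact hinj hx hy (mul_left_cancel₀ hc0 h)
  · obtain ⟨z, hz, hzw⟩ := hsurj (show c⁻¹ * w ∈ ball (0 : ℂ) 1 by
      rw [mem_ball_zero_iff, norm_mul, norm_inv, hc1, inv_one, one_mul]
      exact mem_ball_zero_iff.1 hw)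
    exact ⟨z, hz, by simp only [hzw]; field_simp⟩

/-! ### Construction of a probe domain -/

/-- A homeomorphism of the plane supported in a ball that moves the centre by less than the
radius. -/
theorem exists_homeomorph_move_center (c v : ℂ) {r : ℝ} (hv : ‖v‖ < r) :
    ∃ ψ : ℂ ≃ₜ ℂ, ψ c = c + v ∧ (∀ z ∉ ball c r, ψ z = z) ∧ ∀ z ∈ ball c r, ψ z ∈ ball c r := by
  have hr : 0 < r := (norm_nonneg v).trans_lt hv
  -- The identity plus a tent function times `v`. The perturbation has Lipschitz constant `‖v‖ / r <
  -- 1`, so the map is a homeomorphism of the plane.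
  set f : ℂ → ℂ := fun z => z + ((max 0 (1 - ‖z - c‖ / r) : ℝ) : ℂ) * v with hf
  have hk : ‖v‖ / r < 1 := (div_lt_one hr).2 hv
  set k : NNReal := ⟨‖v‖ / r, by positivity⟩ with hkdef
  have happ : ApproximatesLinearOn f
      ((ContinuousLinearEquiv.refl ℝ ℂ : ℂ ≃L[ℝ] ℂ) : ℂ →L[ℝ] ℂ) univ k := by
    intro x _ y _
    have h1 : f x - f y - (x - y)
        = ((max 0 (1 - ‖x - c‖ / r) - max 0 (1 - ‖y - c‖ / r) : ℝ) : ℂ) * v := by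
      simp only [hf]; push_cast; ring
    have h2 : |max 0 (1 - ‖x - c‖ / r) - max 0 (1 - ‖y - c‖ / r)| ≤ ‖x - y‖ / r := by
      rw [max_comm 0, max_comm 0]
      refine (abs_max_sub_max_le_abs _ _ _).trans ?_ |>.trans (?_ : |‖y - c‖ - ‖x - c‖| / r ≤ _)
      · rw [← abs_of_pos hr, ← abs_div, abs_of_pos hr, sub_div]
        exact le_of_eq (by congr 1; ring)
      · gcongr
        refine (abs_norm_sub_norm_le _ _).trans (le_of_eq ?_)
        rw [sub_sub_sub_cancel_right, norm_sub_rev]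
    change ‖f x - f y - (x - y)‖ ≤ ‖v‖ / r * ‖x - y‖
    rw [h1, norm_mul, Complex.norm_real, Real.norm_eq_abs]
    calc _ ≤ ‖x - y‖ / r * ‖v‖ := by gcongr
      _ = _ := by ring
  have hN : ‖((ContinuousLinearEquiv.refl ℝ ℂ).symm : ℂ →L[ℝ] ℂ)‖₊ = 1 := by
    ext; exact ContinuousLinearMap.norm_id
  have hkN : k < ‖((ContinuousLinearEquiv.refl ℝ ℂ).symm : ℂ →L[ℝ] ℂ)‖₊⁻¹ := by
    rw [hN, inv_one]; exact hk
  set ψ := happ.toHomeomorph f (Or.inr hkN) with hψ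
  have hψf : ∀ z, ψ z = f z := fun z => rfl
  have hfix : ∀ z ∉ ball c r, ψ z = z := by
    intro z hz
    rw [hψf]
    have : r ≤ ‖z - c‖ := by rw [mem_ball, not_lt, dist_eq_norm] at hz; exact hz
    have h1 : 1 - ‖z - c‖ / r ≤ 0 := by rw [sub_nonpos, le_div_iff₀ hr]; linarith
    simp [hf, max_eq_left h1]
  refine ⟨ψ, ?_, hfix, fun z hz => ?_⟩
  · rw [hψf]; simp [hf]
  · by_contra h
    have h1 := ψ.injective (hfix _ h)
    rw [h1] at h
    exact h hz

theorem isSimplyConnected_of_convex {s : Set ℂ} (hs : Convex ℝ s) (hne : s.Nonempty) :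
    IsSimplyConnected s := by
  have := hs.contractibleSpace hne
  exact SimplyConnectedSpace.ofContractible s

/-- Two points of a domain lie in a simply connected open subset of it. -/
theorem exists_isSimplyConnected_subset {Ω : Set ℂ} {a b : ℂ} (hΩ : IsOpen Ω)
    (hc : IsPreconnected Ω) (ha : a ∈ Ω) (hb : b ∈ Ω) :
    ∃ V : Set ℂ, IsOpen V ∧ IsSimplyConnected V ∧ V ⊆ Ω ∧ a ∈ V ∧ b ∈ V := by
  set P : ℂ → Prop := fun b => ∃ V : Set ℂ, IsOpen V ∧ IsSimplyConnected V ∧ V ⊆ Ω ∧ a ∈ V ∧ b ∈ V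
    with hP
  -- If `a` lies in the support of the move, the ball `ball x (2 * r)` already contains both points.
  -- Otherwise the homeomorphism carrying `p` to `q` fixes `a` and keeps the image of `V` inside
  -- `Ω`.
  have hmove : ∀ x r, 0 < r → ball x (2 * r) ⊆ Ω → ∀ p ∈ ball x (r / 2), ∀ q ∈ ball x (r / 2),
      P p → P q := by
    rintro x r hr hsub p hp q hq ⟨V, hVo, hVs, hVΩ, haV, hpV⟩
    have hpx : ball p r ⊆ ball x (2 * r) := ball_subset_ball' (by
      have := mem_ball.1 hp; linarith)
    by_cases hap : a ∈ ball p r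
    · exact ⟨ball x (2 * r), isOpen_ball, isSimplyConnected_of_convex (convex_ball _ _)
        ⟨x, mem_ball_self (by linarith)⟩, hsub, hpx hap, ball_subset_ball (by linarith) hq⟩
    · have hqp : ‖q - p‖ < r := by
        rw [← dist_eq_norm]
        have h1 := dist_triangle_right q p x
        have h2 := mem_ball.1 hp
        have h3 := mem_ball.1 hq
        linarith
      obtain ⟨ψ, hψp, hfix, hin⟩ := exists_homeomorph_move_center p (q - p) hqp
      refine ⟨ψ '' V, ψ.isOpenMap V hVo, ψ.isSimplyConnected_image.2 hVs, ?_,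
        ⟨a, haV, hfix a hap⟩, ⟨p, hpV, by rw [hψp]; ring⟩⟩
      rintro _ ⟨z, hz, rfl⟩
      by_cases hzp : z ∈ ball p r
      · exact hsub (hpx (hin z hzp))
      · rw [hfix z hzp]; exact hVΩ hz
  have hradius : ∀ x ∈ Ω, ∃ r, 0 < r ∧ ball x (2 * r) ⊆ Ω := fun x hx => by
    obtain ⟨R, hR, h⟩ := Metric.isOpen_iff.1 hΩ x hx
    exact ⟨R / 2, by positivity, by rwa [mul_div_cancel₀ R two_ne_zero]⟩
  have hPΩ : ∀ x, P x → x ∈ Ω := fun x ⟨V, _, _, h, _, hx⟩ => h hx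
  -- The points reachable from `a` form an open and relatively closed subset of the connected set
  -- `Ω`.
  refine hc.subset_of_closure_inter_subset (u := {x | P x}) ?_ ⟨a, ha, ?_⟩ ?_ hb
  · rw [Metric.isOpen_iff]
    intro x hx
    obtain ⟨r, hr, h⟩ := hradius x (hPΩ x hx)
    exact ⟨r / 2, by positivity, fun y hy =>
      hmove x r hr h x (mem_ball_self (by positivity)) y hy hx⟩
  · obtain ⟨r, hr, h⟩ := hradius a ha
    exact ⟨ball a (2 * r), isOpen_ball, isSimplyConnected_of_convex (convex_ball _ _)
        ⟨a, mem_ball_self (by linarith)⟩, h, mem_ball_self (by linarith), mem_ball_self (by linarith)⟩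
  · rintro x ⟨hxc, hxΩ⟩
    obtain ⟨r, hr, h⟩ := hradius x hxΩ
    obtain ⟨y, hy, hxy⟩ := Metric.mem_closure_iff.1 hxc (r / 2) (by positivity)
    exact hmove x r hr h y (by rwa [mem_ball, dist_comm]) x (mem_ball_self (by positivity)) hy

theorem hasRealAnalyticBoundary_preimage_ball {V : Set ℂ} (hV : IsOpen V) {φ : ℂ → ℂ}
    (hφ : DifferentiableOn ℂ φ V) (hd : ∀ z ∈ V, deriv φ z ≠ 0) {s : ℝ} (hs : 0 < s)
    (hcl : closure (V ∩ φ ⁻¹' ball 0 s) ⊆ V) (hle : ∀ z ∈ closure (V ∩ φ ⁻¹' ball 0 s), ‖φ z‖ ≤ s) :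
    HasRealAnalyticBoundary (V ∩ φ ⁻¹' ball 0 s) := by
  intro p hp
  have hpV : p ∈ V := hcl hp.1
  have hGo : IsOpen (V ∩ φ ⁻¹' ball 0 s) := hφ.continuousOn.isOpen_inter_preimage hV isOpen_ball
  have hps : ‖φ p‖ = s := by
    refine le_antisymm (hle p hp.1) ?_
    by_contra h
    rw [not_le] at h
    refine hp.2 ?_
    rw [hGo.interior_eq]
    exact ⟨hpV, by simpa using h⟩
  have hpa := hφ.analyticAt (hV.mem_nhds hpV)
  have hpR : AnalyticAt ℝ φ p := hpa.restrictScalars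
  have hform : (fun z => ‖φ z‖ ^ 2 - s ^ 2) = fun z => (φ z).re ^ 2 + (φ z).im ^ 2 - s ^ 2 := by
    funext z
    rw [← Complex.normSq_eq_norm_sq, Complex.normSq_apply]; ring
  have hre : AnalyticAt ℝ (fun z => (φ z).re) p := (Complex.reCLM.analyticAt _).comp hpR
  have him : AnalyticAt ℝ (fun z => (φ z).im) p := (Complex.imCLM.analyticAt _).comp hpR
  refine ⟨fun z => ‖φ z‖ ^ 2 - s ^ 2, ?_, ?_, ?_⟩
  · rw [hform]
    exact ((hre.pow 2).add (him.pow 2)).sub analyticAt_const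
  · have h1 : HasFDerivAt φ _ p :=
      hpa.differentiableAt.hasDerivAt.hasFDerivAt.restrictScalars ℝ
    have h2 := (h1.norm_sq.sub_const (s ^ 2)).fderiv
    rw [h2]
    intro h0
    -- In this direction the differential of `φ` returns `φ p`, so that of `‖φ‖ ^ 2` is `2 * ‖φ p‖ ^
    -- 2 = 2 * s ^ 2`, which is nonzero.
    have h3 := DFunLike.congr_fun h0 (φ p / deriv φ p)
    have h4 : φ p / deriv φ p * deriv φ p = φ p := div_mul_cancel₀ _ (hd p hpV)
    simp [h4] at h3
    rw [h3, norm_zero] at hps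
    exact hs.ne hps
  · filter_upwards [hV.mem_nhds hpV] with z hz
    simp only [mem_inter_iff, hz, true_and, mem_preimage, mem_ball_zero_iff]
    rw [sub_neg, sq_lt_sq₀ (norm_nonneg _) hs.le]

/-- A sublevel set `‖φ‖ < s` of a Riemann map with `‖φ b‖ < s < 1` works: the inverse of `φ`
identifies it with a round disc, and its closure lies in the compact image of the closed disc of
radius `s`. -/
theorem exists_isProbeDomain {Ω : Set ℂ} {a b : ℂ} (hΩ : IsOpen Ω) (hc : IsConnected Ω)
    (hbd : Bornology.IsBounded Ω) (ha : a ∈ Ω) (hb : b ∈ Ω) : ∃ G, IsProbeDomain Ω G a b := by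
  obtain ⟨V, hVo, hVs, hVΩ, haV, hbV⟩ := exists_isSimplyConnected_subset hΩ hc.isPreconnected ha hb
  obtain ⟨φ, hφ⟩ := exists_isRiemannMap hVo hVs (hbd.subset hVΩ) haV
  obtain ⟨F, hF⟩ : ∃ F : ℂ → ℂ, ∀ w ∈ ball (0 : ℂ) 1, F w ∈ V ∧ φ (F w) = w :=
    ⟨Function.invFunOn φ V, fun w hw => ⟨Function.invFunOn_mem (hφ.bijOn.surjOn hw),
      Function.invFunOn_eq (hφ.bijOn.surjOn hw)⟩⟩
  have hFφ := left_inverse_of_bijOn hφ.bijOn hF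
  have hFc := (differentiableOn_inverse_of_bijOn hVo hφ.holomorphic hφ.bijOn hF).continuousOn
  have hb1 : ‖φ b‖ < 1 := mem_ball_zero_iff.1 (hφ.bijOn.mapsTo hbV)
  obtain ⟨s, hbs, hs1⟩ := exists_between hb1
  have hs0 : 0 < s := (norm_nonneg _).trans_lt hbs
  set G := V ∩ φ ⁻¹' ball 0 s with hG
  have hs1' : closedBall (0 : ℂ) s ⊆ ball 0 1 := closedBall_subset_ball hs1
  have hbs1 : ball (0 : ℂ) s ⊆ ball 0 1 := ball_subset_closedBall.trans hs1'
  have hGo : IsOpen G := hφ.holomorphic.continuousOn.isOpen_inter_preimage hVo isOpen_ball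
  have hK : IsCompact (F '' closedBall 0 s) := (isCompact_closedBall 0 s).image_of_continuousOn
    (hFc.mono hs1')
  have hclK : closure G ⊆ F '' closedBall 0 s := by
    refine closure_minimal ?_ hK.isClosed
    rintro z ⟨hz, hzs⟩
    exact ⟨φ z, ball_subset_closedBall hzs, hFφ z hz⟩
  have hKV : F '' closedBall 0 s ⊆ V := by
    rintro _ ⟨w, hw, rfl⟩; exact (hF w (hs1' hw)).1
  refine ⟨G, hGo, ?_, hK.of_isClosed_subset isClosed_closure hclK, hclK.trans (hKV.trans hVΩ),
    ?_, ⟨haV, by simp [hφ.map_base, hs0]⟩, ⟨hbV, by simpa using hbs⟩⟩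
  · have e : G ≃ₜ ball (0 : ℂ) s :=
      { toFun := fun z => ⟨φ z, z.2.2⟩
        invFun := fun w => ⟨F w, (hF w (hbs1 w.2)).1, by
          rw [mem_preimage, (hF w (hbs1 w.2)).2]; exact w.2⟩
        left_inv := fun z => Subtype.ext (hFφ z z.2.1)
        right_inv := fun w => Subtype.ext (hF w (hbs1 w.2)).2
        continuous_toFun := ((hφ.holomorphic.continuousOn.mono inter_subset_left).domRestrict).subtype_mk _
        continuous_invFun := ((hFc.mono hbs1).domRestrict).subtype_mk _ }
    exact e.toHomotopyEquiv.simplyConnectedSpace_iff.2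
      (isSimplyConnected_of_convex (convex_ball 0 s) ⟨0, mem_ball_self hs0⟩)
  · refine hasRealAnalyticBoundary_preimage_ball hVo hφ.holomorphic
      (fun z hz => deriv_ne_zero_of_injOn hVo hφ.holomorphic hφ.bijOn.injOn hz) hs0
      (hclK.trans hKV) fun z hz => ?_
    obtain ⟨w, hw, rfl⟩ := hclK hz
    rw [(hF w (hs1' hw)).2]
    exact mem_closedBall_zero_iff.1 hw

/-! ### Schwarz reflection across a diameter -/

section Reflection

theorem Complex.norm_le_norm_of_abs_im_le {x y y' : ℝ} (h : |y'| ≤ |y|) :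
    ‖(x : ℂ) + y' * Complex.I‖ ≤ ‖(x : ℂ) + y * Complex.I‖ := by
  rw [Complex.norm_add_mul_I, Complex.norm_add_mul_I]
  exact Real.sqrt_le_sqrt (by nlinarith [sq_le_sq.2 h])

/-- Cauchy's theorem on a rectangle asks for differentiability only in the interior, and the
interior misses the real axis when one side lies on it. -/
theorem boundary_rect_eq_zero_of_off_real {f : ℂ → ℂ} {R : ℝ}
    (hc : ContinuousOn f (ball 0 R)) (hd : ∀ z ∈ ball (0 : ℂ) R, z.im ≠ 0 → DifferentiableAt ℂ f z)
    (x₁ x₂ y₁ y₂ : ℝ) (hy : y₁ = 0 ∨ y₂ = 0) (hsub : (uIcc x₁ x₂ ×ℂ uIcc y₁ y₂) ⊆ ball 0 R) :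
    (((∫ x : ℝ in x₁..x₂, f (x + y₁ * Complex.I)) - ∫ x : ℝ in x₁..x₂, f (x + y₂ * Complex.I)) +
      Complex.I • ∫ y : ℝ in y₁..y₂, f (x₂ + y * Complex.I)) -
      Complex.I • ∫ y : ℝ in y₁..y₂, f (x₁ + y * Complex.I) = 0 := by
  have h := Complex.integral_boundary_rect_eq_zero_of_continuousOn_of_differentiableOn f
    (x₁ + y₁ * Complex.I) (x₂ + y₂ * Complex.I) (by simpa using hc.mono hsub) (by
      intro z hz
      simp at hz
      rw [Complex.mem_reProdIm] at hz
      refine (hd z (hsub ?_) ?_).differentiableWithinAt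
      · rw [Complex.mem_reProdIm]
        exact ⟨Ioo_subset_Icc_self hz.1, Ioo_subset_Icc_self hz.2⟩
      · intro h0
        have h2 := hz.2
        rw [h0, mem_Ioo, min_lt_iff, lt_max_iff] at h2
        rcases hy with h | h <;> rw [h] at h2 <;> simp only [lt_irrefl, false_or, or_false] at h2 <;>
          exact lt_asymm h2.1 h2.2)
  simpa using h

/-- The boundary integral is the sum of two signed ones over rectangles with a side on the real
axis, whether or not the original rectangle meets the axis. Both stay in the ball because shrinking
`|im|` shrinks the norm. -/
theorem isConservativeOn_of_off_real {f : ℂ → ℂ} {R : ℝ}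
    (hc : ContinuousOn f (ball 0 R))
    (hd : ∀ z ∈ ball (0 : ℂ) R, z.im ≠ 0 → DifferentiableAt ℂ f z) :
    Complex.IsConservativeOn f (ball 0 R) := by
  intro z w hzw
  rw [← add_eq_zero_iff_eq_neg, Complex.wedgeIntegral_add_wedgeIntegral_eq]
  have hmem : ∀ x ∈ uIcc z.re w.re, ∀ y ∈ uIcc z.im w.im,
      (x : ℂ) + y * Complex.I ∈ ball (0 : ℂ) R := fun x hx y hy => hzw (by
    rw [Complex.Rectangle, Complex.mem_reProdIm]; simpa using ⟨hx, hy⟩)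
  have hmem' : ∀ x ∈ uIcc z.re w.re, ∀ y ∈ uIcc z.im w.im, ∀ y' ∈ uIcc y 0,
      (x : ℂ) + y' * Complex.I ∈ ball (0 : ℂ) R := fun x hx y hy y' hy' => by
    refine mem_ball_zero_iff.2 ((Complex.norm_le_norm_of_abs_im_le ?_).trans_lt
      (mem_ball_zero_iff.1 (hmem x hx y hy)))
    rcases mem_uIcc.1 hy' with h | h
    · rw [abs_of_nonpos h.2, abs_of_nonpos (h.1.trans h.2)]; linarith [h.1]
    · rw [abs_of_nonneg h.1, abs_of_nonneg (h.1.trans h.2)]; exact h.2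
  have hrect : ∀ y ∈ uIcc z.im w.im, (uIcc z.re w.re ×ℂ uIcc y 0) ⊆ ball (0 : ℂ) R := by
    intro y hy u hu
    rw [Complex.mem_reProdIm] at hu
    have := hmem' _ hu.1 y hy _ hu.2
    rwa [Complex.re_add_im] at this
  have hint : ∀ x ∈ uIcc z.re w.re, ∀ y ∈ uIcc z.im w.im,
      IntervalIntegrable (fun t : ℝ => f (x + t * Complex.I)) volume y 0 := by
    intro x hx y hy
    refine ContinuousOn.intervalIntegrable (hc.comp (by fun_prop) fun t ht => hmem' x hx y hy t ht)
  have h1 := boundary_rect_eq_zero_of_off_real hc hd z.re w.re z.im 0 (Or.inr rfl)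
    (hrect _ left_mem_uIcc)
  have h2 := boundary_rect_eq_zero_of_off_real hc hd z.re w.re 0 w.im (Or.inl rfl)
    (by rw [uIcc_comm 0]; exact hrect _ right_mem_uIcc)
  have a1 := intervalIntegral.integral_add_adjacent_intervals
    (hint z.re left_mem_uIcc z.im left_mem_uIcc) (hint z.re left_mem_uIcc w.im right_mem_uIcc).symm
  have a2 := intervalIntegral.integral_add_adjacent_intervals
    (hint w.re right_mem_uIcc z.im left_mem_uIcc) (hint w.re right_mem_uIcc w.im right_mem_uIcc).symm
  rw [← a1, ← a2]
  simp only [smul_eq_mul] at *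
  linear_combination h1 + h2

/-- A continuous function on a disc that is holomorphic off the real axis is holomorphic. -/
theorem differentiableOn_ball_of_off_real {f : ℂ → ℂ} {R : ℝ}
    (hc : ContinuousOn f (ball 0 R))
    (hd : ∀ z ∈ ball (0 : ℂ) R, z.im ≠ 0 → DifferentiableAt ℂ f z) :
    DifferentiableOn ℂ f (ball 0 R) :=
  ((isConservativeOn_of_off_real hc hd).isExactOn_ball hc).differentiableOn isOpen_ball

theorem convex_ball_inter_im_pos (R : ℝ) : Convex ℝ (ball (0 : ℂ) R ∩ {z | 0 < z.im}) :=
  (convex_ball _ _).inter (convex_halfSpace_im_gt 0)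

theorem convex_ball_inter_im_neg (R : ℝ) : Convex ℝ (ball (0 : ℂ) R ∩ {z | z.im < 0}) :=
  (convex_ball _ _).inter (convex_halfSpace_im_lt 0)

theorem isOpen_ball_inter_im_pos (R : ℝ) : IsOpen (ball (0 : ℂ) R ∩ {z | 0 < z.im}) :=
  isOpen_ball.inter (isOpen_lt continuous_const Complex.continuous_im)

theorem isOpen_ball_inter_im_neg (R : ℝ) : IsOpen (ball (0 : ℂ) R ∩ {z | z.im < 0}) :=
  isOpen_ball.inter (isOpen_lt Complex.continuous_im continuous_const)

/-- A bounded holomorphic function on a convex open set has a primitive that extends to a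
Lipschitz function on the plane. -/
theorem exists_continuous_primitive {s : Set ℂ} (hs : Convex ℝ s) (ho : IsOpen s) {g : ℂ → ℂ}
    (hg : DifferentiableOn ℂ g s) {C : NNReal} (hC : ∀ z ∈ s, ‖g z‖₊ ≤ C) :
    ∃ P : ℂ → ℂ, Continuous P ∧ ∀ z ∈ s, HasDerivAt P (g z) z := by
  obtain ⟨p, hp⟩ := hs.exists_forall_hasDerivWithinAt hg
  obtain ⟨P, hP, hpP⟩ :=
    (hs.lipschitzOnWith_of_nnnorm_hasDerivWithin_le hp hC).extend_finite_dimension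
  refine ⟨P, hP.continuous, fun z hz => ?_⟩
  exact ((hp z hz).hasDerivAt (ho.mem_nhds hz)).congr_of_eventuallyEq
    (hpP.symm.eventuallyEq_of_mem (ho.mem_nhds hz))

/-- If two bounded holomorphic functions on the upper and lower half discs have matching boundary
values on the diameter, their continuous primitives differ by a constant on the diameter. -/
theorem sub_eq_of_jump_tendsto_zero {R : ℝ} {g k P M : ℂ → ℂ}
    (hP : Continuous P) (hM : Continuous M)
    (hPd : ∀ z ∈ ball (0 : ℂ) R ∩ {z | 0 < z.im}, HasDerivAt P (g z) z)
    (hMd : ∀ z ∈ ball (0 : ℂ) R ∩ {z | z.im < 0}, HasDerivAt M (k z) z)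
    (hjump : ∀ ε > 0, ∃ η > 0, ∀ z ∈ ball (0 : ℂ) R ∩ {z | 0 < z.im}, z.im < η →
      ‖g z - k (conj z)‖ ≤ ε) {x : ℝ} (hx : |x| < R) :
    P x - M x = P 0 - M 0 := by
  have hlim : ∀ t : ℝ, Filter.Tendsto (fun y : ℝ => P (t + y * Complex.I) - M (t - y * Complex.I))
      (𝓝[>] 0) (𝓝 (P t - M t)) := fun t => by
    have hc : Continuous fun y : ℝ => P (t + y * Complex.I) - M (t - y * Complex.I) := by fun_prop
    have := hc.tendsto 0
    simp only [Complex.ofReal_zero, zero_mul, add_zero, sub_zero] at this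
    exact this.mono_left nhdsWithin_le_nhds
  have hdiff := ((hlim x).sub (hlim 0)).norm
  rw [← sub_eq_zero, ← norm_le_zero_iff]
  refine le_of_forall_pos_le_add fun δ hδ => ?_
  rw [zero_add]
  -- The mean value inequality along a segment of length `|x|` just off the diameter then costs at
  -- most `δ`.
  obtain ⟨η, hη, hj⟩ := hjump (δ / (|x| + 1)) (by positivity)
  simp only [Complex.ofReal_zero] at hdiff
  refine le_of_tendsto hdiff ?_
  have hR : 0 < R := (abs_nonneg x).trans_lt hx
  have hη' : 0 < min η (R - |x|) := lt_min hη (by linarith)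
  filter_upwards [Ioo_mem_nhdsGT hη'] with y hy
  have hy0 : 0 < y := hy.1
  have hyη : y < η := hy.2.trans_le (min_le_left _ _)
  have hyR : y < R - |x| := hy.2.trans_le (min_le_right _ _)
  have hmem : ∀ t ∈ Icc (-|x|) |x|, ∀ s : ℝ, |s| = y → (t : ℂ) + s * Complex.I ∈ ball (0 : ℂ) R := by
    intro t ht s hs
    rw [mem_ball_zero_iff]
    refine (norm_add_le _ _).trans_lt ?_
    rw [norm_mul, Complex.norm_I, mul_one, Complex.norm_real, Complex.norm_real, Real.norm_eq_abs,
      Real.norm_eq_abs, hs]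
    have := abs_le.2 ht
    linarith
  have hup : ∀ t ∈ Icc (-|x|) |x|, (t : ℂ) + y * Complex.I ∈ ball (0 : ℂ) R ∩ {z | 0 < z.im} :=
    fun t ht => ⟨hmem t ht y (abs_of_pos hy0), by simpa using hy0⟩
  have hdn : ∀ t ∈ Icc (-|x|) |x|, (t : ℂ) - y * Complex.I ∈ ball (0 : ℂ) R ∩ {z | z.im < 0} :=
    fun t ht => ⟨by
      have := hmem t ht (-y) (by rw [abs_neg, abs_of_pos hy0])
      simpa [sub_eq_add_neg] using this, by simpa using hy0⟩
  have hderiv : ∀ t ∈ Icc (-|x|) |x|, HasDerivWithinAt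
      (fun t : ℝ => P (t + y * Complex.I) - M (t - y * Complex.I))
      (g (t + y * Complex.I) - k (t - y * Complex.I)) (Icc (-|x|) |x|) t := fun t ht =>
    (((hPd _ (hup t ht)).comp_add_const (t : ℂ) (y * Complex.I)).comp_ofReal.sub
      ((hMd _ (hdn t ht)).comp_sub_const (t : ℂ) (y * Complex.I)).comp_ofReal).hasDerivWithinAt
  have hb := (convex_Icc (-|x|) |x|).norm_image_sub_le_of_norm_hasDerivWithin_le
    (𝕜 := ℝ) (C := δ / (|x| + 1)) hderiv (fun t ht => by
      have := hj _ (hup t ht) (by simpa using hyη)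
      have hcj : conj ((t : ℂ) + y * Complex.I) = t - y * Complex.I := by
        simp [sub_eq_add_neg]
      rwa [hcj] at this)
    (show (0 : ℝ) ∈ Icc (-|x|) |x| from ⟨by simp, by simp⟩)
    (show x ∈ Icc (-|x|) |x| from ⟨neg_abs_le x, le_abs_self x⟩)
  simp only [Complex.ofReal_zero] at hb
  refine hb.trans ?_
  rw [sub_zero, Real.norm_eq_abs, div_mul_eq_mul_div, div_le_iff₀ (by positivity)]
  nlinarith [abs_nonneg x]

/-- Two bounded holomorphic functions on the two half discs whose difference across the diameter
tends to zero are restrictions of one holomorphic function. -/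
theorem exists_differentiableOn_of_jump_tendsto_zero {R : ℝ} {g k : ℂ → ℂ} {C : NNReal}
    (hg : DifferentiableOn ℂ g (ball (0 : ℂ) R ∩ {z | 0 < z.im}))
    (hk : DifferentiableOn ℂ k (ball (0 : ℂ) R ∩ {z | z.im < 0}))
    (hgC : ∀ z ∈ ball (0 : ℂ) R ∩ {z | 0 < z.im}, ‖g z‖₊ ≤ C)
    (hkC : ∀ z ∈ ball (0 : ℂ) R ∩ {z | z.im < 0}, ‖k z‖₊ ≤ C)
    (hjump : ∀ ε > 0, ∃ η > 0, ∀ z ∈ ball (0 : ℂ) R ∩ {z | 0 < z.im}, z.im < η →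
      ‖g z - k (conj z)‖ ≤ ε) :
    ∃ g₁ : ℂ → ℂ, DifferentiableOn ℂ g₁ (ball 0 R) ∧
      EqOn g₁ g (ball (0 : ℂ) R ∩ {z | 0 < z.im}) := by
  obtain ⟨P, hP, hPd⟩ := exists_continuous_primitive (convex_ball_inter_im_pos R)
    (isOpen_ball_inter_im_pos R) hg hgC
  obtain ⟨M, hM, hMd⟩ := exists_continuous_primitive (convex_ball_inter_im_neg R)
    (isOpen_ball_inter_im_neg R) hk hkC
  classical
  -- `g` and `k` need not have boundary values, but their primitives do. The primitives are glued
  -- along the diameter, and the glued function is differentiated at the end.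
  set Q : ℂ → ℂ := fun z => if 0 ≤ z.im then P z else M z + (P 0 - M 0) with hQ
  have hQP : EqOn Q P {z | 0 < z.im} := fun z hz => if_pos (le_of_lt hz)
  have hQM : EqOn Q (fun z => M z + (P 0 - M 0)) {z | z.im < 0} := fun z hz => if_neg (not_le.2 hz)
  have hQd : ∀ z ∈ ball (0 : ℂ) R ∩ {z | 0 < z.im}, HasDerivAt Q (g z) z := fun z hz =>
    (hPd z hz).congr_of_eventuallyEq ((hQP.mono inter_subset_right).eventuallyEq_of_mem
      ((isOpen_ball_inter_im_pos R).mem_nhds hz))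
  have hQd' : ∀ z ∈ ball (0 : ℂ) R ∩ {z | z.im < 0}, HasDerivAt Q (k z) z := fun z hz =>
    ((hMd z hz).add_const _).congr_of_eventuallyEq ((hQM.mono inter_subset_right).eventuallyEq_of_mem
      ((isOpen_ball_inter_im_neg R).mem_nhds hz))
  have hQc : ContinuousOn Q (ball 0 R) := by
    refine ContinuousOn.if ?_ hP.continuousOn (hM.add_const _).continuousOn
    rintro z ⟨hz, hzf⟩
    have hzi : z.im = 0 := by
      have := frontier_le_subset_eq continuous_const Complex.continuous_im hzf
      exact this.symm
    have hzx : z = (z.re : ℂ) := Complex.ext (by simp) (by simp [hzi])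
    have h1 : |z.re| < R := (Complex.abs_re_le_norm z).trans_lt (mem_ball_zero_iff.1 hz)
    have := sub_eq_of_jump_tendsto_zero hP hM hPd hMd hjump h1
    rw [hzx]
    linear_combination this
  have hQD : DifferentiableOn ℂ Q (ball 0 R) := by
    refine differentiableOn_ball_of_off_real hQc fun z hz hzi => ?_
    rcases lt_or_gt_of_ne hzi with h | h
    · exact (hQd' z ⟨hz, h⟩).differentiableAt
    · exact (hQd z ⟨hz, h⟩).differentiableAt
  exact ⟨deriv Q, hQD.deriv isOpen_ball, fun z hz => (hQd z hz).deriv⟩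

/-- **Schwarz reflection** for a function whose modulus tends to one at the diameter. -/
theorem exists_reflection {R : ℝ} {g : ℂ → ℂ}
    (hg : DifferentiableOn ℂ g (ball (0 : ℂ) R ∩ {z | 0 < z.im}))
    (hg2 : ∀ z ∈ ball (0 : ℂ) R ∩ {z | 0 < z.im}, 1 / 2 ≤ ‖g z‖)
    (hg1 : ∀ z ∈ ball (0 : ℂ) R ∩ {z | 0 < z.im}, ‖g z‖ ≤ 1)
    (hbd : ∀ ε > 0, ∃ η > 0, ∀ z ∈ ball (0 : ℂ) R ∩ {z | 0 < z.im}, z.im < η → 1 - ε ≤ ‖g z‖) :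
    ∃ g₁ : ℂ → ℂ, DifferentiableOn ℂ g₁ (ball 0 R) ∧
      EqOn g₁ g (ball (0 : ℂ) R ∩ {z | 0 < z.im}) := by
  have hconj : ∀ z ∈ ball (0 : ℂ) R ∩ {z | z.im < 0}, conj z ∈ ball (0 : ℂ) R ∩ {z | 0 < z.im} :=
    fun z hz => ⟨by simpa using hz.1, by simpa using hz.2⟩
  refine exists_differentiableOn_of_jump_tendsto_zero (C := 2) (k := fun z => (conj (g (conj z)))⁻¹)
    hg (fun z hz => ?_) (fun z hz => ?_) (fun z hz => ?_) fun ε hε => ?_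
  · have h1 := hg.differentiableAt ((isOpen_ball_inter_im_pos R).mem_nhds (hconj z hz))
    have h2 := h1.conj_conj
    rw [Complex.conj_conj] at h2
    refine (DifferentiableAt.fun_inv h2 ?_).differentiableWithinAt
    have := hg2 _ (hconj z hz)
    simp only [Function.comp, ne_eq, map_eq_zero]
    rw [← norm_eq_zero]
    linarith
  · rw [← NNReal.coe_le_coe]
    exact (hg1 z hz).trans (by norm_num)
  · rw [← NNReal.coe_le_coe, coe_nnnorm, norm_inv, Complex.norm_conj]
    have := hg2 _ (hconj z hz)
    exact (inv_anti₀ (by norm_num) this).trans (by norm_num)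
  · obtain ⟨η, hη, h⟩ := hbd (ε / 4) (by positivity)
    refine ⟨η, hη, fun z hz hzη => ?_⟩
    have h1 := h z hz hzη
    have h2 := hg2 z hz
    have h3 := hg1 z hz
    rw [Complex.conj_conj]
    have hne : conj (g z) ≠ 0 := by
      rw [← norm_pos_iff, Complex.norm_conj]; linarith
    -- The jump is `(‖g‖ ^ 2 - 1) / conj g`. It is small because `‖g‖` is near `1` and at least `1 /
    -- 2`.
    have h4 : g z - (conj (g z))⁻¹ = ((‖g z‖ ^ 2 - 1 : ℝ) : ℂ) * (conj (g z))⁻¹ := by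
      have : g z * conj (g z) = ((‖g z‖ ^ 2 : ℝ) : ℂ) := by
        rw [Complex.mul_conj, Complex.normSq_eq_norm_sq]
      push_cast at this ⊢
      rw [← this]
      field_simp
    rw [h4, norm_mul, Complex.norm_real, Real.norm_eq_abs, norm_inv, Complex.norm_conj,
      abs_of_nonpos (by nlinarith), ← div_eq_mul_inv, div_le_iff₀ (by linarith)]
    nlinarith

end Reflection

/-! ### Straightening a real-analytic boundary -/

/-- A real-analytic curve extends to a holomorphic function of a complex parameter. -/
theorem exists_analyticAt_extension {σ : ℝ → ℂ} (hσ : AnalyticAt ℝ σ 0) :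
    ∃ γ : ℂ → ℂ, AnalyticAt ℂ γ 0 ∧ ∀ᶠ t : ℝ in 𝓝 0, γ t = σ t := by
  obtain ⟨p, hp⟩ := hσ
  rw [hasFPowerSeriesAt_iff] at hp
  set a : ℕ → ℂ := p.coeff
  obtain ⟨r, hr, hb⟩ := Metric.eventually_nhds_iff_ball.1 hp
  set q := FormalMultilinearSeries.ofScalars (𝕜 := ℂ) ℂ a with hq
  have hrad : 0 < q.radius := by
    set t : NNReal := ⟨r / 2, by positivity⟩ with ht
    -- Convergence at the single real point `r / 2` bounds the terms there, so the complex power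
    -- series with the same coefficients has positive radius.
    have hs := (hb (r / 2) (by
      rw [mem_ball_zero_iff, Real.norm_of_nonneg (by positivity)]; linarith)).summable
    have hcob := hs.tendsto_atTop_zero.norm
    obtain ⟨C, hC⟩ := hcob.bddAbove_range
    have : (t : ENNReal) ≤ q.radius := by
      refine FormalMultilinearSeries.le_radius_of_bound _ C fun n => ?_
      have h1 := hC (mem_range_self n)
      simp only [norm_smul, norm_pow, Real.norm_of_nonneg (show 0 ≤ r / 2 by positivity)] at h1
      rw [hq, FormalMultilinearSeries.ofScalars_norm, mul_comm]
      exact h1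
    refine lt_of_lt_of_le ?_ this
    rw [ENNReal.coe_pos, ← NNReal.coe_pos]
    exact half_pos hr
  have hfps := q.hasFPowerSeriesOnBall hrad
  refine ⟨q.sum, hfps.analyticAt, ?_⟩
  have h2 := (hasFPowerSeriesAt_iff.1 hfps.hasFPowerSeriesAt)
  have h3 := (Complex.continuous_ofReal.tendsto 0).eventually h2
  filter_upwards [h3, hp] with t ht1 ht2
  simp only [zero_add] at ht1 ht2
  refine ht1.unique ?_
  convert ht2 using 2 with n
  rw [hq, FormalMultilinearSeries.coeff_ofScalars, Complex.real_smul, smul_eq_mul]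
  push_cast
  rfl

/-- The real-linear automorphism `v ↦ c v̄` of the plane. -/
noncomputable def conjMulEquiv (c : ℂ) (hc : c ≠ 0) : ℂ ≃L[ℝ] ℂ :=
  Complex.conjCLE.trans ((ContinuousLinearEquiv.unitsEquivAut ℂ (Units.mk0 c hc)).restrictScalars ℝ)

theorem conjMulEquiv_apply (c : ℂ) (hc : c ≠ 0) (v : ℂ) : conjMulEquiv c hc v = conj v * c := rfl

/-- The zero set of a real-analytic function with non-vanishing differential has a regular
real-analytic parametrisation. -/
theorem exists_analytic_curve {ρ : ℂ → ℝ} {p : ℂ} (hρ : AnalyticAt ℝ ρ p) (hd : fderiv ℝ ρ p ≠ 0)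
    (h0 : ρ p = 0) : ∃ σ : ℝ → ℂ, AnalyticAt ℝ σ 0 ∧ σ 0 = p ∧ deriv σ 0 ≠ 0 ∧
      ∀ᶠ t in 𝓝 0, ρ (σ t) = 0 := by
  set D := fderiv ℝ ρ p with hD
  set c : ℂ := ⟨D 1, D Complex.I⟩ with hc
  have hDv : ∀ v : ℂ, D v = (conj c * v).re := fun v => by
    have : v = (v.re : ℝ) • (1 : ℂ) + (v.im : ℝ) • Complex.I := by
      simp [Complex.re_add_im]
    conv_lhs => rw [this]
    rw [map_add, map_smul, map_smul]
    simp [hc]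
    ring
  have hc0 : c ≠ 0 := fun h => hd (by ext v; simp [hDv, h])
  have hIc : Complex.I * c ≠ 0 := mul_ne_zero Complex.I_ne_zero hc0
  -- Local coordinates from a tangential component and `ρ`. With `c` the gradient of `ρ`, the
  -- differential of `Φ` at `p` is `v ↦ I * c * conj v`, which is invertible, and the curve is the
  -- inverse image of the real axis.
  set Φ : ℂ → ℂ := fun z => (((conj c * (z - p)).im : ℝ) : ℂ) + ((ρ z : ℝ) : ℂ) * Complex.I with hΦ
  have hΦp : Φ p = 0 := by simp [hΦ, h0]
  have hlin : AnalyticAt ℝ (fun z : ℂ => conj c * (z - p)) p := by fun_prop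
  have him : AnalyticAt ℝ (fun z : ℂ => (((conj c * (z - p)).im : ℝ) : ℂ)) p :=
    ((Complex.ofRealCLM.comp Complex.imCLM).analyticAt _).comp hlin
  have hρc : AnalyticAt ℝ (fun z : ℂ => ((ρ z : ℝ) : ℂ)) p := (Complex.ofRealCLM.analyticAt _).comp hρ
  have hΦa : AnalyticAt ℝ Φ p := him.add (hρc.mul analyticAt_const)
  set A := conjMulEquiv (Complex.I * c) hIc with hA
  have hfd : fderiv ℝ Φ p = A := by
    have h1 : HasFDerivAt (fun z : ℂ => conj c * (z - p))
        ((ContinuousLinearMap.toSpanSingleton ℂ (conj c)).restrictScalars ℝ) p := by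
      have : HasDerivAt (fun z : ℂ => conj c * (z - p)) (conj c) p := by
        simpa using ((hasDerivAt_id p).sub_const p).const_mul (conj c)
      exact this.hasFDerivAt.restrictScalars ℝ
    have h2 := (Complex.ofRealCLM.comp Complex.imCLM).hasFDerivAt.comp p h1
    have h3 := (Complex.ofRealCLM.hasFDerivAt.comp p hρ.differentiableAt.hasFDerivAt).mul_const
      Complex.I
    have h4 : HasFDerivAt Φ _ p := h2.add h3
    rw [h4.fderiv]
    ext1 v
    rw [ContinuousLinearEquiv.coe_coe, hA, conjMulEquiv_apply]
    simp only [add_apply, ContinuousLinearMap.comp_apply, smul_apply, Complex.ofRealCLM_apply, Complex.imCLM_apply]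
    rw [← hD, hDv]
    apply Complex.ext <;> (simp <;> ring)
  have hstrict : HasStrictFDerivAt Φ (A : ℂ →L[ℝ] ℂ) p := by
    rw [← hfd]; exact hΦa.hasStrictFDerivAt
  set e := hstrict.toOpenPartialHomeomorph Φ with he
  have heΦ : ∀ z, e z = Φ z := fun z => rfl
  have hps : p ∈ e.source := hstrict.mem_toOpenPartialHomeomorph_source
  have hsymm : AnalyticAt ℝ e.symm 0 := by
    have := e.analyticAt_symm' (i := A) hps hΦa hfd
    rwa [heΦ, hΦp] at this
  have h0t : (0 : ℂ) ∈ e.target := by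
    have := e.map_source hps
    rwa [heΦ, hΦp] at this
  have hsymm0 : e.symm 0 = p := by
    have := e.left_inv hps
    rwa [heΦ, hΦp] at this
  have hσa : AnalyticAt ℝ (fun t : ℝ => e.symm (t : ℂ)) 0 := by
    have hof : AnalyticAt ℝ (fun t : ℝ => (t : ℂ)) 0 := Complex.ofRealCLM.analyticAt _
    refine AnalyticAt.comp (g := e.symm) (f := fun t : ℝ => (t : ℂ)) ?_ hof
    simpa using hsymm
  have hright : ∀ᶠ t : ℝ in 𝓝 0, Φ (e.symm (t : ℂ)) = t := by
    have h1 : ∀ᶠ w : ℂ in 𝓝 ((0 : ℝ) : ℂ), w ∈ e.target := by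
      rw [Complex.ofReal_zero]
      exact e.open_target.mem_nhds h0t
    filter_upwards [(Complex.continuous_ofReal.tendsto 0).eventually h1] with t ht
    exact e.right_inv ht
  refine ⟨fun t => e.symm (t : ℂ), hσa, by simpa using hsymm0, fun hz => ?_, ?_⟩
  · have h1 := hσa.differentiableAt.hasDerivAt
    rw [hz] at h1
    have h2 : HasFDerivAt Φ (A : ℂ →L[ℝ] ℂ) (e.symm ((0 : ℝ) : ℂ)) := by
      rw [Complex.ofReal_zero, hsymm0]; exact hstrict.hasFDerivAt
    have h3 := h2.comp_hasDerivAt (0 : ℝ) h1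
    rw [map_zero] at h3
    have h4 : HasDerivAt (fun t : ℝ => (t : ℂ)) 1 0 := Complex.ofRealCLM.hasDerivAt
    have h5 := h3.unique (h4.congr_of_eventuallyEq hright)
    exact zero_ne_one h5
  · filter_upwards [hright] with t ht
    have := congrArg Complex.im ht
    simpa [hΦ] using this

/-- Let `γ` complexify the boundary curve. Then `ρ ∘ γ` vanishes on the real axis and its
differential at `0` is `v ↦ l * v.im` with `l ≠ 0`. Strict differentiability, comparing `ζ` with its
real part, shows that the sign of `ρ (γ ζ)` is that of `ζ.im * l`. If `l > 0`, `ζ` is replaced by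
`-ζ`. -/
theorem exists_boundary_chart_of_lt {ρ : ℂ → ℝ} {p : ℂ} (hρ : AnalyticAt ℝ ρ p)
    (hd : fderiv ℝ ρ p ≠ 0) (h0 : ρ p = 0) :
    ∃ γ : ℂ → ℂ, AnalyticAt ℂ γ 0 ∧ γ 0 = p ∧ deriv γ 0 ≠ 0 ∧
      ∀ᶠ ζ in 𝓝 0, (ρ (γ ζ) < 0 ↔ 0 < ζ.im) := by
  obtain ⟨σ, hσ, hσ0, hσd, hσρ⟩ := exists_analytic_curve hρ hd h0
  obtain ⟨γ, hγ, hγσ⟩ := exists_analyticAt_extension hσ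
  have hγ0 : γ 0 = p := by
    have := hγσ.self_of_nhds
    rwa [Complex.ofReal_zero, hσ0] at this
  have hγr : HasDerivAt (fun t : ℝ => γ t) (deriv γ 0) 0 := by
    refine HasDerivAt.comp_ofReal ?_
    rw [Complex.ofReal_zero]
    exact hγ.differentiableAt.hasDerivAt
  have hγd : deriv γ 0 ≠ 0 := by
    have := (hγr.congr_of_eventuallyEq (f₁ := σ) (hγσ.mono fun t ht => ht.symm)).deriv
    rwa [this] at hσd
  have hγs : HasStrictFDerivAt γ
      ((ContinuousLinearMap.toSpanSingleton ℂ (deriv γ 0)).restrictScalars ℝ) 0 :=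
    hγ.hasStrictDerivAt.hasStrictFDerivAt.restrictScalars ℝ
  have hρs : HasStrictFDerivAt ρ (fderiv ℝ ρ p) (γ 0) := by rw [hγ0]; exact hρ.hasStrictFDerivAt
  have hu := hρs.comp 0 hγs
  set L := (fderiv ℝ ρ p).comp
    ((ContinuousLinearMap.toSpanSingleton ℂ (deriv γ 0)).restrictScalars ℝ) with hL
  have hLv : ∀ v : ℂ, L v = fderiv ℝ ρ p (v * deriv γ 0) := fun v => by simp [hL]
  have hureal : ∀ᶠ t : ℝ in 𝓝 0, ρ (γ t) = 0 := by
    filter_upwards [hγσ, hσρ] with t h1 h2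
    rw [h1, h2]
  have hL1 : L 1 = 0 := by
    have h1 : HasDerivAt (fun t : ℝ => ρ (γ t)) (fderiv ℝ ρ p (deriv γ 0)) 0 := by
      have h2 : HasFDerivAt ρ (fderiv ℝ ρ p) (γ ((0 : ℝ) : ℂ)) := by
        rw [Complex.ofReal_zero]; exact hρs.hasFDerivAt
      exact h2.comp_hasDerivAt (0 : ℝ) hγr
    have h3 := h1.unique ((hasDerivAt_const (0 : ℝ) (0 : ℝ)).congr_of_eventuallyEq hureal)
    rw [hLv, one_mul, h3]
  set l := L Complex.I with hl
  have hLv2 : ∀ v : ℂ, L v = v.im * l := fun v => by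
    have : v = (v.re : ℝ) • (1 : ℂ) + (v.im : ℝ) • Complex.I := by simp [Complex.re_add_im]
    conv_lhs => rw [this]
    rw [map_add, map_smul, map_smul, hL1, smul_zero, zero_add, smul_eq_mul]
  have hl0 : l ≠ 0 := by
    intro h
    refine hd (ContinuousLinearMap.ext fun v => ?_)
    have h1 := hLv2 (v / deriv γ 0)
    rw [hLv, div_mul_cancel₀ _ hγd, h, mul_zero] at h1
    simpa using h1
  have hsign : ∀ᶠ ζ in 𝓝 (0 : ℂ), (ρ (γ ζ) < 0 ↔ ζ.im * l < 0) := by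
    have hlo := hu.isLittleO.def (c := |l| / 2) (by positivity)
    have hpair : Filter.Tendsto (fun ζ : ℂ => (ζ, (ζ.re : ℂ))) (𝓝 0) (𝓝 ((0 : ℂ), (0 : ℂ))) := by
      have : Continuous fun ζ : ℂ => (ζ, (ζ.re : ℂ)) := by fun_prop
      simpa using this.tendsto 0
    have hre : Filter.Tendsto Complex.re (𝓝 0) (𝓝 0) := by
      simpa using Complex.continuous_re.tendsto 0
    filter_upwards [hpair.eventually hlo, hre.eventually hureal] with ζ h1 h2
    have h3 : ζ - (ζ.re : ℂ) = ζ.im * Complex.I := by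
      apply Complex.ext <;> simp
    simp only [h2, sub_zero] at h1
    rw [h3, hLv2, norm_mul, Complex.norm_I, mul_one, Complex.norm_real, Real.norm_eq_abs,
      Real.norm_eq_abs] at h1
    simp only [Complex.mul_im, Complex.ofReal_re, Complex.I_im, mul_one, Complex.ofReal_im,
      Complex.I_re, mul_zero, add_zero] at h1
    have h4 : |l| / 2 * |ζ.im| = |ζ.im * l| / 2 := by rw [abs_mul]; ring
    rw [h4] at h1
    rw [abs_le] at h1
    constructor
    · intro h
      by_contra hn
      rw [not_lt] at hn
      rw [abs_of_nonneg hn] at h1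
      linarith [h1.1]
    · intro h
      rw [abs_of_neg h] at h1
      linarith [h1.2]
  rcases lt_or_gt_of_ne hl0 with h | h
  · refine ⟨γ, hγ, hγ0, hγd, hsign.mono fun ζ hζ => hζ.trans ?_⟩
    constructor <;> intro h2 <;> nlinarith
  · have hneg : Filter.Tendsto (fun ζ : ℂ => -ζ) (𝓝 0) (𝓝 0) := by
      simpa using (continuous_neg (G := ℂ)).tendsto 0
    refine ⟨fun ζ => γ (-ζ), AnalyticAt.comp (g := γ) (f := fun ζ : ℂ => -ζ) (by simpa using hγ)
      (by fun_prop), by simpa using hγ0, ?_, (hneg.eventually hsign).mono fun ζ hζ => hζ.trans ?_⟩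
    · rw [deriv_comp_neg]; simpa using hγd
    · rw [Complex.neg_im]
      constructor <;> intro h2 <;> nlinarith

theorem HasRealAnalyticBoundary.exists_chart {G : Set ℂ} (hG : IsOpen G)
    (hb : HasRealAnalyticBoundary G) {p : ℂ} (hp : p ∈ frontier G) :
    ∃ γ : ℂ → ℂ, AnalyticAt ℂ γ 0 ∧ γ 0 = p ∧ deriv γ 0 ≠ 0 ∧
      ∀ᶠ ζ in 𝓝 0, (γ ζ ∈ G ↔ 0 < ζ.im) := by
  obtain ⟨ρ, hρ, hd, hev⟩ := hb p hp
  have h0 : ρ p = 0 := by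
    refine le_antisymm ?_ (not_lt.1 fun h => ?_)
    · have hfr : ∃ᶠ z in 𝓝 p, z ∈ G := mem_closure_iff_frequently.1 hp.1
      by_contra h
      rw [not_le] at h
      obtain ⟨z, hz, hz2, hz3⟩ := (hfr.and_eventually (hev.and
        (hρ.continuousAt.eventually_const_lt h))).exists
      exact lt_asymm (hz2.1 hz) hz3
    · have := hev.self_of_nhds.2 h
      exact hp.2 (by rwa [hG.interior_eq])
  obtain ⟨γ, hγ, hγ0, hγd, hs⟩ := exists_boundary_chart_of_lt hρ hd h0
  refine ⟨γ, hγ, hγ0, hγd, ?_⟩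
  have : ∀ᶠ ζ in 𝓝 0, (γ ζ ∈ G ↔ ρ (γ ζ) < 0) := by
    have h1 := hγ.continuousAt.tendsto
    rw [hγ0] at h1
    exact h1.eventually hev
  filter_upwards [this, hs] with ζ h1 h2
  rw [h1, h2]

/-! ### Extension of the Riemann map across the boundary -/

/-- The sublevel sets of the modulus of a Riemann map are compact. -/
theorem IsRiemannMap.isCompact_sublevel {G : Set ℂ} {a : ℂ} {f : ℂ → ℂ} (hG : IsOpen G)
    (hf : IsRiemannMap G a f) {s : ℝ} (hs : s < 1) : IsCompact {z ∈ G | ‖f z‖ ≤ s} := by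
  have hF : ∀ w ∈ ball (0 : ℂ) 1, Function.invFunOn f G w ∈ G ∧ f (Function.invFunOn f G w) = w :=
    fun w hw => ⟨Function.invFunOn_mem (hf.bijOn.surjOn hw), Function.invFunOn_eq (hf.bijOn.surjOn hw)⟩
  have hd := differentiableOn_inverse_of_bijOn hG hf.holomorphic hf.bijOn hF
  have hsub : closedBall (0 : ℂ) s ⊆ ball 0 1 := closedBall_subset_ball hs
  have : {z ∈ G | ‖f z‖ ≤ s} = Function.invFunOn f G '' closedBall 0 s := by
    ext z
    constructor
    · rintro ⟨hz, hzs⟩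
      exact ⟨f z, by simpa using hzs, left_inverse_of_bijOn hf.bijOn hF z hz⟩
    · rintro ⟨w, hw, rfl⟩
      have := hF w (hsub hw)
      exact ⟨this.1, by rw [this.2]; simpa using hw⟩
  rw [this]
  exact (isCompact_closedBall 0 s).image_of_continuousOn (hd.continuousOn.mono hsub)

/-- The modulus of a Riemann map tends to `1` along an analytic boundary chart. -/
theorem IsRiemannMap.exists_im_lt_imp {G : Set ℂ} {a : ℂ} {f γ : ℂ → ℂ} (hG : IsOpen G)
    (hf : IsRiemannMap G a f) {R : ℝ} (hγ : ContinuousOn γ (closedBall 0 R))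
    (hGγ : ∀ ζ ∈ closedBall (0 : ℂ) R, (γ ζ ∈ G ↔ 0 < ζ.im)) {ε : ℝ} (hε : 0 < ε) :
    ∃ η > 0, ∀ z ∈ closedBall (0 : ℂ) R ∩ {z | 0 < z.im}, z.im < η → 1 - ε ≤ ‖f (γ z)‖ := by
  have hK := hf.isCompact_sublevel hG (s := 1 - ε) (by linarith)
  -- On this compact set `ζ.im` is positive, so when it is nonempty its minimum there serves as `η`.
  set L := closedBall (0 : ℂ) R ∩ γ ⁻¹' {z ∈ G | ‖f z‖ ≤ 1 - ε} with hL
  have hLc : IsCompact L := (isCompact_closedBall 0 R).of_isClosed_subset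
    (hγ.preimage_isClosed_of_isClosed isClosed_closedBall hK.isClosed) inter_subset_left
  rcases L.eq_empty_or_nonempty with h | h
  · refine ⟨1, one_pos, fun z hz _ => ?_⟩
    by_contra hn
    rw [not_le] at hn
    have : z ∈ L := ⟨hz.1, (hGγ z hz.1).2 hz.2, hn.le⟩
    rw [h] at this
    exact this
  · obtain ⟨z₀, hz₀, hmin⟩ := hLc.exists_isMinOn h Complex.continuous_im.continuousOn
    refine ⟨z₀.im, (hGγ z₀ hz₀.1).1 hz₀.2.1, fun z hz hzi => ?_⟩
    by_contra hn
    rw [not_le] at hn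
    have : z ∈ L := ⟨hz.1, (hGγ z hz.1).2 hz.2, hn.le⟩
    exact absurd (hmin this) (not_le.2 hzi)

/-- A Riemann map extends holomorphically across each point of a real-analytic boundary. -/
theorem IsRiemannMap.exists_local_extension {G : Set ℂ} {a : ℂ} {f : ℂ → ℂ} (hG : IsOpen G)
    (hb : HasRealAnalyticBoundary G) (hf : IsRiemannMap G a f) {p : ℂ} (hp : p ∈ frontier G) :
    ∃ r > 0, ∃ g : ℂ → ℂ, DifferentiableOn ℂ g (ball p r) ∧ EqOn g f (ball p r ∩ G) := by
  obtain ⟨γ, hγ, hγ0, hγd, hGγ⟩ := hb.exists_chart hG hp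
  obtain ⟨R, hR, hRb⟩ := nhds_basis_closedBall.eventually_iff.1
    (hGγ.and hγ.eventually_analyticAt)
  have hγc : ContinuousOn γ (closedBall 0 R) := fun ζ hζ =>
    (hRb hζ).2.continuousAt.continuousWithinAt
  have hGR : ∀ ζ ∈ closedBall (0 : ℂ) R, (γ ζ ∈ G ↔ 0 < ζ.im) := fun ζ hζ => (hRb hζ).1
  obtain ⟨η, hη, hη2⟩ := hf.exists_im_lt_imp hG hγc hGR (ε := 1 / 2) (by norm_num)
  -- Below height `η` the modulus of `f ∘ γ` is at least `1 / 2`, so on this smaller half disc the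
  -- reflected function is bounded.
  set R' := min R η with hR'
  have hR'0 : 0 < R' := lt_min hR hη
  have hsub : ball (0 : ℂ) R' ⊆ closedBall 0 R :=
    ball_subset_closedBall.trans (closedBall_subset_closedBall (min_le_left _ _))
  obtain ⟨g₁, hg₁, hg₁e⟩ := exists_reflection (R := R') (g := f ∘ γ) (by
      intro ζ hζ
      refine DifferentiableAt.differentiableWithinAt ?_
      refine DifferentiableAt.comp ζ ?_ (hRb (hsub hζ.1)).2.differentiableAt
      exact hf.holomorphic.differentiableAt (hG.mem_nhds ((hGR ζ (hsub hζ.1)).2 hζ.2)))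
    (by
      intro ζ hζ
      have : ζ.im < η := by
        have h1 : ‖ζ‖ < R' := by simpa using hζ.1
        exact lt_of_le_of_lt ((le_abs_self _).trans (Complex.abs_im_le_norm ζ))
          (h1.trans_le (min_le_right _ _))
      have := hη2 ζ ⟨hsub hζ.1, hζ.2⟩ this
      norm_num at this ⊢
      exact this)
    (by
      intro ζ hζ
      have := hf.bijOn.mapsTo ((hGR ζ (hsub hζ.1)).2 hζ.2)
      exact (mem_ball_zero_iff.1 this).le)
    (by
      intro ε hε
      obtain ⟨η', h, h2⟩ := hf.exists_im_lt_imp hG hγc hGR hε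
      exact ⟨η', h, fun z hz => h2 z ⟨hsub hz.1, hz.2⟩⟩)
  have hstrict := hγ.hasStrictDerivAt.hasStrictFDerivAt_equiv hγd
  set e := hstrict.toOpenPartialHomeomorph γ with he
  have h0s : (0 : ℂ) ∈ e.source := hstrict.mem_toOpenPartialHomeomorph_source
  have hpt : p ∈ e.target := by
    have := e.map_source h0s
    rwa [show e 0 = γ 0 from rfl, hγ0] at this
  have hsp : e.symm p = 0 := by
    have := e.left_inv h0s
    rwa [show e 0 = γ 0 from rfl, hγ0] at this
  have hsa : AnalyticAt ℂ e.symm p := by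
    have := e.analyticAt_symm' h0s hγ hstrict.hasFDerivAt.fderiv
    rwa [show e 0 = γ 0 from rfl, hγ0] at this
  have h1 : ∀ᶠ z in 𝓝 p, e.symm z ∈ ball (0 : ℂ) R' :=
    hsa.continuousAt.eventually (by rw [hsp]; exact ball_mem_nhds 0 hR'0)
  obtain ⟨r, hr, hrb⟩ := nhds_basis_ball.eventually_iff.1
    ((e.open_target.eventually_mem hpt).and (h1.and hsa.eventually_analyticAt))
  refine ⟨r, hr, g₁ ∘ e.symm, fun z hz => ?_, fun z hz => ?_⟩
  · obtain ⟨-, h3, h4⟩ := hrb hz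
    exact ((hg₁.differentiableAt (isOpen_ball.mem_nhds h3)).comp z
      h4.differentiableAt).differentiableWithinAt
  · obtain ⟨h2, h3, -⟩ := hrb hz.1
    have h5 : γ (e.symm z) = z := e.right_inv h2
    have h6 : 0 < (e.symm z).im := (hGR _ (hsub h3)).1 (by rw [h5]; exact hz.2)
    rw [Function.comp_apply, hg₁e ⟨h3, h6⟩, Function.comp_apply, h5]

/-- Local holomorphic extensions across the boundary points of an open set patch together. -/
theorem exists_differentiableOn_extension {G : Set ℂ} {f : ℂ → ℂ} (hG : IsOpen G)
    (hf : DifferentiableOn ℂ f G)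
    (hloc : ∀ p ∈ frontier G, ∃ r > 0, ∃ g : ℂ → ℂ,
      DifferentiableOn ℂ g (ball p r) ∧ EqOn g f (ball p r ∩ G)) :
    ∃ U : Set ℂ, ∃ f₁ : ℂ → ℂ, IsOpen U ∧ closure G ⊆ U ∧ DifferentiableOn ℂ f₁ U ∧
      EqOn f₁ f G := by
  classical
  choose! r hr g hg hgf using hloc
  have hr3 : ∀ p ∈ frontier G, ball p (r p / 3) ⊆ ball p (r p) := fun p hp =>
    ball_subset_ball (by linarith [hr p hp])
  -- If the balls of one third radius meet, the centre `q` of the smaller lies in the full ball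
  -- about `p`. The convex intersection of the full balls then contains a frontier point, hence
  -- points of `G`, and the identity theorem applies.
  have aux : ∀ p ∈ frontier G, ∀ q ∈ frontier G, r q ≤ r p → ∀ z ∈ ball p (r p / 3),
      z ∈ ball q (r q / 3) → g p z = g q z := by
    intro p hp q hq hle z hzp hzq
    have hV : IsOpen (ball p (r p) ∩ ball q (r q)) := isOpen_ball.inter isOpen_ball
    have hqV : q ∈ ball p (r p) ∩ ball q (r q) := by
      refine ⟨?_, mem_ball_self (hr q hq)⟩
      have := dist_triangle_left q p z
      rw [mem_ball] at *
      linarith [hr p hp]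
    have hfr : ∃ᶠ x in 𝓝 q, x ∈ G := mem_closure_iff_frequently.1 hq.1
    obtain ⟨x, hxG, hxV⟩ := (hfr.and_eventually (hV.mem_nhds hqV)).exists
    refine AnalyticOnNhd.eqOn_of_preconnected_of_eventuallyEq
      (((hg p hp).mono inter_subset_left).analyticOnNhd hV)
      (((hg q hq).mono inter_subset_right).analyticOnNhd hV)
      (((convex_ball p _).inter (convex_ball q _)).isPreconnected) hxV ?_
      ⟨hr3 p hp hzp, hr3 q hq hzq⟩
    filter_upwards [(hV.inter hG).mem_nhds ⟨hxV, hxG⟩] with y hy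
    rw [hgf p hp ⟨hy.1.1, hy.2⟩, hgf q hq ⟨hy.1.2, hy.2⟩]
  have aux2 : ∀ p ∈ frontier G, ∀ q ∈ frontier G, ∀ z ∈ ball p (r p / 3),
      z ∈ ball q (r q / 3) → g p z = g q z := by
    intro p hp q hq z hzp hzq
    rcases le_total (r q) (r p) with h | h
    · exact aux p hp q hq h z hzp hzq
    · exact (aux q hq p hp h z hzq hzp).symm
  set f₁ : ℂ → ℂ := fun z => if h : ∃ p ∈ frontier G, z ∈ ball p (r p / 3) then g h.choose z else f z
    with hf₁
  have h1 : ∀ p ∈ frontier G, EqOn f₁ (g p) (ball p (r p / 3)) := by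
    intro p hp z hz
    have h : ∃ p ∈ frontier G, z ∈ ball p (r p / 3) := ⟨p, hp, hz⟩
    simp only [hf₁, dif_pos h]
    exact aux2 _ h.choose_spec.1 p hp z h.choose_spec.2 hz
  have h2 : EqOn f₁ f G := by
    intro z hz
    by_cases h : ∃ p ∈ frontier G, z ∈ ball p (r p / 3)
    · obtain ⟨p, hp, hzp⟩ := h
      rw [h1 p hp hzp, hgf p hp ⟨hr3 p hp hzp, hz⟩]
    · simp only [hf₁, dif_neg h]
  refine ⟨G ∪ ⋃ p ∈ frontier G, ball p (r p / 3), f₁,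
    hG.union (isOpen_biUnion fun p _ => isOpen_ball), fun z hz => ?_, ?_, h2⟩
  · by_cases hzG : z ∈ G
    · exact Or.inl hzG
    · have hzf : z ∈ frontier G := ⟨hz, by rwa [hG.interior_eq]⟩
      exact Or.inr (mem_biUnion hzf (mem_ball_self (by linarith [hr z hzf])))
  · rintro z (hz | hz)
    · exact ((hf.congr h2).differentiableAt (hG.mem_nhds hz)).differentiableWithinAt
    · simp only [mem_iUnion] at hz
      obtain ⟨p, hp, hzp⟩ := hz
      exact ((((hg p hp).mono (hr3 p hp)).congr (h1 p hp)).differentiableAt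
        (isOpen_ball.mem_nhds hzp)).differentiableWithinAt

/-- A Riemann map of a probe domain extends to a connected neighbourhood of the closure, where
the extension is bounded by any prescribed number `r > 1` and has bounded derivative. -/
theorem IsRiemannMap.exists_extension {Ω G : Set ℂ} {a b : ℂ} {f : ℂ → ℂ} (hΩ : IsOpen Ω)
    (hG : IsProbeDomain Ω G a b) (hf : IsRiemannMap G a f) {r : ℝ} (hr : 1 < r) :
    ∃ U : Set ℂ, ∃ f₁ : ℂ → ℂ, ∃ M : ℝ, IsOpen U ∧ IsConnected U ∧ closure G ⊆ U ∧ U ⊆ Ω ∧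
      DifferentiableOn ℂ f₁ U ∧ EqOn f₁ f G ∧ ∀ z ∈ U, ‖f₁ z‖ < r ∧ ‖deriv f₁ z‖ ≤ M := by
  obtain ⟨U₀, f₁, hU₀, hGU₀, hf₁, hf₁f⟩ := exists_differentiableOn_extension hG.isOpen hf.holomorphic
    fun p hp => hf.exists_local_extension hG.isOpen hG.analyticBoundary hp
  have hd : ContinuousOn (deriv f₁) U₀ := (hf₁.deriv hU₀).continuousOn
  obtain ⟨M, hM⟩ := hG.isCompact_closure.exists_bound_of_continuousOn (hd.mono hGU₀)
  have hle : ∀ z ∈ closure G, ‖f₁ z‖ ≤ 1 := by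
    refine fun z hz => le_on_closure (f := fun z => ‖f₁ z‖) (g := fun _ => (1 : ℝ)) (s := G) ?_
      (hf₁.continuousOn.mono hGU₀).norm continuousOn_const hz
    intro x hx
    rw [hf₁f hx]
    exact (mem_ball_zero_iff.1 (hf.bijOn.mapsTo hx)).le
  set U₁ := (U₀ ∩ Ω) ∩ (fun z => (‖f₁ z‖, ‖deriv f₁ z‖)) ⁻¹' (Iio r ×ˢ Iio (M + 1)) with hU₁
  have hU₁o : IsOpen U₁ := by
    refine ContinuousOn.isOpen_inter_preimage ?_ (hU₀.inter hΩ) (isOpen_Iio.prod isOpen_Iio)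
    exact (hf₁.continuousOn.norm.prodMk hd.norm).mono inter_subset_left
  have hGU₁ : closure G ⊆ U₁ := fun z hz => ⟨⟨hGU₀ hz, hG.closure_subset hz⟩,
    (hle z hz).trans_lt hr, (hM z hz).trans_lt (lt_add_one M)⟩
  have ha : a ∈ closure G := subset_closure hG.left_mem
  -- Passing to the component of `a` keeps the closure of the connected set `G` and provides the
  -- connectedness used in the identity theorem.
  have hsub := connectedComponentIn_subset U₁ a
  have hconn : IsPreconnected G := hG.simplyConnected.isPathConnected.isConnected.isPreconnected
  refine ⟨connectedComponentIn U₁ a, f₁, M + 1, hU₁o.connectedComponentIn,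
    isConnected_connectedComponentIn_iff.2 (hGU₁ ha),
    hconn.closure.subset_connectedComponentIn ha hGU₁, fun z hz => (hsub hz).1.2,
    hf₁.mono fun z hz => (hsub hz).1.1, hf₁f, fun z hz => ?_⟩
  exact ⟨(hsub hz).2.1, (hsub hz).2.2.le⟩

/-! ### Kernel derivatives through the Riemann map -/

theorem exists_isBergmanKernel_transportedKernel {G : Set ℂ} {a : ℂ} {f : ℂ → ℂ} (hG : IsOpen G)
    (hf : IsRiemannMap G a f) : IsBergmanKernel G (transportedKernel f) :=
  isBergmanKernel_transportedKernel hG hf.holomorphic hf.bijOn (F := Function.invFunOn f G)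
    fun _ hw => ⟨Function.invFunOn_mem (hf.bijOn.surjOn hw),
      Function.invFunOn_eq (hf.bijOn.surjOn hw)⟩

theorem IsRiemannMap.bergmanKernel_eq {G : Set ℂ} {a : ℂ} {f : ℂ → ℂ} (hG : IsOpen G)
    (hf : IsRiemannMap G a f) {z w : ℂ} (hz : z ∈ G) (hw : w ∈ G) :
    bergmanKernel G z w = conj (deriv f w) * deriv f z * diskKernel (f z) (f w) := by
  rw [(exists_isBergmanKernel_transportedKernel hG hf).bergmanKernel_eq hz hw, transportedKernel,
    formPullback]
  ring

theorem IsRiemannMap.deriv_mul_diskKernel {G : Set ℂ} {a : ℂ} {f F : ℂ → ℂ} (hG : IsOpen G)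
    (hf : IsRiemannMap G a f) (hF : ∀ w ∈ ball (0 : ℂ) 1, F w ∈ G ∧ f (F w) = w) {z w : ℂ}
    (hz : z ∈ G) (hw : w ∈ ball (0 : ℂ) 1) :
    deriv f z * diskKernel (f z) w = bergmanKernel G z (F w) * conj (deriv F w) := by
  have h := deriv_inverse_mul_deriv hG hf.holomorphic hf.bijOn hF (hF w hw).1
  rw [(hF w hw).2] at h
  have h2 := congrArg conj h
  rw [map_mul, map_one] at h2
  rw [hf.bergmanKernel_eq hG hz (hF w hw).1, (hF w hw).2]
  linear_combination (-deriv f z * diskKernel (f z) w) * h2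

theorem conj_iteratedDeriv_const_mul_invSq (c ζ : ℂ) (m : ℕ) :
    conj (iteratedDeriv m (fun w => conj c * invSq (conj ζ) w) 0)
      = c * kernelDeriv diskKernel 0 m ζ := by
  rw [iteratedDeriv_const_mul_field, iteratedDeriv_invSq_zero, kernelDeriv_diskKernel]
  simp

theorem dbar_iterate_const_mul_diskKernel {k : ℂ → ℂ} {c ζ : ℂ}
    (hk : k =ᶠ[𝓝 0] fun w => c * diskKernel ζ w) (m : ℕ) :
    (dbar^[m] k) 0 = c * kernelDeriv diskKernel 0 m ζ := by
  rw [← conj_iteratedDeriv_const_mul_invSq]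
  refine dbar_iterate_of_eventuallyEq_conj
    (analyticAt_const.mul (analyticAt_invSq (by simp))) (hk.trans (.of_eq ?_)) m
  funext w
  simp [diskKernel_eq_conj]

/-- The holomorphic function of `w` whose conjugate is the Bergman kernel `K(z, w)`. -/
noncomputable def conjKernel (f : ℂ → ℂ) (z w : ℂ) : ℂ :=
  conj (deriv f z) * invSq (conj (f z)) (f w) * deriv f w

theorem IsRiemannMap.bergmanKernel_eq_conj {G : Set ℂ} {a : ℂ} {f : ℂ → ℂ} (hG : IsOpen G)
    (hf : IsRiemannMap G a f) {z w : ℂ} (hz : z ∈ G) (hw : w ∈ G) :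
    bergmanKernel G z w = conj (conjKernel f z w) := by
  rw [hf.bergmanKernel_eq hG hz hw, conjKernel, diskKernel_eq_conj]
  simp
  ring

theorem IsRiemannMap.analyticAt {G : Set ℂ} {a : ℂ} {f : ℂ → ℂ} (hG : IsOpen G)
    (hf : IsRiemannMap G a f) {z : ℂ} (hz : z ∈ G) : AnalyticAt ℂ f z :=
  hf.holomorphic.analyticAt (hG.mem_nhds hz)

theorem IsRiemannMap.analyticAt_conjKernel {G : Set ℂ} {a : ℂ} {f : ℂ → ℂ} (hG : IsOpen G)
    (hf : IsRiemannMap G a f) (z : ℂ) (ha : a ∈ G) : AnalyticAt ℂ (conjKernel f z) a := by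
  have h := hf.analyticAt hG ha
  have h1 : AnalyticAt ℂ (invSq (conj (f z))) (f a) := by
    rw [hf.map_base]; exact analyticAt_invSq (by simp)
  exact (analyticAt_const.mul (h1.comp h)).mul h.deriv

theorem IsRiemannMap.kernelDeriv_eq_conj {G : Set ℂ} {a : ℂ} {f : ℂ → ℂ} (hG : IsOpen G)
    (hf : IsRiemannMap G a f) {z : ℂ} (hz : z ∈ G) (ha : a ∈ G) (n : ℕ) :
    kernelDeriv (bergmanKernel G) a n z = conj (iteratedDeriv n (conjKernel f z) a) := by
  refine dbar_iterate_of_eventuallyEq_conj (hf.analyticAt_conjKernel hG z ha) ?_ n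
  filter_upwards [hG.mem_nhds ha] with w hw
  exact hf.bergmanKernel_eq_conj hG hz hw

theorem IsRiemannMap.dbar_iterate_pullback {G : Set ℂ} {a : ℂ} {f F : ℂ → ℂ} (hG : IsOpen G)
    (hf : IsRiemannMap G a f) (hF : ∀ w ∈ ball (0 : ℂ) 1, F w ∈ G ∧ f (F w) = w) {z : ℂ}
    (hz : z ∈ G) (m : ℕ) :
    (dbar^[m] (fun w => bergmanKernel G z (F w) * conj (deriv F w))) 0
      = deriv f z * kernelDeriv diskKernel 0 m (f z) := by
  refine dbar_iterate_const_mul_diskKernel ?_ m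
  filter_upwards [ball_mem_nhds (0 : ℂ) one_pos] with w hw
  rw [hf.deriv_mul_diskKernel hG hF hz hw]

theorem IsRiemannMap.inverse_zero {G : Set ℂ} {a : ℂ} {f F : ℂ → ℂ} (hf : IsRiemannMap G a f)
    (hF : ∀ w ∈ ball (0 : ℂ) 1, F w ∈ G ∧ f (F w) = w) (ha : a ∈ G) : F 0 = a := by
  rw [← hf.map_base]
  exact left_inverse_of_bijOn hf.bijOn hF a ha

theorem IsRiemannMap.analyticAt_inverse {G : Set ℂ} {a : ℂ} {f F : ℂ → ℂ} (hG : IsOpen G)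
    (hf : IsRiemannMap G a f) (hF : ∀ w ∈ ball (0 : ℂ) 1, F w ∈ G ∧ f (F w) = w) :
    AnalyticAt ℂ F 0 :=
  (differentiableOn_inverse_of_bijOn hG hf.holomorphic hf.bijOn hF).analyticAt
    (ball_mem_nhds 0 one_pos)

/-- Taylor coefficients at `0` of the pull-back of a holomorphic form under `F`. -/
theorem IsRiemannMap.conj_iteratedDeriv_pullback {G : Set ℂ} {a : ℂ} {f F : ℂ → ℂ} (hG : IsOpen G)
    (hf : IsRiemannMap G a f) (hF : ∀ w ∈ ball (0 : ℂ) 1, F w ∈ G ∧ f (F w) = w) (ha : a ∈ G)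
    {g : ℂ → ℂ} (hg : AnalyticAt ℂ g a) (m : ℕ) :
    conj (iteratedDeriv m (fun w => g (F w) * deriv F w) 0)
      = ∑ n ∈ Finset.range (m + 1), pullbackCoeff F a m n * conj (iteratedDeriv n g a) := by
  have h0 := hf.inverse_zero hF ha
  rw [iteratedDeriv_pullback (hf.analyticAt_inverse hG hF) (by rwa [h0]), map_sum, h0]
  exact Finset.sum_congr rfl fun n _ => by rw [map_mul, pullbackCoeff]

/-- The `m`-th `dbar` derivative of the pulled-back kernel at `0` is computed in two ways: from the
disc formula, and by applying the pull-back formula to the holomorphic function conjugate to the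
kernel. -/
theorem IsRiemannMap.deriv_mul_kernelDeriv {G : Set ℂ} {a : ℂ} {f F : ℂ → ℂ} (hG : IsOpen G)
    (hf : IsRiemannMap G a f) (hF : ∀ w ∈ ball (0 : ℂ) 1, F w ∈ G ∧ f (F w) = w) (ha : a ∈ G)
    {z : ℂ} (hz : z ∈ G) (m : ℕ) :
    deriv f z * kernelDeriv diskKernel 0 m (f z)
      = ∑ n ∈ Finset.range (m + 1), pullbackCoeff F a m n * kernelDeriv (bergmanKernel G) a n z := by
  simp only [hf.kernelDeriv_eq_conj hG hz ha]
  rw [← hf.conj_iteratedDeriv_pullback hG hF ha (hf.analyticAt_conjKernel hG z ha),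
    ← hf.dbar_iterate_pullback hG hF hz]
  refine dbar_iterate_of_eventuallyEq_conj ?_ ?_ m
  · have h := hf.analyticAt_inverse hG hF
    refine AnalyticAt.mul (AnalyticAt.comp (g := conjKernel f z) ?_ h) h.deriv
    rw [hf.inverse_zero hF ha]
    exact hf.analyticAt_conjKernel hG z ha
  · filter_upwards [ball_mem_nhds (0 : ℂ) one_pos] with w hw
    rw [hf.bergmanKernel_eq_conj hG hz (hF w hw).1, map_mul]

/-- The coefficients expressing `K_a^n` through the kernel derivatives of the disc. -/
noncomputable def kernelDerivExtension (f f₁ : ℂ → ℂ) (a : ℂ) (n : ℕ) (z : ℂ) : ℂ :=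
  deriv f₁ z * ∑ k ∈ Finset.range (n + 1),
    conj (iteratedDeriv n (fun w => f w ^ k * deriv f w) a / (k.factorial : ℂ)) *
      kernelDeriv diskKernel 0 k (f₁ z)

/-- The converse direction, from the disc to `G`. The result is `f'` times a polynomial in `f`, and
therefore continues holomorphically wherever `f` does. -/
theorem IsRiemannMap.kernelDeriv_eq {G : Set ℂ} {a : ℂ} {f : ℂ → ℂ} (hG : IsOpen G)
    (hf : IsRiemannMap G a f) {z : ℂ} (hz : z ∈ G) (ha : a ∈ G) (n : ℕ) :
    kernelDeriv (bergmanKernel G) a n z = kernelDerivExtension f f a n z := by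
  have h := iteratedDeriv_pullback (g := fun w => conj (deriv f z) * invSq (conj (f z)) w)
    (hf.analyticAt hG ha) (by
      rw [hf.map_base]; exact analyticAt_const.mul (analyticAt_invSq (by simp))) n
  simp only [hf.map_base, sub_zero] at h
  rw [hf.kernelDeriv_eq_conj hG hz ha, kernelDerivExtension]
  refine (congrArg conj h).trans ?_
  rw [map_sum, Finset.mul_sum]
  refine Finset.sum_congr rfl fun k _ => ?_
  rw [map_mul, conj_iteratedDeriv_const_mul_invSq]
  ring

theorem differentiableOn_kernelDerivExtension {U : Set ℂ} (hU : IsOpen U) (f : ℂ → ℂ) {f₁ : ℂ → ℂ}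
    (hf₁ : DifferentiableOn ℂ f₁ U) (a : ℂ) (n : ℕ) :
    DifferentiableOn ℂ (kernelDerivExtension f f₁ a n) U := by
  refine (hf₁.deriv hU).mul (DifferentiableOn.fun_sum fun k _ => ?_)
  simp only [kernelDeriv_diskKernel]
  exact ((hf₁.pow k).const_mul _).const_mul _

/-- The triangular sum over `n ≤ m ≤ N` is exchanged. The sequence `κ` is free because this serves
both for kernel derivatives and for conjugated derivatives of a test function. -/
theorem sum_approxCoeff_mul (f F : ℂ → ℂ) (a b : ℂ) (N : ℕ) (κ : ℕ → ℂ) :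
    ∑ n ∈ Finset.range (N + 1), approxCoeff f F a b N n * κ n
      = conj (deriv f b) * ∑ m ∈ Finset.range (N + 1), conj (f b) ^ m / (m.factorial : ℂ) *
          ∑ n ∈ Finset.range (m + 1), pullbackCoeff F a m n * κ n := by
  simp only [approxCoeff, Finset.mul_sum, Finset.sum_mul]
  rw [Finset.sum_comm' (t' := Finset.range (N + 1)) (s' := fun m => Finset.range (m + 1))]
  · refine Finset.sum_congr rfl fun m _ => Finset.sum_congr rfl fun n _ => by ring
  · intro n m
    simp only [Finset.mem_range, Finset.mem_Icc]
    omega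

/-! ### Approximation of the kernel and the quadrature identity -/

/-- On `G`, the approximation error is the pull-back of the Taylor remainder on the disc. -/
theorem IsRiemannMap.bergmanKernel_sub_eq_formPullback {G : Set ℂ} {a b : ℂ} {f F : ℂ → ℂ}
    (hG : IsOpen G) (hf : IsRiemannMap G a f)
    (hF : ∀ w ∈ ball (0 : ℂ) 1, F w ∈ G ∧ f (F w) = w) (ha : a ∈ G) (hb : b ∈ G) {z : ℂ}
    (hz : z ∈ G) (N : ℕ) :
    bergmanKernel G z b - ∑ n ∈ Finset.range (N + 1),
        approxCoeff f F a b N n * kernelDeriv (bergmanKernel G) a n z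
      = conj (deriv f b) * formPullback f (fun u => diskKernel u (f b) -
          ∑ n ∈ Finset.range (N + 1),
            conj (f b) ^ n / (n.factorial : ℂ) * kernelDeriv diskKernel 0 n u) z := by
  rw [sum_approxCoeff_mul, hf.bergmanKernel_eq hG hz hb, formPullback, sub_mul, mul_sub,
    Finset.sum_mul]
  congr 1
  · ring
  · congr 1
    refine Finset.sum_congr rfl fun m _ => ?_
    rw [← hf.deriv_mul_kernelDeriv hG hF ha hz]
    ring

theorem IsRiemannMap.norm_lt_one {G : Set ℂ} {a : ℂ} {f : ℂ → ℂ} (hf : IsRiemannMap G a f) {z : ℂ}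
    (hz : z ∈ G) : ‖f z‖ < 1 :=
  mem_ball_zero_iff.1 (hf.bijOn.mapsTo hz)

theorem IsRiemannMap.bergmanKernel_sub_eq {G : Set ℂ} {a b : ℂ} {f F : ℂ → ℂ}
    (hG : IsOpen G) (hf : IsRiemannMap G a f)
    (hF : ∀ w ∈ ball (0 : ℂ) 1, F w ∈ G ∧ f (F w) = w) (ha : a ∈ G) (hb : b ∈ G) {z : ℂ}
    (hz : z ∈ G) (N : ℕ) :
    bergmanKernel G z b - ∑ n ∈ Finset.range (N + 1),
        approxCoeff f F a b N n * kernelDeriv (bergmanKernel G) a n z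
      = conj (deriv f b) * deriv f z * taylorRemainder N (f z * conj (f b)) := by
  rw [hf.bergmanKernel_sub_eq_formPullback hG hF ha hb hz, formPullback, diskKernel_sub_taylor _ _ _
    (mul_conj_ne_one (hf.norm_lt_one hz) (by simpa using hf.norm_lt_one hb))]
  ring

/-- The approximate quadrature identity. -/
theorem IsRiemannMap.sub_sum_eq_areaInner {G : Set ℂ} {a b : ℂ} {f F : ℂ → ℂ}
    (hG : IsOpen G) (hf : IsRiemannMap G a f)
    (hF : ∀ w ∈ ball (0 : ℂ) 1, F w ∈ G ∧ f (F w) = w) (ha : a ∈ G) (hb : b ∈ G) (N : ℕ)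
    {h : ℂ → ℂ} (hh : InBergmanSpace G h) :
    h b - ∑ n ∈ Finset.range (N + 1), conj (approxCoeff f F a b N n) * iteratedDeriv n h a
      = areaInner G h (fun z => bergmanKernel G z b - ∑ n ∈ Finset.range (N + 1),
          approxCoeff f F a b N n * kernelDeriv (bergmanKernel G) a n z) := by
  have hH := inBergmanSpace_formPullback_inverse hG hf.holomorphic hf.bijOn hF hh
  -- The pairing is moved to the disc, where it equals the Taylor remainder at `f b` of the
  -- pull-back of `h` under `F`.
  rw [areaInner_congr_right hG.measurableSet h
      fun z hz => hf.bergmanKernel_sub_eq_formPullback hG hF ha hb hz N,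
    areaInner_const_mul_right, areaInner_formPullback_right hG hf.holomorphic hf.bijOn hF,
    areaInner_diskKernel_sub hH (hf.norm_lt_one hb),
    areaInner_diskKernel hH (hf.bijOn.mapsTo hb), Complex.conj_conj, mul_sub]
  congr 1
  · rw [formPullback, left_inverse_of_bijOn hf.bijOn hF b hb]
    linear_combination (-h b) * deriv_inverse_mul_deriv hG hf.holomorphic hf.bijOn hF hb
  · have h1 := sum_approxCoeff_mul f F a b N fun n => conj (iteratedDeriv n h a)
    simp only [← hf.conj_iteratedDeriv_pullback hG hF ha (hh.1.analyticAt (hG.mem_nhds ha))] at h1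
    simpa [show formPullback F h = fun w => h (F w) * deriv F w from rfl] using congrArg conj h1

theorem InBergmanSpace.integral_norm_le {G : Set ℂ} {h : ℂ → ℂ} (hh : InBergmanSpace G h)
    (hG : volume G ≠ ⊤) : ∫ x in G, ‖h x‖ ≤ √(volume.real G) * areaNorm G h := by
  have : IsFiniteMeasure (volume.restrict G) := ⟨by simpa using hG.lt_top⟩
  have h1 := integral_mul_norm_le_Lp_mul_Lq (μ := volume.restrict G) (f := fun _ => (1 : ℂ)) (g := h)
    Real.HolderConjugate.two_two (memLp_const 1) (by simpa using hh.2)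
  simpa [areaNorm, Real.sqrt_eq_rpow] using h1

/-- If `‖k‖ ≤ C` on a set of finite area, then pairing with `k` has norm at most `C √area`. -/
theorem InBergmanSpace.norm_areaInner_le {G : Set ℂ} {h k : ℂ → ℂ} (hh : InBergmanSpace G h)
    (hGm : MeasurableSet G) (hG : volume G ≠ ⊤) {C : ℝ} (h0 : 0 ≤ C) (hC : ∀ z ∈ G, ‖k z‖ ≤ C) :
    ‖areaInner G h k‖ ≤ √(volume.real G) * C * areaNorm G h := by
  refine (_root_.norm_areaInner_le hGm (hh.integrableOn hG) hC).trans ?_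
  calc C * ∫ x in G, ‖h x‖ ≤ C * (√(volume.real G) * areaNorm G h) := by
        gcongr; exact hh.integral_norm_le hG
    _ = _ := by ring

theorem exists_mul_norm_lt_one {B : ℂ} (hB : ‖B‖ < 1) : ∃ r : ℝ, 1 < r ∧ r * ‖B‖ < 1 := by
  have := norm_nonneg B
  refine ⟨2 / (1 + ‖B‖), ?_, ?_⟩
  · rw [lt_div_iff₀ (by linarith)]; linarith
  · rw [div_mul_eq_mul_div, div_lt_one (by linarith)]; linarith

/-- Extension to a neighbourhood of the closure, with the explicit error. -/
theorem IsRiemannMap.exists_kernel_extension {Ω G : Set ℂ} {a b : ℂ} {f F : ℂ → ℂ}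
    (hΩ : IsOpen Ω) (hG : IsProbeDomain Ω G a b) (hf : IsRiemannMap G a f)
    (hF : ∀ w ∈ ball (0 : ℂ) 1, F w ∈ G ∧ f (F w) = w) :
    ∃ U : Set ℂ, IsOpen U ∧ IsConnected U ∧ closure G ⊆ U ∧ U ⊆ Ω ∧
      ∃ (f₁ κb : ℂ → ℂ) (κa : ℕ → ℂ → ℂ),
        DifferentiableOn ℂ f₁ U ∧ EqOn f₁ f G ∧
        DifferentiableOn ℂ κb U ∧ EqOn κb (fun z => bergmanKernel G z b) G ∧
        (∀ n, DifferentiableOn ℂ (κa n) U ∧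
          EqOn (κa n) (kernelDeriv (bergmanKernel G) a n) G) ∧
        ∃ r M : ℝ, 1 < r ∧ r * ‖f b‖ < 1 ∧
          (∀ z ∈ U, ‖f₁ z‖ < r ∧ ‖deriv f₁ z‖ ≤ M) ∧
          ∀ N : ℕ, ∀ z ∈ U,
            κb z - ∑ n ∈ Finset.range (N + 1), approxCoeff f F a b N n * κa n z
              = conj (deriv f b) * deriv f₁ z * taylorRemainder N (f₁ z * conj (f b)) ∧
            ‖κb z - ∑ n ∈ Finset.range (N + 1), approxCoeff f F a b N n * κa n z‖
              ≤ ‖deriv f b‖ * M * remainderBound N (r * ‖f b‖) := by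
  have ha := hG.left_mem
  have hb := hG.right_mem
  obtain ⟨r, hr, hrB⟩ := exists_mul_norm_lt_one (hf.norm_lt_one hb)
  obtain ⟨U, f₁, M, hU, hUc, hGU, hUΩ, hf₁, hf₁f, hbd⟩ := hf.exists_extension hΩ hG hr
  have hd : EqOn (deriv f₁) (deriv f) G := hf₁f.deriv hG.isOpen
  have hd₁ := hf₁.deriv hU
  set κb : ℂ → ℂ := fun z => conj (deriv f b) * deriv f₁ z * diskKernel (f₁ z) (f b) with hκb
  set κa : ℕ → ℂ → ℂ := kernelDerivExtension f f₁ a with hκa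
  have hmaps : MapsTo f₁ U (ball 0 r) := fun z hz => mem_ball_zero_iff.2 (hbd z hz).1
  have hκbd : DifferentiableOn ℂ κb U :=
    (hd₁.const_mul _).mul ((differentiableOn_diskKernel hrB).comp hf₁ hmaps)
  have hκad : ∀ n, DifferentiableOn ℂ (κa n) U :=
    differentiableOn_kernelDerivExtension hU f hf₁ a
  have hκbe : EqOn κb (fun z => bergmanKernel G z b) G := fun z hz => by
    simp only [hκb, hd hz, hf₁f hz, hf.bergmanKernel_eq hG.isOpen hz hb]
  have hκae : ∀ n, EqOn (κa n) (kernelDeriv (bergmanKernel G) a n) G := fun n z hz => by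
    rw [hf.kernelDeriv_eq hG.isOpen hz ha]
    simp only [hκa, kernelDerivExtension, hd hz, hf₁f hz]
  -- Both sides are holomorphic on the connected set `U` and agree on `G`. The denominator of the
  -- remainder does not vanish because `‖f₁‖ < r` and `r * ‖f b‖ < 1`.
  have hid : ∀ N : ℕ, EqOn
      (fun z => κb z - ∑ n ∈ Finset.range (N + 1), approxCoeff f F a b N n * κa n z)
      (fun z => conj (deriv f b) * deriv f₁ z * taylorRemainder N (f₁ z * conj (f b))) U := by
    intro N
    have hne : ∀ z ∈ U, 1 - f₁ z * conj (f b) ≠ 0 := fun z hz =>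
      sub_ne_zero.2 (mul_conj_ne_one (hbd z hz).1 hrB).symm
    have hR : DifferentiableOn ℂ (fun z => taylorRemainder N (f₁ z * conj (f b))) U := by
      have h1 : DifferentiableOn ℂ (fun z => f₁ z * conj (f b)) U := hf₁.mul_const _
      exact (((((h1.pow _).const_mul _).sub ((h1.pow _).const_mul _)).const_mul _).div
        ((h1.const_sub 1).pow 2) fun z hz => pow_ne_zero 2 (hne z hz))
    refine AnalyticOnNhd.eqOn_of_preconnected_of_eventuallyEq
      ((hκbd.sub (DifferentiableOn.fun_sum fun n _ => (hκad n).const_mul _)).analyticOnNhd hU)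
      (((hd₁.const_mul _).mul hR).analyticOnNhd hU) hUc.isPreconnected
      (hGU (subset_closure ha)) ?_
    filter_upwards [hG.isOpen.mem_nhds ha] with z hz
    have := hf.bergmanKernel_sub_eq hG.isOpen hF ha hb hz N
    simp only [hκbe hz, hκae _ hz, hd hz, hf₁f hz, this]
  refine ⟨U, hU, hUc, hGU, hUΩ, f₁, κb, κa, hf₁, hf₁f, hκbd, hκbe, fun n => ⟨hκad n, hκae n⟩,
    r, M, hr, hrB, hbd, fun N z hz => ⟨hid N hz, ?_⟩⟩
  have h1 := hid N hz
  simp only at h1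
  rw [h1, norm_mul, norm_mul, Complex.norm_conj]
  have h2 := norm_taylorRemainder_mul_conj_le N (hbd z hz).1 hrB
  have h3 := (hbd z hz).2
  have h4 : 0 ≤ M := (norm_nonneg _).trans h3
  gcongr

theorem mainTheorem3 :
    -- the unit disc
    (IsBergmanKernel (ball 0 1) (bergmanKernel (ball 0 1)) ∧
      (∀ z ∈ ball (0 : ℂ) 1, ∀ w ∈ ball (0 : ℂ) 1,
        bergmanKernel (ball 0 1) z w = diskKernel z w) ∧
      (∀ z ∈ ball (0 : ℂ) 1, ∀ m : ℕ,
        kernelDeriv (bergmanKernel (ball 0 1)) 0 m z = kernelDeriv diskKernel 0 m z) ∧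
      (∀ (z : ℂ) (m : ℕ),
        kernelDeriv diskKernel 0 m z = (Real.pi : ℂ)⁻¹ * ((m + 1).factorial : ℂ) * z ^ m) ∧
      ∀ B ∈ ball (0 : ℂ) 1,
        (∀ (N : ℕ) (z : ℂ), z * conj B ≠ 1 →
          diskKernel z B - ∑ n ∈ Finset.range (N + 1),
              conj B ^ n / (n.factorial : ℂ) * kernelDeriv diskKernel 0 n z
            = taylorRemainder N (z * conj B)) ∧
        ∀ r : ℝ, 1 < r → r * ‖B‖ < 1 → ∀ ε : ℝ, 0 < ε → ∃ N₀ : ℕ, ∀ N ≥ N₀,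
          ∀ z ∈ ball (0 : ℂ) r, ‖taylorRemainder N (z * conj B)‖ < ε) ∧
    -- a bounded domain `Ω` and two distinct points of it
    ∀ (Ω : Set ℂ) (a b : ℂ), IsOpen Ω → IsConnected Ω → Bornology.IsBounded Ω →
      a ∈ Ω → b ∈ Ω → a ≠ b →
      (∃ G : Set ℂ, IsProbeDomain Ω G a b) ∧
      ∀ G : Set ℂ, IsProbeDomain Ω G a b →
        IsBergmanKernel G (bergmanKernel G) ∧
        (∃ f : ℂ → ℂ, IsRiemannMap G a f) ∧
        ∀ f F : ℂ → ℂ, IsRiemannMap G a f →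
          (∀ w ∈ ball (0 : ℂ) 1, F w ∈ G ∧ f (F w) = w) →
          -- the transformation formulas
          (∀ z ∈ G, ∀ w ∈ ball (0 : ℂ) 1,
            deriv f z * bergmanKernel (ball 0 1) (f z) w
              = bergmanKernel G z (F w) * conj (deriv F w)) ∧
          (∀ z ∈ G, conj (deriv f b) * deriv f z * bergmanKernel (ball 0 1) (f z) (f b)
              = bergmanKernel G z b) ∧
          (∀ z ∈ G, ∀ m : ℕ,
            deriv f z * kernelDeriv (bergmanKernel (ball 0 1)) 0 m (f z)
              = (dbar^[m] (fun w => bergmanKernel G z (F w) * conj (deriv F w))) 0 ∧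
            deriv f z * kernelDeriv (bergmanKernel (ball 0 1)) 0 m (f z)
              = ∑ n ∈ Finset.range (m + 1),
                  pullbackCoeff F a m n * kernelDeriv (bergmanKernel G) a n z) ∧
          -- `f`, `K̃_b` and all `K̃_a^n` extend holomorphically to a neighbourhood `U` of the
          -- closure of `G`, on which the approximation is uniform with explicit error
          (∃ U : Set ℂ, IsOpen U ∧ IsConnected U ∧ closure G ⊆ U ∧ U ⊆ Ω ∧
            ∃ (f₁ κb : ℂ → ℂ) (κa : ℕ → ℂ → ℂ),
              DifferentiableOn ℂ f₁ U ∧ EqOn f₁ f G ∧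
              DifferentiableOn ℂ κb U ∧ EqOn κb (fun z => bergmanKernel G z b) G ∧
              (∀ n, DifferentiableOn ℂ (κa n) U ∧
                EqOn (κa n) (kernelDeriv (bergmanKernel G) a n) G) ∧
              (∃ r M : ℝ, 1 < r ∧ r * ‖f b‖ < 1 ∧
                (∀ z ∈ U, ‖f₁ z‖ < r ∧ ‖deriv f₁ z‖ ≤ M) ∧
                ∀ N : ℕ, ∀ z ∈ U,
                  κb z - ∑ n ∈ Finset.range (N + 1), approxCoeff f F a b N n * κa n z
                    = conj (deriv f b) * deriv f₁ z * taylorRemainder N (f₁ z * conj (f b)) ∧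
                  ‖κb z - ∑ n ∈ Finset.range (N + 1), approxCoeff f F a b N n * κa n z‖
                    ≤ ‖deriv f b‖ * M * remainderBound N (r * ‖f b‖)) ∧
              ∀ ε : ℝ, 0 < ε → ∃ N₀ : ℕ, ∀ N ≥ N₀, ∀ z ∈ U,
                ‖κb z - ∑ n ∈ Finset.range (N + 1), approxCoeff f F a b N n * κa n z‖ < ε) ∧
          -- the resulting approximate quadrature identity on `G`
          (∀ (N : ℕ) (h : ℂ → ℂ), InBergmanSpace G h →
            h b - ∑ n ∈ Finset.range (N + 1),
                conj (approxCoeff f F a b N n) * iteratedDeriv n h a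
              = areaInner G h (fun z => bergmanKernel G z b - ∑ n ∈ Finset.range (N + 1),
                  approxCoeff f F a b N n * kernelDeriv (bergmanKernel G) a n z)) ∧
          ∀ ε : ℝ, 0 < ε → ∃ N₀ : ℕ, ∀ N ≥ N₀, ∀ h : ℂ → ℂ, InBergmanSpace G h →
            ‖h b - ∑ n ∈ Finset.range (N + 1),
                conj (approxCoeff f F a b N n) * iteratedDeriv n h a‖ ≤ ε * areaNorm G h := by
  refine ⟨⟨isBergmanKernel_diskKernel.bergmanKernel,
    fun z hz w hw => isBergmanKernel_diskKernel.bergmanKernel_eq hz hw,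
    fun z hz m => isBergmanKernel_diskKernel.kernelDeriv_eq isOpen_ball hz
      (mem_ball_self one_pos) m,
    kernelDeriv_diskKernel, fun B _ => ⟨fun N z hz => diskKernel_sub_taylor B N z hz,
      fun r hr hrB ε hε =>
        exists_forall_norm_taylorRemainder_lt B (zero_le_one.trans hr.le) hrB hε⟩⟩, ?_⟩
  intro Ω a b hΩ hΩc hΩb ha hb _
  refine ⟨exists_isProbeDomain hΩ hΩc hΩb ha hb, fun G hG => ?_⟩
  have hGb : Bornology.IsBounded G := hΩb.subset (subset_closure.trans hG.closure_subset)
  have hGo := hG.isOpen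
  obtain ⟨f₀, hf₀⟩ := exists_isRiemannMap hGo hG.simplyConnected hGb hG.left_mem
  refine ⟨(exists_isBergmanKernel_transportedKernel hGo hf₀).bergmanKernel, ⟨f₀, hf₀⟩,
    fun f F hf hF => ?_⟩
  have hK : ∀ z ∈ G, ∀ w ∈ ball (0 : ℂ) 1, bergmanKernel (ball 0 1) (f z) w = diskKernel (f z) w :=
    fun z hz w hw => isBergmanKernel_diskKernel.bergmanKernel_eq (hf.bijOn.mapsTo hz) hw
  have hKd : ∀ z ∈ G, ∀ m, kernelDeriv (bergmanKernel (ball 0 1)) 0 m (f z)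
      = kernelDeriv diskKernel 0 m (f z) := fun z hz m =>
    isBergmanKernel_diskKernel.kernelDeriv_eq isOpen_ball (hf.bijOn.mapsTo hz)
      (mem_ball_self one_pos) m
  obtain ⟨U, hU, hUc, hGU, hUΩ, f₁, κb, κa, hf₁, hf₁f, hκb, hκbe, hκa, r, M, hr, hrB, hbd, hN⟩ :=
    hf.exists_kernel_extension hΩ hG hF
  have hρ : 0 ≤ r * ‖f b‖ := mul_nonneg (zero_le_one.trans hr.le) (norm_nonneg _)
  refine ⟨fun z hz w hw => ?_, fun z hz => ?_, fun z hz m => ⟨?_, ?_⟩,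
    ⟨U, hU, hUc, hGU, hUΩ, f₁, κb, κa, hf₁, hf₁f, hκb, hκbe, hκa, ⟨r, M, hr, hrB, hbd, hN⟩,
      fun ε hε => ?_⟩,
    fun N h hh => hf.sub_sum_eq_areaInner hGo hF hG.left_mem hG.right_mem N hh, fun ε hε => ?_⟩
  · rw [hK z hz w hw, hf.deriv_mul_diskKernel hGo hF hz hw]
  · rw [hK z hz _ (hf.bijOn.mapsTo hG.right_mem), hf.bergmanKernel_eq hGo hz hG.right_mem]
  · rw [hKd z hz, hf.dbar_iterate_pullback hGo hF hz]
  · rw [hKd z hz, hf.deriv_mul_kernelDeriv hGo hF hG.left_mem hz]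
  · obtain ⟨N₀, h0⟩ := exists_forall_remainderBound_lt hρ hrB (‖deriv f b‖ * M) hε
    exact ⟨N₀, fun N hN₀ z hz => (hN N z hz).2.trans_lt (h0 N hN₀)⟩
  -- The factor `√area` comes from Cauchy–Schwarz, which bounds the `L¹` norm of `h` by its `L²`
  -- norm.
  · obtain ⟨N₀, h0⟩ := exists_forall_remainderBound_lt hρ hrB
      (√(volume.real G) * (‖deriv f b‖ * M)) hε
    refine ⟨N₀, fun N hN₀ h hh => ?_⟩
    rw [hf.sub_sum_eq_areaInner hGo hF hG.left_mem hG.right_mem N hh]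
    have hC : ∀ z ∈ G, ‖bergmanKernel G z b - ∑ n ∈ Finset.range (N + 1),
        approxCoeff f F a b N n * kernelDeriv (bergmanKernel G) a n z‖
          ≤ ‖deriv f b‖ * M * remainderBound N (r * ‖f b‖) := fun z hz => by
      have h1 := (hN N z (hGU (subset_closure hz))).2
      simp only [hκbe hz, (hκa _).2 hz] at h1
      exact h1
    refine (hh.norm_areaInner_le hGo.measurableSet hGb.measure_lt_top.ne
      ((norm_nonneg _).trans (hC b hG.right_mem)) hC).trans ?_
    refine mul_le_mul_of_nonneg_right ?_ (Real.sqrt_nonneg _)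
    rw [← mul_assoc]
    exact (h0 N hN₀).le
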